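/- **Setting.** For $n\ge2$ let $\mathcal Z_n$ be the set of $(\mathbf x,\mathbf b)\in\mathbb R^n\times\{-1,0,1\}^n$ such that $x_i>x_j$ whenever $i>j$ and $b_ib_j\ne0$. Fix $T>0$. A *solution* of the particle system on $[0,T]$ with initial datum $(\mathbf x^\circ,\mathbf b^\circ)\in\mathcal Z_n$ is a map $(\mathbf x,\mathbf b):[0,T]\to\mathcal Z_n$ for which there is a finite set $S\subset(0,T]$ such that: each $x_i$ is continuous on $[0,T]$ and $C^1$ on $[0,T]\setminus S$; each $b_i$ is right-continuous with left limits; $(\mathbf x(0),\mathbf b(0))=(\mathbf x^\circ,\mathbf b^\circ)$; each $b_i$ jumps at most once, and if it jumps at $t$ then $t\in S$, $|b_i(t-)|=1$ and $b_i(t)=0$; for all $\tau\in S$, $y\in\mathbb R$ one has $\sum_{i:\,x_i(\tau)=y}(b_i(\tau)-b_i(\tau-))=0$; and on $(0,T)\setminus S$ $$\frac{dx_i}{dt}=\frac1n\sum_{j\ne i}\frac{b_ib_j}{x_i-x_j},\qquad i=1,\dots,n$$ (summands with $b_ib_j=0$ are $0$). The empirical measure of $(\mathbf x,\mathbf b)$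 is the signed measure $\frac1n\sum_{i=1}^n b_i\delta_{x_i}$. A *modulus of continuity* is a nondecreasing $\omega:[0,\infty)\to[0,\infty)$ with $\omega(0)=0$ that is continuous at $0$. Given real numbers $s_n\to0$ and a modulus $\omega$, we say that finite signed measures $\mu_n$ ($n\ge2$) on $\mathbb R$ *converge to $\mu$ with data $(s_n),\omega$* if (a) $\int\varphi\,d\mu_n\to\int\varphi\,d\mu$ for every bounded continuous $\varphi$, (b) $\mu$ has no atoms, (c) $|\mu_n((x,y])|\le s_n+\omega(|x-y|)$ for all $n\ge 2$ and $x\le y$. Let $Q=(0,\infty)\times\mathbb R$ and consider $$u_t=\mathcal I[u]\,|u_x|\ \text{ on }Q,\qquad \mathcal I[w](x)=\int_{\mathbb R}\big(w(x+z)-w(x)-zw'(x)\big)\frac{dz}{z^2}.\tag{HJ}$$ For $\rho>0$ put $$H_\rho[\phi,u](t,x)=\Big(\int_{|z|<\rho}\big(\phi(t,x+z)-\phi(t,x)-\phi_x(t,x)z\big)\frac{dz}{z^2}+\int_{|z|\ge\rho}\big(u(t,x+z)-u(t,x)\big)\frac{dz}{z^2}\Big)|\phi_x(t,x)|.$$ A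 bounded upper semicontinuous $u:Q\to\mathbb R$ is a *$\rho$-subsolution* of (HJ) if, whenever $\phi\in C^2(Q)$ and $u-\phi$ has a global maximum over $Q$ at $(\bar t,\bar x)\in Q$: $\phi_t(\bar t,\bar x)\le H_\rho[\phi,u](\bar t,\bar x)$ if $\phi_x(\bar t,\bar x)\ne0$, and $\phi_t(\bar t,\bar x)\le0$ if $\phi(t,x)=c|x-\bar x|^4+g(t)$ on $Q$ for some $c\in\mathbb R$ and some function $g$. A bounded lower semicontinuous function is a *$\rho$-supersolution* if the same holds with minima in place of maxima and the inequalities reversed. A bounded $u:Q\to\mathbb R$ is a *$\rho$-solution* if its upper semicontinuous envelope $u^*$ is a $\rho$-subsolution and its lower semicontinuous envelope $u_*$ is a $\rho$-supersolution. It has *initial datum* $u^\circ$ if $u^*(0,\cdot)=u_*(0,\cdot)=u^\circ$, where $u^*(0,x)$ and $u_*(0,x)$ are the upper and lower limits of $u$ at $(0,x)$ along $Q$. **Corollary 5.6.** For $n\ge2$ let $(\mathbf x_n^\circ,\mathbf b_n^\circ)\in\mathcal Z_n$ have empirical measure $\kappa_n^\circ$, and suppose that $\kappa_n^\circ$ converges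 to a finite signed measure $\kappa^\circ$ with some data $s_n\to0$ and $\omega$. Let $(\mathbf x_n,\mathbf b_n)$ be a solution of the particle system on $[0,T]$ with initial datum $(\mathbf x_n^\circ,\mathbf b_n^\circ)$, and let $\kappa_n(t)$ be the empirical measure of $(\mathbf x_n(t),\mathbf b_n(t))$. Then there are finite signed measures $\kappa(t)$, $t\in[0,T]$, and a function $u:[0,\infty)\times\mathbb R\to\mathbb R$ such that: 1. there are a sequence $s_n\to0$ and a modulus $\omega$ such that for every $t\in[0,T]$ and every sequence $t_n\to t$ in $[0,T]$, $\kappa_n(t_n)$ converges to $\kappa(t)$ with data $(s_n),\omega$; moreover the family $\{\kappa_n(t)\}_{n\ge2,\,t\in[0,T]}$ is bounded in total variation and tight; 2. $u(t,x)=\kappa(t,(-\infty,x])$ for all $t\in[0,T]$, $x\in\mathbb R$, and $\kappa(t)$, $t\in[0,T]$, is the only family of finite signed measures with this property; 3. $u(0,x)=u^\circ(x):=\kappa^\circ((-\infty,x])$ for all $x$, and $u$ is the unique viscosity solution of (HJ) on $Q$ with initial datum $u^\circ$: it is a $\rho$-solution with initial datum $u^\circ$ for every $\rho>0$, and every $\rho$-solution,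 for any $\rho>0$, with initial datum $u^\circ$ equals $u$ on $Q$. -/

import Mathlib

open MeasureTheory Set Filter Topology

noncomputable section

namespace ChargedParticles

/-! ### The annihilating particle system -/

/-- The state space: positions `x` and charges `b` in `{-1, 0, 1}` such that the charged particles
are strictly ordered from left to right by their index (neutral particles are unconstrained). -/
def IsState {n : ℕ} (x : Fin n → ℝ) (b : Fin n → ℤ) : Prop :=
  (∀ i, b i = -1 ∨ b i = 0 ∨ b i = 1) ∧ ∀ i j, j < i → b i * b j ≠ 0 → x j < x i

/-- The left limit `b_i(t-)` of the `i`-th charge. -/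
def leftCharge {n : ℕ} (b : ℝ → Fin n → ℤ) (t : ℝ) (i : Fin n) : ℤ :=
  Function.leftLim (fun s => b s i) t

/-- `(x, b)` solves the particle system on `[0, T]` with initial datum `(x₀, b₀)` and with the
finite set `S ⊆ (0, T]` as set of exceptional times. Only the values of `x` and `b` on `[0, T]`
matter. In the differential equation the summands with `b i * b j = 0` vanish; in all others
`x i ≠ x j` because of `state`. -/
structure IsSolutionWith {n : ℕ} (T : ℝ) (x₀ : Fin n → ℝ) (b₀ : Fin n → ℤ)
    (x : ℝ → Fin n → ℝ) (b : ℝ → Fin n → ℤ) (S : Finset ℝ) : Prop where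
  exceptional : ∀ τ ∈ S, τ ∈ Ioc 0 T
  state : ∀ t ∈ Icc 0 T, IsState (x t) (b t)
  continuousOn : ∀ i, ContinuousOn (fun t => x t i) (Icc 0 T)
  contDiffOn : ∀ i, ContDiffOn ℝ 1 (fun t => x t i) (Icc 0 T \ ↑S)
  rightContinuous : ∀ i, ∀ t ∈ Icc 0 T, ContinuousWithinAt (fun s => b s i) (Icc t T) t
  hasLeftLimits : ∀ i, ∀ t ∈ Ioc 0 T, ∃ l : ℤ, Tendsto (fun s => b s i) (𝓝[<] t) (𝓝 l)
  initial_pos : x 0 = x₀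
  initial_charge : b 0 = b₀
  jump_once : ∀ i, {t | t ∈ Ioc 0 T ∧ leftCharge b t i ≠ b t i}.Subsingleton
  jump : ∀ i, ∀ t ∈ Ioc 0 T, leftCharge b t i ≠ b t i →
    t ∈ S ∧ |leftCharge b t i| = 1 ∧ b t i = 0
  annihilation : ∀ τ ∈ S, ∀ y : ℝ,
    ∑ i with x τ i = y, (b τ i - leftCharge b τ i) = 0
  ode : ∀ t ∈ Ioo 0 T \ ↑S, ∀ i, HasDerivAt (fun s => x s i)
    ((1 / n) * ∑ j with j ≠ i, (b t i * b t j : ℝ) / (x t i - x t j)) t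

/-- `(x, b)` is a solution of the particle system with annihilation on `[0, T]`. -/
def IsSolution {n : ℕ} (T : ℝ) (x₀ : Fin n → ℝ) (b₀ : Fin n → ℤ)
    (x : ℝ → Fin n → ℝ) (b : ℝ → Fin n → ℤ) : Prop :=
  ∃ S : Finset ℝ, IsSolutionWith T x₀ b₀ x b S

/-- The signed empirical measure `(1/n) ∑ i, b i • δ_{x i}`. -/
def empirical {n : ℕ} (x : Fin n → ℝ) (b : Fin n → ℤ) : SignedMeasure ℝ :=
  ∑ i, VectorMeasure.dirac (x i) ((b i : ℝ) / n)

/-! ### Convergence of signed measures -/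

/-- A modulus of continuity: a nondecreasing function on `[0, ∞)` that vanishes at `0` and is
continuous there. -/
def IsModulus (ω : ℝ → ℝ) : Prop :=
  MonotoneOn ω (Ici 0) ∧ ω 0 = 0 ∧ ContinuousWithinAt ω (Ici 0) 0

/-- Convergence `μ n → ν` with given equicontinuity data `s`, `ω`: narrow convergence, no atoms in
the limit, and `|μ n (x, y]| ≤ s n + ω |x - y|`. The sequences in question start at `n = 2`. -/
def ConvergesWith (s : ℕ → ℝ) (ω : ℝ → ℝ) (μ : ℕ → SignedMeasure ℝ) (ν : SignedMeasure ℝ) : Prop :=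
  (∀ φ : BoundedContinuousFunction ℝ ℝ,
    Tendsto (fun n => (μ n).integral φ (ContinuousLinearMap.lsmul ℝ ℝ)) atTop
      (𝓝 (ν.integral φ (ContinuousLinearMap.lsmul ℝ ℝ)))) ∧
  (∀ x : ℝ, ν {x} = 0) ∧
  ∀ n ≥ 2, ∀ x y : ℝ, x ≤ y → |μ n (Ioc x y)| ≤ s n + ω |x - y|

/-! ### The limiting Hamilton-Jacobi equation -/

/-- The open half plane `Q = (0, ∞) × ℝ` of points `(t, x)`. -/
def Q : Set (ℝ × ℝ) := Ioi 0 ×ˢ univ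

/-- The time derivative of `φ`. -/
def dt (φ : ℝ × ℝ → ℝ) (t x : ℝ) : ℝ := deriv (fun s => φ (s, x)) t

/-- The space derivative of `φ`. -/
def dx (φ : ℝ × ℝ → ℝ) (t x : ℝ) : ℝ := deriv (fun y => φ (t, y)) x

/-- The Hamiltonian with the test function `φ` near the singularity of the kernel and `u` away
from it. -/
def hamiltonian (ρ : ℝ) (φ u : ℝ × ℝ → ℝ) (t x : ℝ) : ℝ :=
  ((∫ z in Ioo (-ρ) ρ, (φ (t, x + z) - φ (t, x) - dx φ t x * z) / z ^ 2) +
    ∫ z in (Ioo (-ρ) ρ)ᶜ, (u (t, x + z) - u (t, x)) / z ^ 2) * |dx φ t x|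

def BoundedOnQ (u : ℝ × ℝ → ℝ) : Prop := ∃ C, ∀ p ∈ Q, |u p| ≤ C

/-- `φ(s, y) = c |y - x|⁴ + g(s)` on `Q`. -/
def IsQuarticAt (φ : ℝ × ℝ → ℝ) (x : ℝ) : Prop :=
  ∃ (c : ℝ) (g : ℝ → ℝ), ∀ s > 0, ∀ y, φ (s, y) = c * |y - x| ^ 4 + g s

/-- `ρ`-subsolutions in `Q`. Test functions whose space derivative vanishes at the point of contact
and which are not of the quartic form impose no condition. -/
def IsSubsolution (ρ : ℝ) (u : ℝ × ℝ → ℝ) : Prop :=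
  UpperSemicontinuousOn u Q ∧ BoundedOnQ u ∧
  ∀ φ : ℝ × ℝ → ℝ, ContDiffOn ℝ 2 φ Q →
    ∀ t x : ℝ, (t, x) ∈ Q → IsMaxOn (fun p => u p - φ p) Q (t, x) →
      (dx φ t x ≠ 0 → dt φ t x ≤ hamiltonian ρ φ u t x) ∧ (IsQuarticAt φ x → dt φ t x ≤ 0)

/-- `ρ`-supersolutions in `Q`. -/
def IsSupersolution (ρ : ℝ) (v : ℝ × ℝ → ℝ) : Prop :=
  LowerSemicontinuousOn v Q ∧ BoundedOnQ v ∧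
  ∀ ψ : ℝ × ℝ → ℝ, ContDiffOn ℝ 2 ψ Q →
    ∀ t x : ℝ, (t, x) ∈ Q → IsMinOn (fun p => v p - ψ p) Q (t, x) →
      (dx ψ t x ≠ 0 → hamiltonian ρ ψ v t x ≤ dt ψ t x) ∧ (IsQuarticAt ψ x → 0 ≤ dt ψ t x)

/-- The upper semicontinuous envelope of a bounded function on `Q`, extended to the closure of `Q`;
it only depends on the values of `u` on `Q`. -/
def upperEnvelope (u : ℝ × ℝ → ℝ) (p : ℝ × ℝ) : ℝ := limsup u (𝓝[Q] p)

/-- The lower semicontinuous envelope of a bounded function on `Q`, extended to the closure of `Q`;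
it only depends on the values of `u` on `Q`. -/
def lowerEnvelope (u : ℝ × ℝ → ℝ) (p : ℝ × ℝ) : ℝ := liminf u (𝓝[Q] p)

/-- `u` is a viscosity `ρ`-solution in `Q` (no continuity required). -/
def IsViscositySolution (ρ : ℝ) (u : ℝ × ℝ → ℝ) : Prop :=
  BoundedOnQ u ∧ IsSubsolution ρ (upperEnvelope u) ∧ IsSupersolution ρ (lowerEnvelope u)

/-- Both envelopes of `u` attain the initial datum `u₀` at `t = 0`. -/
def HasInitialDatum (u : ℝ × ℝ → ℝ) (u₀ : ℝ → ℝ) : Prop :=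
  ∀ x, upperEnvelope u (0, x) = u₀ x ∧ lowerEnvelope u (0, x) = u₀ x

end ChargedParticles

end

open MeasureTheory Set Filter Topology

noncomputable section

namespace ChargedParticles

/-! ### The truncated kernel -/

/-! Everything is compared with one solution `W` of the limiting equation, which is built by hand
and is uniformly continuous in time and space.

Construction. An explicit upwind scheme with truncated kernel is monotone under a time step
restriction (`step_mono`) and commutes with translations, with the addition of constants and with
reflection. Hence it is nonexpansive in the sup norm and passes on the spatial modulus of the datum,
and a barrier yields a modulus in time (`scheme_equicontinuous`). A subsequence converges to some
`W`. Monotonicity and consistency make `W` a subsolution (`IsSchemeLimit.isSubsolution`), and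
reflection makes it a supersolution.

Comparison. In `doubling` the penalty is c(x - y)⁴ + c(t + r - s)². At a maximum both slopes agree
in modulus, the outer nonlocal terms add up to something nonpositive by translation invariance, and
the inner terms of a quartic are small for a small radius. If the slope vanishes then x = y, which
is exactly the case covered by the quartic condition in the definition. So only quartic test
functions are ever needed (`QuarticSub`), and approximate subsolutions are admissible. Every other
solution is compared with `W` only, whose uniform continuity controls the error; this gives
uniqueness.

Particles. The upper envelope of the cumulative charge is an approximate subsolution
(`IsSlab.quarticSub`). When a quartic touches it at a charged particle, the differential equation
turns the time derivative of the test function into the force on the particle, and the force is a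
singular integral of the cumulative charge (`integral_cnt_div_sq`). Its singular part is controlled
because an integer valued function under a parabola with nonzero slope exceeds the smooth bound only
on short intervals (`setIntegral_div_sq_le`). Annihilations conserve the cumulative charge, so the
doubling estimate survives the exceptional times (`IsSolutionWith.doubled_le`). Reversing all
charges gives the opposite bound, hence uniform convergence of the cumulative functions to `W`.

Measures. Narrow convergence of the initial measures excludes loss of mass at infinity by a gliding
hump, and with the equicontinuity it gives uniform convergence of the initial cumulative functions.
A symmetrized moment estimate keeps the measures tight. The functions `W(t, ·)` are limits of
functions of variation at most one, so they are cumulative functions of signed measures. -/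

/-- The part of the nonlocal operator away from the singularity. -/
def outer (ρ : ℝ) (f : ℝ → ℝ) (x : ℝ) : ℝ :=
  ∫ z in (Ioo (-ρ) ρ)ᶜ, (f (x + z) - f x) / z ^ 2

lemma integrableOn_inv_sq_Ioi {ρ : ℝ} (hρ : 0 < ρ) :
    IntegrableOn (fun z : ℝ => 1 / z ^ 2) (Ioi ρ) := by
  refine (integrableOn_Ioi_rpow_of_lt (a := -2) (by norm_num) hρ).congr_fun ?_ measurableSet_Ioi
  intro z hz
  have hz' : 0 < z := hρ.trans hz
  simp only
  rw [Real.rpow_neg hz'.le, one_div]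
  norm_cast

lemma integral_inv_sq_Ioi {ρ : ℝ} (hρ : 0 < ρ) : ∫ z in Ioi ρ, 1 / z ^ 2 = 1 / ρ := by
  have h := integral_Ioi_rpow_of_lt (a := -2) (by norm_num) hρ
  rw [← setIntegral_congr_fun measurableSet_Ioi (f := fun z : ℝ => z ^ (-2 : ℝ))]
  · rw [h]
    norm_num
    rw [Real.rpow_neg_one]
  · intro z hz
    have hz' : 0 < z := hρ.trans hz
    simp only
    rw [Real.rpow_neg hz'.le, one_div]
    norm_cast

lemma compl_Ioo_eq (ρ : ℝ) : (Ioo (-ρ) ρ)ᶜ = Iic (-ρ) ∪ Ici ρ := by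
  ext z
  simp only [mem_compl_iff, mem_Ioo, not_and, not_lt, mem_union, mem_Iic, mem_Ici]
  constructor
  · intro h
    by_cases h' : z ≤ -ρ
    · exact Or.inl h'
    · exact Or.inr (h (not_le.1 h'))
  · rintro (h | h) h'
    · exact absurd h (not_le.2 h')
    · exact h

lemma integrableOn_inv_sq_Ici {ρ : ℝ} (hρ : 0 < ρ) :
    IntegrableOn (fun z : ℝ => 1 / z ^ 2) (Ici ρ) :=
  (integrableOn_Ici_iff_integrableOn_Ioi).2 (integrableOn_inv_sq_Ioi hρ)

lemma integrableOn_inv_sq_Iic {ρ : ℝ} (hρ : 0 < ρ) :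
    IntegrableOn (fun z : ℝ => 1 / z ^ 2) (Iic (-ρ)) := by
  have h := (integrableOn_inv_sq_Ici hρ).comp_neg
  simpa using h

lemma integrableOn_inv_sq {ρ : ℝ} (hρ : 0 < ρ) :
    IntegrableOn (fun z : ℝ => 1 / z ^ 2) (Ioo (-ρ) ρ)ᶜ := by
  rw [compl_Ioo_eq]
  exact (integrableOn_inv_sq_Iic hρ).union (integrableOn_inv_sq_Ici hρ)

/-- An integral against the truncated kernel folds to one over a half line. -/
lemma integral_compl_Ioo_eq {ρ : ℝ} (hρ : 0 < ρ) {g : ℝ → ℝ}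
    (hg : IntegrableOn g (Ioo (-ρ) ρ)ᶜ) :
    ∫ z in (Ioo (-ρ) ρ)ᶜ, g z = ∫ z in Ioi ρ, (g z + g (-z)) := by
  rw [compl_Ioo_eq] at hg ⊢
  have h1 : IntegrableOn g (Iic (-ρ)) := hg.mono_set subset_union_left
  have h2 : IntegrableOn g (Ioi ρ) :=
    hg.mono_set (Ioi_subset_Ici_self.trans subset_union_right)
  have h3 : IntegrableOn (fun z => g (-z)) (Ioi ρ) := by
    have := h1.comp_neg
    simp only [neg_Iic, neg_neg] at this
    exact this.mono_set Ioi_subset_Ici_self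
  have hd : Disjoint (Iic (-ρ)) (Ici ρ) := by
    rw [Set.disjoint_left]
    intro z hz hz'
    have a : z ≤ -ρ := hz
    have b : ρ ≤ z := hz'
    linarith
  rw [setIntegral_union hd measurableSet_Ici h1 (hg.mono_set subset_union_right),
    integral_add h2 h3, integral_Ici_eq_integral_Ioi, integral_comp_neg_Ioi, add_comm]

lemma integral_inv_sq {ρ : ℝ} (hρ : 0 < ρ) : ∫ z in (Ioo (-ρ) ρ)ᶜ, 1 / z ^ 2 = 2 / ρ := by
  rw [integral_compl_Ioo_eq hρ (integrableOn_inv_sq hρ)]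
  simp only [neg_sq]
  rw [integral_add (integrableOn_inv_sq_Ioi hρ) (integrableOn_inv_sq_Ioi hρ),
    integral_inv_sq_Ioi hρ]
  ring

lemma integrableOn_div_sq {ρ C : ℝ} (hρ : 0 < ρ) {g : ℝ → ℝ} (hg : Measurable g)
    (hC : ∀ z, |g z| ≤ C) : IntegrableOn (fun z => g z / z ^ 2) (Ioo (-ρ) ρ)ᶜ := by
  refine Integrable.mono' ((integrableOn_inv_sq hρ).const_mul C)
    (hg.div (by fun_prop)).aestronglyMeasurable (Eventually.of_forall fun z => ?_)
  rw [Real.norm_eq_abs, abs_div, abs_of_nonneg (sq_nonneg z), mul_one_div]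
  exact div_le_div_of_nonneg_right (hC z) (sq_nonneg z)

lemma integrableOn_outer {ρ C : ℝ} (hρ : 0 < ρ) {f : ℝ → ℝ} (hf : Measurable f)
    (hC : ∀ x, |f x| ≤ C) (x : ℝ) :
    IntegrableOn (fun z => (f (x + z) - f x) / z ^ 2) (Ioo (-ρ) ρ)ᶜ := by
  refine integrableOn_div_sq (C := 2 * C) hρ (by fun_prop) fun z => ?_
  have := abs_sub (f (x + z)) (f x)
  linarith [hC (x + z), hC x]

lemma abs_outer_le {ρ C : ℝ} (hρ : 0 < ρ) {f : ℝ → ℝ} (hC : ∀ x, |f x| ≤ C) (x : ℝ) :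
    |outer ρ f x| ≤ 4 * C / ρ := by
  have h : ‖∫ z in (Ioo (-ρ) ρ)ᶜ, (f (x + z) - f x) / z ^ 2‖
      ≤ ∫ z in (Ioo (-ρ) ρ)ᶜ, 2 * C * (1 / z ^ 2) := by
    refine norm_integral_le_of_norm_le ((integrableOn_inv_sq hρ).const_mul _)
      (Eventually.of_forall fun z => ?_)
    rw [Real.norm_eq_abs, abs_div, abs_of_nonneg (sq_nonneg z), mul_one_div]
    refine div_le_div_of_nonneg_right ?_ (sq_nonneg z)
    have := abs_sub (f (x + z)) (f x)
    linarith [hC (x + z), hC x]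
  rw [integral_const_mul, integral_inv_sq hρ] at h
  refine h.trans (le_of_eq ?_)
  ring

lemma outer_neg (ρ : ℝ) (f : ℝ → ℝ) (x : ℝ) : outer ρ (fun y => -f y) x = -outer ρ f x := by
  unfold outer
  rw [← integral_neg]
  congr 1
  ext z
  ring

/-- The hypothesis holds at a maximum of f(x) + g(y) minus a penalty in x - y, because translating
both points by z leaves the penalty unchanged. This is how the nonlocal terms drop out of the
doubling argument. -/
lemma outer_add_outer_nonpos {ρ C : ℝ} (hρ : 0 < ρ) {f g : ℝ → ℝ} (hf : Measurable f)
    (hg : Measurable g) (hfC : ∀ x, |f x| ≤ C) (hgC : ∀ x, |g x| ≤ C) {x y : ℝ}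
    (h : ∀ z, f (x + z) + g (y + z) ≤ f x + g y) : outer ρ f x + outer ρ g y ≤ 0 := by
  unfold outer
  rw [← integral_add (integrableOn_outer hρ hf hfC x) (integrableOn_outer hρ hg hgC y)]
  refine integral_nonpos fun z => ?_
  simp only [Pi.zero_apply]
  rw [← add_div]
  exact div_nonpos_of_nonpos_of_nonneg (by linarith [h z]) (sq_nonneg z)

/-! ### Quartic test functions and doubling of variables -/

/-- Approximate subsolutions, tested from above with quartic functions only. -/
def QuarticSub (c κ ρ : ℝ) (I : Set ℝ) (U : ℝ × ℝ → ℝ) : Prop :=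
  ∀ t ∈ I, ∀ (x y₀ : ℝ) (g : ℝ → ℝ), |x - y₀| ≤ 1 → ContDiffOn ℝ 2 g I →
    (∀ s ∈ I, ∀ y, U (s, y) - c * (y - y₀) ^ 4 - g s ≤ U (t, x) - c * (x - y₀) ^ 4 - g t) →
    deriv g t ≤ |4 * c * (x - y₀) ^ 3| * outer ρ (fun y => U (t, y)) x + κ

lemma upperSemicontinuous_slice {U : ℝ × ℝ → ℝ} {J : Set ℝ}
    (hU : UpperSemicontinuousOn U (J ×ˢ univ)) {t : ℝ} (ht : t ∈ J) :
    UpperSemicontinuous fun y => U (t, y) := by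
  intro y a ha
  have h := hU (t, y) ⟨ht, mem_univ _⟩ a ha
  have hc : Tendsto (fun y' : ℝ => (t, y')) (𝓝 y) (𝓝[J ×ˢ univ] (t, y)) :=
    tendsto_nhdsWithin_iff.2 ⟨(Continuous.prodMk_right t).tendsto y,
      Eventually.of_forall fun y' => ⟨ht, mem_univ _⟩⟩
  exact hc.eventually h

/-- Doubling of variables: the doubled difference of an approximate subsolution `U` and of `W`,
for which `-W` is an approximate subsolution, stays below its bound at the initial time. -/
theorem doubling {U W : ℝ × ℝ → ℝ} {C c η r κ ρ M σ : ℝ} {I K : Set ℝ} {P : ℝ → ℝ}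
    (hr : 0 < r) (hρ : 0 < ρ) (hσ : 0 ≤ σ) (hI : I ⊆ Ioi σ) (hIo : IsOpen I)
    (hU : UpperSemicontinuousOn U (insert σ I ×ˢ univ))
    (hUC : ∀ t ∈ insert σ I, ∀ x, |U (t, x)| ≤ C)
    (hW : ContinuousOn W (Ici 0 ×ˢ univ)) (hWC : ∀ t ≥ 0, ∀ x, |W (t, x)| ≤ C)
    (hP0 : ∀ t ∈ insert σ I, 0 ≤ P t) (hP : ContinuousOn P (insert σ I))
    (hP2 : ContDiffOn ℝ 2 P I) (hP' : ∀ t ∈ I, η ≤ deriv P t)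
    (hK : IsCompact K) (hKs : K ⊆ insert σ I) (hPK : ∀ t ∈ insert σ I, t ∉ K → 2 * C ≤ P t)
    (hc : 0 < c) (hcr : 2 * C ≤ c * (r / 2) ^ 2) (hc1 : 2 * C ≤ c)
    (hinf : ∃ R, ∀ t ∈ K, ∀ x s y, 0 ≤ s → R ≤ |x| → |x - y| ≤ 1 → |t + r - s| ≤ r / 2 →
      U (t, x) - W (s, y) ≤ M)
    (hinit : ∀ x s y, 0 ≤ s → |x - y| ≤ 1 → |σ + r - s| ≤ r / 2 →
      U (σ, x) - W (s, y) - c * (x - y) ^ 4 - c * (σ + r - s) ^ 2 - P σ ≤ M)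
    (hM : 0 < M) (hUs : QuarticSub c κ ρ I U) (hWs : QuarticSub c κ ρ (Ioi 0) (fun p => -W p))
    (hκ : 2 * κ < η) :
    ∀ t ∈ insert σ I, ∀ x s y, 0 ≤ s →
      U (t, x) - W (s, y) - c * (x - y) ^ 4 - c * (t + r - s) ^ 2 - P t ≤ M := by
  by_contra hcon
  push Not at hcon
  obtain ⟨t₁, ht₁, x₁, s₁, y₁, hs₁, h₁⟩ := hcon
  obtain ⟨R, hR⟩ := hinf
  -- The time penalty is centred at s = t + r instead of s = t, to keep the contact time of W
  -- positive. All terms except U form one continuous summand.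
  set Φ : ℝ × ℝ × ℝ × ℝ → ℝ := fun q =>
    U (q.1, q.2.1) + (-W (q.2.2.1, q.2.2.2) - c * (q.2.1 - q.2.2.2) ^ 4
      - c * (q.1 + r - q.2.2.1) ^ 2 - P q.1) with hΦ
  -- localization of large values
  have hloc : ∀ t ∈ insert σ I, ∀ x s y, 0 ≤ s → M < Φ (t, x, s, y) →
      t ∈ K ∧ |x| ≤ R ∧ |x - y| ≤ 1 ∧ |t + r - s| ≤ r / 2 := by
    intro t ht x s y hs h
    simp only [hΦ] at h
    have hu := abs_le.1 (hUC t ht x)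
    have hw := abs_le.1 (hWC s hs y)
    have e1 : 0 ≤ c * (x - y) ^ 4 := by positivity
    have e2 : 0 ≤ c * (t + r - s) ^ 2 := by positivity
    have e3 := hP0 t ht
    -- Since U - W ≤ 2C, any one of the penalties that reaches 2C makes Φ nonpositive, hence not
    -- larger than M > 0.
    have htK : t ∈ K := by
      by_contra htK
      have := hPK t ht htK
      linarith
    have hxy : |x - y| ≤ 1 := by
      by_contra hxy
      push Not at hxy
      have : 1 ≤ (x - y) ^ 4 := by
        rw [← (show Even 4 by decide).pow_abs]
        exact one_le_pow₀ hxy.le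
      nlinarith
    have hts : |t + r - s| ≤ r / 2 := by
      by_contra hts
      push Not at hts
      have : (r / 2) ^ 2 ≤ (t + r - s) ^ 2 := by
        rw [← sq_abs (t + r - s)]
        gcongr
      nlinarith
    refine ⟨htK, ?_, hxy, hts⟩
    by_contra hx
    push Not at hx
    have := hR t htK x s y hs hx.le hxy hts
    linarith
  obtain ⟨B, hB⟩ := hK.isBounded.bddAbove
  set A : Set (ℝ × ℝ × ℝ × ℝ) :=
    K ×ˢ (Icc (-R) R ×ˢ (Icc 0 (B + 2 * r) ×ˢ Icc (-R - 1) (R + 1))) with hA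
  have hAc : IsCompact A := hK.prod (isCompact_Icc.prod (isCompact_Icc.prod isCompact_Icc))
  have hmemA : ∀ t ∈ insert σ I, ∀ x s y, 0 ≤ s → M < Φ (t, x, s, y) → (t, x, s, y) ∈ A := by
    intro t ht x s y hs h
    obtain ⟨h1, h2, h3, h4⟩ := hloc t ht x s y hs h
    have h5 := hB h1
    rw [abs_le] at h2 h3 h4
    refine ⟨h1, ⟨h2.1, h2.2⟩, ⟨hs, by linarith [h4.1]⟩, ?_, ?_⟩ <;> simp only <;> linarith
  have hΦusc : UpperSemicontinuousOn Φ A := by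
    apply UpperSemicontinuousOn.add
    · intro q hq a ha
      have hc : Tendsto (fun q' : ℝ × ℝ × ℝ × ℝ => (q'.1, q'.2.1)) (𝓝[A] q)
          (𝓝[insert σ I ×ˢ univ] (q.1, q.2.1)) :=
        tendsto_nhdsWithin_iff.2 ⟨(Continuous.tendsto (by fun_prop) q).mono_left
          nhdsWithin_le_nhds, eventually_nhdsWithin_of_forall fun q' hq' =>
            ⟨hKs hq'.1, mem_univ _⟩⟩
      exact hc.eventually (hU _ ⟨hKs hq.1, mem_univ _⟩ a ha)
    · apply ContinuousOn.upperSemicontinuousOn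
      have hW' : ContinuousOn (fun q : ℝ × ℝ × ℝ × ℝ => W (q.2.2.1, q.2.2.2)) A :=
        hW.comp (by fun_prop) fun q hq => ⟨hq.2.2.1.1, mem_univ _⟩
      have hP'' : ContinuousOn (fun q : ℝ × ℝ × ℝ × ℝ => P q.1) A :=
        hP.comp (by fun_prop) fun q hq => hKs hq.1
      exact ((hW'.neg.sub (by fun_prop)).sub (by fun_prop)).sub hP''
  have h₁' : M < Φ (t₁, x₁, s₁, y₁) := by
    simp only [hΦ]
    linarith
  obtain ⟨⟨t, x, s, y⟩, hmA, hmax⟩ :=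
    hΦusc.exists_isMaxOn ⟨_, hmemA t₁ ht₁ x₁ s₁ y₁ hs₁ h₁'⟩ hAc
  have hbig : M < Φ (t, x, s, y) :=
    h₁'.trans_le (hmax (hmemA t₁ ht₁ x₁ s₁ y₁ hs₁ h₁'))
  have hs : 0 ≤ s := hmA.2.2.1.1
  have htJ : t ∈ insert σ I := hKs hmA.1
  have hglob : ∀ t' ∈ insert σ I, ∀ x' s' y', 0 ≤ s' → Φ (t', x', s', y') ≤ Φ (t, x, s, y) := by
    intro t' ht' x' s' y' hs'
    by_cases h : M < Φ (t', x', s', y')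
    · exact hmax (hmemA t' ht' x' s' y' hs' h)
    · exact (not_lt.1 h).trans hbig.le
  obtain ⟨-, -, hxy, hts⟩ := hloc t htJ x s y hs hbig
  have htI : t ∈ I := by
    rcases htJ with rfl | h
    · exfalso
      have := hinit x s y hs hxy hts
      simp only [hΦ] at hbig
      linarith
    · exact h
  have ht0 : 0 < t := hσ.trans_lt (hI htI)
  -- The shift by r pays off here: s ≥ t + r / 2, so W is never touched at the initial time.
  have hs0 : 0 < s := by linarith [(abs_le.1 hts).2]
  have hdU := hUs t htI x y (fun t' => c * (t' + r - s) ^ 2 + P t') hxy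
    (ContDiffOn.add (by fun_prop) hP2) (by
      intro t' ht' x'
      have := hglob t' (mem_insert_of_mem _ ht') x' s y hs
      simp only [hΦ] at this
      linarith)
  have hdW := hWs s hs0 y x (fun s' => c * (t + r - s') ^ 2) (by rwa [abs_sub_comm])
    (by fun_prop) (by
      intro s' hs' y'
      have := hglob t htJ x s' y' (le_of_lt hs')
      simp only [hΦ] at this
      have e1 : (y' - x) ^ 4 = (x - y') ^ 4 := by ring
      have e2 : (y - x) ^ 4 = (x - y) ^ 4 := by ring
      rw [e1, e2]
      linarith)
  have hPd : DifferentiableAt ℝ P t :=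
    (hP2.differentiableOn (by norm_num)).differentiableAt (hIo.mem_nhds htI)
  -- The penalty contributes opposite time derivatives at t and at s, so only the derivative of P
  -- survives in the sum of the two inequalities.
  have d1 : HasDerivAt (fun t' => c * (t' + r - s) ^ 2 + P t')
      (c * (2 * (t + r - s)) + deriv P t) t := by
    have := ((((hasDerivAt_id t).add_const r).sub_const s).pow 2).const_mul c
    exact (this.add hPd.hasDerivAt).congr_deriv (by push_cast; simp)
  have d2 : HasDerivAt (fun s' => c * (t + r - s') ^ 2) (-(c * (2 * (t + r - s)))) s := by
    have := (((hasDerivAt_id s).const_sub (t + r)).pow 2).const_mul c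
    exact this.congr_deriv (by push_cast; simp)
  rw [d1.deriv] at hdU
  rw [d2.deriv] at hdW
  have hp : |4 * c * (y - x) ^ 3| = |4 * c * (x - y) ^ 3| := by
    rw [← abs_neg]
    congr 1
    ring
  rw [hp] at hdW
  have hout := outer_add_outer_nonpos (f := fun y => U (t, y)) (g := fun y => -W (s, y))
    (C := C) (x := x) (y := y) hρ
    (upperSemicontinuous_slice hU htJ).measurable
    (by
      have : Continuous fun y => W (s, y) := by
        rw [← continuousOn_univ]
        exact hW.comp (by fun_prop) fun y _ => ⟨hs, mem_univ _⟩
      exact this.neg.measurable)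
    (fun x => hUC t htJ x) (fun y => by simpa using hWC s hs y)
    (by
      intro z
      have := hglob t htJ (x + z) s (y + z) hs
      simp only [hΦ] at this
      have e : x + z - (y + z) = x - y := by ring
      rw [e] at this
      linarith)
  -- The sum of `hdU` and `hdW` now reads η ≤ 2κ, against `hκ`.
  have hP1 := hP' t htI
  have := mul_nonpos_of_nonneg_of_nonpos (abs_nonneg (4 * c * (x - y) ^ 3)) hout
  rw [mul_add] at this
  linarith

/-! ### Symmetric second differences -/

/-- The symmetric second difference. -/
def secondDiff (f : ℝ → ℝ) (x z : ℝ) : ℝ := f (x + z) + f (x - z) - 2 * f x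

/-- In folded form the first order parts at z and -z cancel, so at smooth points the integrand stays
bounded as the truncation radius tends to zero. -/
lemma outer_eq {ρ C : ℝ} (hρ : 0 < ρ) {f : ℝ → ℝ} (hf : Measurable f) (hC : ∀ x, |f x| ≤ C)
    (x : ℝ) : outer ρ f x = ∫ z in Ioi ρ, secondDiff f x z / z ^ 2 := by
  unfold outer
  rw [integral_compl_Ioo_eq hρ (integrableOn_outer hρ hf hC x)]
  congr 1
  ext z
  unfold secondDiff
  rw [neg_sq, ← add_div, ← sub_eq_add_neg]
  ring

lemma abs_secondDiff_le {f : ℝ → ℝ} {C : ℝ} (hC : ∀ x, |f x| ≤ C) (x z : ℝ) :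
    |secondDiff f x z| ≤ 4 * C := by
  have h1 := abs_le.1 (hC (x + z))
  have h2 := abs_le.1 (hC (x - z))
  have h3 := abs_le.1 (hC x)
  unfold secondDiff
  rw [abs_le]
  constructor <;> linarith

lemma integrableOn_secondDiff {ρ C : ℝ} (hρ : 0 < ρ) {f : ℝ → ℝ} (hf : Measurable f)
    (hC : ∀ x, |f x| ≤ C) (x : ℝ) :
    IntegrableOn (fun z => secondDiff f x z / z ^ 2) (Ioi ρ) := by
  have hm : Measurable (secondDiff f x) := by unfold secondDiff; fun_prop
  refine (integrableOn_div_sq hρ hm (abs_secondDiff_le hC x)).mono_set ?_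
  rw [compl_Ioo_eq]
  exact Ioi_subset_Ici_self.trans subset_union_right

/-! ### The explicit upwind scheme -/

/-- Upwind slope. -/
def up (h : ℝ) (f : ℝ → ℝ) (x : ℝ) : ℝ :=
  max (max ((f (x + h) - f x) / h) ((f (x - h) - f x) / h)) 0

/-- Upwind discretization of the right hand side of the equation. -/
def rate (h : ℝ) (f : ℝ → ℝ) (x : ℝ) : ℝ :=
  max (outer h f x) 0 * up h f x - max (-outer h f x) 0 * up h (fun y => -f y) x

/-- The time step which makes the scheme monotone on functions bounded by `C`. -/
def timeStep (C h : ℝ) : ℝ := h ^ 2 / (16 * C)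

/-- One step of the scheme. -/
def step (C h : ℝ) (f : ℝ → ℝ) (x : ℝ) : ℝ := f x + timeStep C h * rate h f x

lemma up_nonneg (h : ℝ) (f : ℝ → ℝ) (x : ℝ) : 0 ≤ up h f x := le_max_right _ _

lemma up_le {h L : ℝ} (hh : 0 < h) {f : ℝ → ℝ} {x : ℝ} (h1 : f (x + h) - f x ≤ L * h)
    (h2 : f (x - h) - f x ≤ L * h) (hL : 0 ≤ L) : up h f x ≤ L := by
  unfold up
  refine max_le (max_le ?_ ?_) hL
  · rwa [div_le_iff₀ hh]
  · rwa [div_le_iff₀ hh]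

lemma up_le_of_bound {h C : ℝ} (hh : 0 < h) {f : ℝ → ℝ} (hC : ∀ x, |f x| ≤ C) (x : ℝ) :
    up h f x ≤ 2 * C / h := by
  have h1 := abs_le.1 (hC (x + h))
  have h2 := abs_le.1 (hC (x - h))
  have h3 := abs_le.1 (hC x)
  have e : 2 * C / h * h = 2 * C := by field_simp
  apply up_le hh
  · rw [e]; linarith
  · rw [e]; linarith
  · exact div_nonneg (by linarith) hh.le

/-- Raising the neighbouring values can only raise the upwind slope; the value at the centre is the
sole source of the loss. -/
lemma up_le_add {h : ℝ} (hh : 0 < h) {f g : ℝ → ℝ} (hfg : ∀ y, f y ≤ g y) (x : ℝ) :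
    up h f x ≤ up h g x + (g x - f x) / h := by
  have hd : 0 ≤ (g x - f x) / h := div_nonneg (by linarith [hfg x]) hh.le
  have key : ∀ y, (f y - f x) / h ≤ (g y - g x) / h + (g x - f x) / h := by
    intro y
    rw [← add_div]
    exact div_le_div_of_nonneg_right (by linarith [hfg y]) hh.le
  unfold up
  rw [← max_add_add_right, ← max_add_add_right]
  refine max_le_max (max_le_max (key _) (key _)) (by linarith)

/-- Again only the centre value acts in the wrong direction, and it is weighted by 2 / h, the total
mass of the truncated kernel. -/
lemma outer_le_add {h C : ℝ} (hh : 0 < h) {f g : ℝ → ℝ} (hf : Measurable f) (hg : Measurable g)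
    (hfC : ∀ x, |f x| ≤ C) (hgC : ∀ x, |g x| ≤ C) (hfg : ∀ y, f y ≤ g y) (x : ℝ) :
    outer h f x ≤ outer h g x + 2 * (g x - f x) / h := by
  have e : 2 * (g x - f x) / h = ∫ z in (Ioo (-h) h)ᶜ, (g x - f x) * (1 / z ^ 2) := by
    rw [integral_const_mul, integral_inv_sq hh]
    ring
  rw [e]
  unfold outer
  rw [← integral_add (integrableOn_outer hh hg hgC x) ((integrableOn_inv_sq hh).const_mul _)]
  refine integral_mono (integrableOn_outer hh hf hfC x)
    ((integrableOn_outer hh hg hgC x).add ((integrableOn_inv_sq hh).const_mul _)) fun z => ?_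
  simp only
  rw [mul_one_div, ← add_div]
  exact div_le_div_of_nonneg_right (by linarith [hfg (x + z)]) (sq_nonneg z)

lemma outer_congr_add (h : ℝ) (f : ℝ → ℝ) (a x : ℝ) :
    outer h (fun y => f y + a) x = outer h f x := by
  unfold outer
  simp only [add_sub_add_right_eq_sub]

lemma rate_add_const (h : ℝ) (f : ℝ → ℝ) (a x : ℝ) :
    rate h (fun y => f y + a) x = rate h f x := by
  unfold rate up
  rw [outer_congr_add]
  have e : ∀ y, -(f y + a) - -(f x + a) = -f y - -f x := fun y => by ring
  simp only [add_sub_add_right_eq_sub, e]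

lemma step_add_const (C h : ℝ) (f : ℝ → ℝ) (a x : ℝ) :
    step C h (fun y => f y + a) x = step C h f x + a := by
  unfold step
  rw [rate_add_const]
  ring

lemma rate_neg (h : ℝ) (f : ℝ → ℝ) (x : ℝ) : rate h (fun y => -f y) x = -rate h f x := by
  unfold rate
  rw [outer_neg]
  simp only [neg_neg]
  ring

lemma step_neg (C h : ℝ) (f : ℝ → ℝ) (x : ℝ) : step C h (fun y => -f y) x = -step C h f x := by
  unfold step
  rw [rate_neg]
  ring

lemma step_shift (C h : ℝ) (f : ℝ → ℝ) (a x : ℝ) :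
    step C h (fun y => f (y + a)) x = step C h f (x + a) := by
  unfold step rate up outer
  simp only [add_right_comm x _ a, sub_add_eq_add_sub x h a]

lemma rate_const (h a x : ℝ) : rate h (fun _ => a) x = 0 := by
  simp [rate, up]

lemma step_const (C h a x : ℝ) : step C h (fun _ => a) x = a := by
  simp [step, rate_const]

lemma timeStep_pos {C h : ℝ} (hC : 0 < C) (hh : 0 < h) : 0 < timeStep C h := by
  unfold timeStep
  positivity

/-- The scheme is monotone. -/
lemma step_mono {C h : ℝ} (hC : 0 < C) (hh : 0 < h) {f g : ℝ → ℝ} (hf : Measurable f)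
    (hg : Measurable g) (hfC : ∀ x, |f x| ≤ C) (hgC : ∀ x, |g x| ≤ C) (hfg : ∀ y, f y ≤ g y)
    (x : ℝ) : step C h f x ≤ step C h g x := by
  have hd : 0 ≤ g x - f x := by linarith [hfg x]
  have o1 := outer_le_add hh hf hg hfC hgC hfg x
  have u1 := up_le_add hh hfg x
  have u2 := up_le_add hh (f := fun y => -g y) (g := fun y => -f y) (fun y => neg_le_neg (hfg y)) x
  have b1 := abs_le.1 (abs_outer_le hh hfC x)
  have b3 := up_le_of_bound hh hgC x
  have b4 := up_le_of_bound (f := fun y => -g y) hh (by simpa using hgC) x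
  have p1 := up_nonneg h g x
  have p2 := up_nonneg h (fun y => -g y) x
  unfold step rate
  set If := outer h f x
  set Ig := outer h g x
  set uf := up h f x
  set ug := up h g x
  set nf := up h (fun y => -f y) x
  set ng := up h (fun y => -g y) x
  set d := g x - f x with hd'
  have e2 : -f x - -g x = d := by rw [hd']; ring
  simp only [e2] at u2
  set δ := d / h with hδ
  have hδ0 : 0 ≤ δ := div_nonneg hd hh.le
  have e3 : 2 * d / h = 2 * δ := by rw [hδ]; ring
  rw [e3] at o1
  set B := C / h with hB
  have hB0 : 0 < B := div_pos hC hh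
  have e4 : 4 * C / h = 4 * B := by rw [hB]; ring
  have e5 : 2 * C / h = 2 * B := by rw [hB]; ring
  rw [e4] at b1
  rw [e5] at b3 b4
  have m1 : max If 0 ≤ max Ig 0 + 2 * δ := by
    refine max_le ?_ (by positivity)
    linarith [le_max_left Ig 0]
  have m2 : max (-Ig) 0 ≤ max (-If) 0 + 2 * δ := by
    refine max_le ?_ (by positivity)
    linarith [le_max_left (-If) 0]
  have m3 : max If 0 ≤ 4 * B := max_le b1.2 (by positivity)
  have m4 : max (-If) 0 ≤ 4 * B := max_le (by linarith [b1.1]) (by positivity)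
  have n3 : 0 ≤ max If 0 := le_max_right _ _
  have n4 : 0 ≤ max (-If) 0 := le_max_right _ _
  -- The factors are exchanged one at a time: a change δ of the slope meets an operator of size at
  -- most 4B, and a change 2δ of the operator meets a slope of size at most 2B.
  have k1 : max If 0 * uf ≤ max Ig 0 * ug + 8 * B * δ := by
    have a1 : max If 0 * uf ≤ max If 0 * ug + 4 * B * δ := by
      nlinarith [mul_le_mul_of_nonneg_left u1 n3, mul_le_mul_of_nonneg_right m3 hδ0]
    have a2 : max If 0 * ug ≤ max Ig 0 * ug + 4 * B * δ := by
      nlinarith [mul_le_mul_of_nonneg_right m1 p1, mul_le_mul_of_nonneg_left b3 hδ0]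
    linarith
  have k2 : max (-Ig) 0 * ng ≤ max (-If) 0 * nf + 8 * B * δ := by
    have a1 : max (-If) 0 * ng ≤ max (-If) 0 * nf + 4 * B * δ := by
      nlinarith [mul_le_mul_of_nonneg_left u2 n4, mul_le_mul_of_nonneg_right m4 hδ0]
    have a2 : max (-Ig) 0 * ng ≤ max (-If) 0 * ng + 4 * B * δ := by
      nlinarith [mul_le_mul_of_nonneg_right m2 p2, mul_le_mul_of_nonneg_left b4 hδ0]
    linarith
  have hτ := timeStep_pos hC hh
  -- This fixes the constant in `timeStep`: the two products together lose 16 (C / h)(d / h), and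
  -- one time step turns this into exactly the gain d of the identity part.
  have hτ' : timeStep C h * (16 * B * δ) = d := by
    rw [hB, hδ, timeStep]
    field_simp
  have := mul_le_mul_of_nonneg_left
    (show max If 0 * uf - max (-If) 0 * nf ≤ max Ig 0 * ug - max (-Ig) 0 * ng + 16 * B * δ by
      linarith) hτ.le
  rw [mul_add, hτ'] at this
  linarith

/-- A monotone map that commutes with adding constants is nonexpansive. Monotonicity is only
available below the bound C, so e is cut off at C / 2; the bounds C / 4 ensure that f ≤ g + C / 2
holds anyway. -/
lemma step_le_add {C h : ℝ} (hC : 0 < C) (hh : 0 < h) {f g : ℝ → ℝ} (hf : Measurable f)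
    (hg : Measurable g) (hfC : ∀ x, |f x| ≤ C / 4) (hgC : ∀ x, |g x| ≤ C / 4) {e : ℝ} (he : 0 ≤ e)
    (hfg : ∀ y, f y ≤ g y + e) (x : ℝ) : step C h f x ≤ step C h g x + e := by
  set e' := min e (C / 2) with he'
  have h1 : step C h f x ≤ step C h (fun y => g y + e') x := by
    refine step_mono hC hh hf (by fun_prop) (fun y => (hfC y).trans (by linarith)) (fun y => ?_)
      (fun y => ?_) x
    · have := abs_le.1 (hgC y)
      have h3 : 0 ≤ e' := le_min he (by linarith)
      have h4 : e' ≤ C / 2 := min_le_right _ _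
      rw [abs_le]
      constructor <;> linarith
    · rcases min_choice e (C / 2) with h | h
      · rw [he', h]; exact hfg y
      · rw [he', h]
        linarith [(abs_le.1 (hfC y)).2, (abs_le.1 (hgC y)).1]
  rw [step_add_const] at h1
  linarith [min_le_left e (C / 2)]

/-- Constants are fixed by the scheme, so monotonicity is a maximum principle. -/
lemma abs_step_le {C B h : ℝ} (hC : 0 < C) (hBC : B ≤ C) (hh : 0 < h) {f : ℝ → ℝ}
    (hf : Measurable f) (hfB : ∀ x, |f x| ≤ B) (x : ℝ) : |step C h f x| ≤ B := by
  have hB : 0 ≤ B := (abs_nonneg _).trans (hfB 0)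
  have h1 := step_mono hC hh hf (measurable_const (a := B)) (fun y => (hfB y).trans hBC)
    (fun y => by rwa [abs_of_nonneg hB]) (fun y => (abs_le.1 (hfB y)).2) x
  have h2 := step_mono hC hh (measurable_const (a := -B)) hf
    (fun y => by rwa [abs_neg, abs_of_nonneg hB]) (fun y => (hfB y).trans hBC)
    (fun y => (abs_le.1 (hfB y)).1) x
  rw [step_const] at h1 h2
  exact abs_le.2 ⟨h2, h1⟩

/-- If `f` moves by at most `e` under a shift, so does its image under the scheme. -/
lemma abs_step_shift_le {C h : ℝ} (hC : 0 < C) (hh : 0 < h) {f : ℝ → ℝ} (hf : Measurable f)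
    (hfC : ∀ x, |f x| ≤ C / 4) {a e : ℝ} (he : ∀ y, |f (y + a) - f y| ≤ e) (x : ℝ) :
    |step C h f (x + a) - step C h f x| ≤ e := by
  have he0 : 0 ≤ e := (abs_nonneg _).trans (he 0)
  rw [← step_shift]
  have h1 := step_le_add hC hh (f := fun y => f (y + a)) (g := f) (by fun_prop) hf
    (fun y => hfC _) hfC he0 (fun y => by linarith [(abs_le.1 (he y)).2]) x
  have h2 := step_le_add hC hh (f := f) (g := fun y => f (y + a)) hf (by fun_prop)
    hfC (fun y => hfC _) he0 (fun y => by linarith [(abs_le.1 (he y)).1]) x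
  rw [abs_le]
  constructor <;> linarith

/-- Iterates of the scheme. -/
def iter (C h : ℝ) (f : ℝ → ℝ) : ℕ → ℝ → ℝ
  | 0 => f
  | k + 1 => step C h (iter C h f k)

lemma iter_neg (C h : ℝ) (f : ℝ → ℝ) (k : ℕ) (x : ℝ) :
    iter C h (fun y => -f y) k x = -iter C h f k x := by
  induction k generalizing x with
  | zero => rfl
  | succ k ih =>
    have : iter C h (fun y => -f y) k = fun y => -iter C h f k y := funext ih
    simp only [iter, this, step_neg]

lemma iter_add (C h : ℝ) (f : ℝ → ℝ) (j k : ℕ) :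
    iter C h f (j + k) = iter C h (iter C h f j) k := by
  induction k with
  | zero => rfl
  | succ k ih => exact congrArg (step C h) ih

/-- Bounded uniformly continuous functions. -/
structure IsBUC (B : ℝ) (f : ℝ → ℝ) : Prop where
  bound : ∀ x, |f x| ≤ B
  modulus : ∀ e > 0, ∃ δ > 0, ∀ a, |a| ≤ δ → ∀ x, |f (x + a) - f x| ≤ e

lemma IsBUC.continuous {B : ℝ} {f : ℝ → ℝ} (hf : IsBUC B f) : Continuous f := by
  rw [Metric.continuous_iff]
  intro x e he
  obtain ⟨δ, hδ, h⟩ := hf.modulus (e / 2) (by linarith)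
  refine ⟨δ, hδ, fun y hy => ?_⟩
  have := h (y - x) (by rw [Real.dist_eq] at hy; exact hy.le) x
  rw [add_sub_cancel] at this
  rw [Real.dist_eq]
  linarith

lemma IsBUC.neg {B : ℝ} {f : ℝ → ℝ} (hf : IsBUC B f) : IsBUC B fun y => -f y where
  bound x := by simpa using hf.bound x
  modulus e he := by
    obtain ⟨δ, hδ, h⟩ := hf.modulus e he
    refine ⟨δ, hδ, fun a ha x => ?_⟩
    rw [← abs_neg]
    convert h a ha x using 2
    ring

section Iter
variable {B C h : ℝ} (hB : 0 < B) (hC : C = 24 * B) (hh : 0 < h)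
include hB hC hh

/-- Nonexpansiveness applied to f and its translates: every spatial modulus of the datum is kept,
uniformly in h and k. The choice C = 24B leaves room for barriers of size up to 6B = C / 4, which
are needed for the modulus in time. -/
lemma iter_bound_shift {f : ℝ → ℝ} (hf : IsBUC B f) (k : ℕ) :
    IsBUC B (iter C h f k) ∧ ∀ a e, (∀ y, |f (y + a) - f y| ≤ e) →
      ∀ x, |iter C h f k (x + a) - iter C h f k x| ≤ e := by
  have hC0 : 0 < C := by linarith
  induction k with
  | zero => exact ⟨hf, fun a e he x => he x⟩
  | succ k ih =>
    obtain ⟨h1, h2⟩ := ih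
    have hm := h1.continuous.measurable
    have h3 : ∀ a e, (∀ y, |f (y + a) - f y| ≤ e) →
      ∀ x, |iter C h f (k + 1) (x + a) - iter C h f (k + 1) x| ≤ e := fun a e he x =>
      abs_step_shift_le hC0 hh hm (fun y => (h1.bound y).trans (by linarith)) (h2 a e he) x
    refine ⟨⟨fun x => abs_step_le hC0 (by linarith) hh hm h1.bound x, fun e he => ?_⟩, h3⟩
    obtain ⟨δ, hδ, h4⟩ := hf.modulus e he
    exact ⟨δ, hδ, fun a ha => h3 a e (h4 a ha)⟩

lemma isBUC_iter {f : ℝ → ℝ} (hf : IsBUC B f) (k : ℕ) : IsBUC B (iter C h f k) :=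
  (iter_bound_shift hB hC hh hf k).1

/-- Together with `iter_add` this carries an estimate for the first few steps to all later times. -/
lemma abs_iter_sub_iter_le {f g : ℝ → ℝ} (hf : IsBUC B f) (hg : IsBUC B g) {e : ℝ}
    (he : ∀ x, |f x - g x| ≤ e) (k : ℕ) (x : ℝ) : |iter C h f k x - iter C h g k x| ≤ e := by
  have hC0 : 0 < C := by linarith
  have he0 : 0 ≤ e := (abs_nonneg _).trans (he 0)
  have key : ∀ f g : ℝ → ℝ, IsBUC B f → IsBUC B g → (∀ x, f x ≤ g x + e) → ∀ k x,
      iter C h f k x ≤ iter C h g k x + e := by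
    intro f g hf hg hfg k
    induction k with
    | zero => exact hfg
    | succ k ih =>
      intro x
      have h1 := isBUC_iter hB hC hh hf k
      have h2 := isBUC_iter hB hC hh hg k
      exact step_le_add hC0 hh h1.continuous.measurable h2.continuous.measurable
        (fun y => (h1.bound y).trans (by linarith)) (fun y => (h2.bound y).trans (by linarith))
        he0 ih x
  have h1 := key f g hf hg (fun x => by linarith [(abs_le.1 (he x)).2]) k x
  have h2 := key g f hg hf (fun x => by linarith [(abs_le.1 (he x)).1]) k x
  rw [abs_le]
  constructor <;> linarith

end Iter

/-! ### A bump function -/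

/-- A bounded smooth function which vanishes at the origin only. -/
def bump (x : ℝ) : ℝ := 1 - 1 / (1 + x ^ 2)

lemma bump_nonneg (x : ℝ) : 0 ≤ bump x := by
  have : 1 / (1 + x ^ 2) ≤ 1 := by
    rw [div_le_one (by positivity)]
    nlinarith [sq_nonneg x]
  unfold bump
  linarith

lemma bump_le_one (x : ℝ) : bump x ≤ 1 := by
  have : 0 < 1 / (1 + x ^ 2) := by positivity
  unfold bump
  linarith

lemma half_le_bump {x : ℝ} (hx : 1 ≤ |x|) : 1 / 2 ≤ bump x := by
  have h : 1 ≤ x ^ 2 := by rw [← sq_abs]; nlinarith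
  have : 1 / (1 + x ^ 2) ≤ 1 / 2 := one_div_le_one_div_of_le (by norm_num) (by linarith)
  unfold bump
  linarith

lemma bump_zero : bump 0 = 0 := by simp [bump]

lemma bump_le_sq (x : ℝ) : bump x ≤ x ^ 2 := by
  have h : bump x = x ^ 2 / (1 + x ^ 2) := by
    unfold bump
    field_simp
    ring
  rw [h]
  exact div_le_self (sq_nonneg x) (by nlinarith [sq_nonneg x])

lemma abs_bump_sub_le (x y : ℝ) : |bump x - bump y| ≤ |x - y| := by
  have h : bump x - bump y = (x - y) * ((x + y) / ((1 + x ^ 2) * (1 + y ^ 2))) := by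
    unfold bump
    field_simp
    ring
  rw [h, abs_mul]
  refine mul_le_of_le_one_right (abs_nonneg _) ?_
  rw [abs_div, abs_of_pos (show 0 < (1 + x ^ 2) * (1 + y ^ 2) by positivity),
    div_le_one (by positivity), abs_le]
  constructor <;> nlinarith [sq_nonneg (x - 1), sq_nonneg (y - 1), sq_nonneg (x + 1),
    sq_nonneg (y + 1), mul_nonneg (sq_nonneg x) (sq_nonneg y)]

lemma abs_secondDiff_bump_le (x z : ℝ) : |secondDiff bump x z| ≤ 8 * z ^ 2 := by
  have hN : (1 + (x + z) ^ 2) * (1 + (x - z) ^ 2) = (1 + x ^ 2 + z ^ 2) ^ 2 - 4 * x ^ 2 * z ^ 2 := by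
    ring
  set s := 1 + x ^ 2 with hs
  set N := (1 + (x + z) ^ 2) * (1 + (x - z) ^ 2) with hN'
  have hs0 : 0 < s := by positivity
  have hN0 : 0 < N := by positivity
  -- Over the common denominator the factor z² splits off, and the remaining quotient is at most 4
  -- in modulus.
  have h : secondDiff bump x z = 2 * z ^ 2 * ((s + z ^ 2 - 4 * x ^ 2) / (s * N)) := by
    have h1 : secondDiff bump x z = 2 / s - 2 * (s + z ^ 2) / N := by
      unfold secondDiff bump
      rw [hN', hs]
      field_simp
      ring
    rw [h1, div_sub_div _ _ hs0.ne' hN0.ne', ← mul_div_assoc]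
    congr 1
    rw [hN]
    ring
  have hN1 : s + z ^ 2 ≤ N := by
    rw [hN', hs]
    nlinarith [mul_nonneg (sq_nonneg (x + z)) (sq_nonneg (x - z)), sq_nonneg x, sq_nonneg z]
  have hs1 : 1 ≤ s := by rw [hs]; nlinarith [sq_nonneg x]
  rw [h, abs_mul, abs_of_nonneg (by positivity : (0 : ℝ) ≤ 2 * z ^ 2)]
  have : |(s + z ^ 2 - 4 * x ^ 2) / (s * N)| ≤ 4 := by
    rw [abs_div, abs_of_pos (mul_pos hs0 hN0), div_le_iff₀ (mul_pos hs0 hN0), abs_le]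
    have hx : x ^ 2 ≤ s := by rw [hs]; linarith
    have hz := sq_nonneg z
    have hN2 : 1 ≤ N := by linarith
    constructor
    · nlinarith [sq_nonneg x]
    · nlinarith [sq_nonneg x]
  nlinarith [sq_nonneg z]

/-! ### Equicontinuity of the scheme and its limits -/

/-- Both bounds together dominate the integrand by (K + K') / (1 + z²), whose integral over the line
is (K + K')π. The point is that the bound does not depend on the truncation h. -/
lemma abs_outer_le_of_secondDiff {h C K K' : ℝ} (hh : 0 < h) {f : ℝ → ℝ} (hf : Measurable f)
    (hC : ∀ x, |f x| ≤ C) {x : ℝ} (h1 : ∀ z, |secondDiff f x z| ≤ K * z ^ 2)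
    (h2 : ∀ z, |secondDiff f x z| ≤ K') : |outer h f x| ≤ (K + K') * Real.pi := by
  rw [outer_eq hh hf hC]
  have hK' : 0 ≤ K' := (abs_nonneg _).trans (h2 0)
  have hK : 0 ≤ K := by simpa using (abs_nonneg _).trans (h1 1)
  have hint : Integrable fun z : ℝ => (K + K') * (1 + z ^ 2)⁻¹ :=
    integrable_inv_one_add_sq.const_mul _
  have h3 : ‖∫ z in Ioi h, secondDiff f x z / z ^ 2‖
      ≤ ∫ z in Ioi h, (K + K') * (1 + z ^ 2)⁻¹ := by
    refine norm_integral_le_of_norm_le hint.integrableOn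
      ((ae_restrict_iff' measurableSet_Ioi).2 (Eventually.of_forall fun z hz => ?_))
    have hz0 : 0 < z := hh.trans hz
    rw [Real.norm_eq_abs, abs_div, abs_of_nonneg (sq_nonneg z), ← div_eq_mul_inv,
      div_le_div_iff₀ (by positivity) (by positivity)]
    nlinarith [h1 z, h2 z, sq_nonneg z, mul_le_mul_of_nonneg_right (h2 z) (sq_nonneg z)]
  refine (h3.trans ?_)
  rw [← integral_univ_inv_one_add_sq, ← integral_const_mul]
  exact setIntegral_le_integral hint (Eventually.of_forall fun z => by
    simp only [Pi.zero_apply]; positivity)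

lemma rate_le {h L M : ℝ} {f : ℝ → ℝ} {x : ℝ} (h1 : up h f x ≤ L)
    (h3 : |outer h f x| ≤ M) : rate h f x ≤ M * L := by
  have hM : 0 ≤ M := (abs_nonneg _).trans h3
  have a1 : max (outer h f x) 0 ≤ M := max_le (abs_le.1 h3).2 hM
  have a2 : 0 ≤ max (-outer h f x) 0 * up h (fun y => -f y) x :=
    mul_nonneg (le_max_right _ _) (up_nonneg _ _ _)
  have a3 : max (outer h f x) 0 * up h f x ≤ M * L :=
    mul_le_mul a1 h1 (up_nonneg _ _ _) hM
  unfold rate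
  linarith

section Time
variable {B C : ℝ} (hB : 0 < B) (hC : C = 24 * B)
include hB hC

/-- A smooth barrier touches f at x up to e. Its rate under the scheme is bounded independently of
h, so by monotonicity the iterates at x rise at most linearly in time. -/
lemma exists_iter_le {f : ℝ → ℝ} (hf : IsBUC B f) {e : ℝ} (he : 0 < e) :
    ∃ A ≥ 0, ∀ h > 0, ∀ k x, iter C h f k x ≤ f x + e + A * (k * timeStep C h) := by
  have hC0 : 0 < C := by linarith
  set e' := min e B with he'
  have he'0 : 0 < e' := lt_min he hB
  obtain ⟨r, hr, hmod⟩ := hf.modulus e' he'0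
  set M : ℝ := (4 * B * (8 / r ^ 2) + 24 * B) * Real.pi with hM
  refine ⟨M * (4 * B / r), by positivity, fun h hh k x => ?_⟩
  set g : ℝ → ℝ := fun y => f x + e' + 4 * B * bump ((y - x) / r) with hg
  have hgm : Measurable g := by
    have : Measurable bump := by unfold bump; fun_prop
    fun_prop
  have hgC : ∀ y, |g y| ≤ 6 * B := by
    intro y
    have h1 := abs_le.1 (hf.bound x)
    have h2 := bump_nonneg ((y - x) / r)
    have h3 := bump_le_one ((y - x) / r)
    have h4 : e' ≤ B := min_le_right _ _
    rw [abs_le]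
    constructor <;> simp only [hg] <;> nlinarith
  have hfg : ∀ y, f y ≤ g y := by
    intro y
    simp only [hg]
    by_cases hy : |y - x| ≤ r
    · have h1 := (abs_le.1 (hmod (y - x) hy x)).2
      rw [add_sub_cancel] at h1
      have := bump_nonneg ((y - x) / r)
      nlinarith
    · have h2 : 1 / 2 ≤ bump ((y - x) / r) := by
        apply half_le_bump
        rw [abs_div, abs_of_pos hr, le_div_iff₀ hr, one_mul]
        exact (not_le.1 hy).le
      have h3 := (abs_le.1 (hf.bound x)).1
      have h4 := (abs_le.1 (hf.bound y)).2
      nlinarith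
  have hsd : ∀ y z, secondDiff g y z = 4 * B * secondDiff bump ((y - x) / r) (z / r) := by
    intro y z
    simp only [hg, secondDiff]
    rw [show (y + z - x) / r = (y - x) / r + z / r by ring,
      show (y - z - x) / r = (y - x) / r - z / r by ring]
    ring
  have hrate : ∀ y, rate h g y ≤ M * (4 * B / r) := by
    intro y
    have lip : ∀ a b, g a - g b ≤ 4 * B / r * |a - b| := by
      intro a b
      have h1 := (abs_le.1 (abs_bump_sub_le ((a - x) / r) ((b - x) / r))).2
      rw [← sub_div, abs_div, abs_of_pos hr, show a - x - (b - x) = a - b by ring] at h1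
      have h2 : 4 * B / r * |a - b| = 4 * B * (|a - b| / r) := by ring
      rw [h2]
      simp only [hg]
      nlinarith
    refine rate_le ?_ ?_
    · apply up_le hh
      · have := lip (y + h) y
        rwa [add_sub_cancel_left, abs_of_pos hh] at this
      · have := lip (y - h) y
        rwa [sub_sub_cancel_left, abs_neg, abs_of_pos hh] at this
      · positivity
    · refine abs_outer_le_of_secondDiff hh hgm hgC (fun z => ?_) (fun z => ?_)
      · rw [hsd, abs_mul, abs_of_pos (by positivity : 0 < 4 * B)]
        have := abs_secondDiff_bump_le ((y - x) / r) (z / r)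
        calc _ ≤ 4 * B * (8 * (z / r) ^ 2) := by gcongr
          _ = _ := by ring
      · exact (abs_secondDiff_le hgC y z).trans (by linarith)
  have hstep : ∀ y, step C h g y ≤ g y + M * (4 * B / r) * timeStep C h := by
    intro y
    unfold step
    have := mul_le_mul_of_nonneg_left (hrate y) (timeStep_pos hC0 hh).le
    linarith
  have hτ := timeStep_pos hC0 hh
  have hind : ∀ k : ℕ, ∀ y, iter C h f k y ≤ g y + M * (4 * B / r) * (k * timeStep C h) := by
    intro k
    induction k with
    | zero => intro y; simpa [iter] using hfg y
    | succ k ih =>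
      intro y
      have hk := isBUC_iter hB hC hh hf k
      have h1 := step_le_add hC0 hh hk.continuous.measurable hgm
        (fun y => (hk.bound y).trans (by linarith)) (fun y => (hgC y).trans (by linarith))
        (by positivity) ih y
      have h2 := hstep y
      push_cast
      simp only [iter]
      linarith
  have := hind k x
  simp only [hg, sub_self, zero_div, bump_zero, mul_zero, add_zero] at this
  linarith [min_le_left e B]

lemma exists_abs_iter_sub_le {f : ℝ → ℝ} (hf : IsBUC B f) {e : ℝ} (he : 0 < e) :
    ∃ A ≥ 0, ∀ h > 0, ∀ k x, |iter C h f k x - f x| ≤ e + A * (k * timeStep C h) := by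
  obtain ⟨A₁, hA₁, h₁⟩ := exists_iter_le hB hC hf he
  obtain ⟨A₂, hA₂, h₂⟩ := exists_iter_le hB hC hf.neg he
  refine ⟨max A₁ A₂, le_max_of_le_left hA₁, fun h hh k x => ?_⟩
  have hτ := timeStep_pos (show 0 < C by linarith) hh
  have a1 := h₁ h hh k x
  have a2 := h₂ h hh k x
  rw [iter_neg] at a2
  have hk : 0 ≤ (k : ℝ) * timeStep C h := by positivity
  have b1 := mul_le_mul_of_nonneg_right (le_max_left A₁ A₂) hk
  have b2 := mul_le_mul_of_nonneg_right (le_max_right A₁ A₂) hk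
  rw [abs_le]
  constructor <;> linarith

/-- The mesh size of the `m`-th approximation. -/
def mesh (m : ℕ) : ℝ := 1 / ((m : ℝ) + 1)

omit hB hC in
lemma mesh_pos (m : ℕ) : 0 < mesh m := by unfold mesh; positivity

omit hB hC in
lemma tendsto_mesh : Tendsto mesh atTop (𝓝 0) := tendsto_one_div_add_atTop_nhds_zero_nat

omit hB hC in
lemma tendsto_timeStep (C : ℝ) : Tendsto (fun m => timeStep C (mesh m)) atTop (𝓝 0) := by
  unfold timeStep
  have := (tendsto_mesh.pow 2).div_const (16 * C)
  simpa using this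

/-- The numerical solution as a function of time and space. -/
def scheme (C : ℝ) (f : ℝ → ℝ) (m : ℕ) (p : ℝ × ℝ) : ℝ :=
  iter C (mesh m) f ⌊p.1 / timeStep C (mesh m)⌋₊ p.2

/-- In space the modulus of f is inherited. In time, steps k and j + k are the k-th iterates of f
and of its j-th iterate, so nonexpansiveness reduces to the first j steps. The functions jump in
time by single steps, hence the estimate only holds for fine meshes. -/
lemma scheme_equicontinuous {f : ℝ → ℝ} (hf : IsBUC B f) {e : ℝ} (he : 0 < e) :
    ∃ δ > 0, ∃ N, ∀ m ≥ N, ∀ p q : ℝ × ℝ, |p.1 - q.1| ≤ δ → |p.2 - q.2| ≤ δ →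
      |scheme C f m p - scheme C f m q| ≤ e := by
  have hC0 : 0 < C := by linarith
  obtain ⟨A, hA, h1⟩ := exists_abs_iter_sub_le hB hC hf (show 0 < e / 4 by linarith)
  obtain ⟨δ, hδ, h2⟩ := hf.modulus (e / 4) (by linarith)
  have hs : ∀ᶠ m in atTop, timeStep C (mesh m) < e / (4 * (A + 1)) :=
    (tendsto_timeStep C).eventually_lt_const (by positivity)
  obtain ⟨N, hN⟩ := eventually_atTop.1 hs
  refine ⟨min δ (e / (4 * (A + 1))), by positivity, N, fun m hm p q hpq hxy => ?_⟩
  have hh := mesh_pos m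
  have hτ := timeStep_pos hC0 hh
  set τ := timeStep C (mesh m) with hτd
  have htime : ∀ (k j : ℕ) x, |iter C (mesh m) f (j + k) x - iter C (mesh m) f k x|
      ≤ e / 4 + A * (j * τ) := by
    intro k j x
    rw [iter_add]
    exact abs_iter_sub_iter_le hB hC hh (isBUC_iter hB hC hh hf j) hf (h1 _ hh j) k x
  have hfl : ∀ (a b : ℝ) x, a ≤ b → b - a ≤ e / (4 * (A + 1)) →
      |iter C (mesh m) f ⌊b / τ⌋₊ x - iter C (mesh m) f ⌊a / τ⌋₊ x| ≤ 3 * e / 4 := by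
    intro a b x hab hba
    have hle : ⌊a / τ⌋₊ ≤ ⌊b / τ⌋₊ := Nat.floor_mono (by gcongr)
    obtain ⟨j, hj⟩ := Nat.exists_eq_add_of_le' hle
    rw [hj]
    refine (htime _ j x).trans ?_
    -- The floors cost one extra time step. Negative times are rounded to step 0, which is harmless:
    -- a positive j forces b / τ to be positive.
    have hj' : (j : ℝ) * τ ≤ e / (4 * (A + 1)) + τ := by
      rcases Nat.eq_zero_or_pos j with rfl | hj0
      · simp only [Nat.cast_zero, zero_mul]
        positivity
      have h3 : (⌊b / τ⌋₊ : ℝ) ≤ b / τ := by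
        apply Nat.floor_le
        by_contra hneg
        have : ⌊b / τ⌋₊ = 0 := Nat.floor_of_nonpos (not_le.1 hneg).le
        omega
      have h4 := Nat.lt_floor_add_one (a / τ)
      rw [hj] at h3
      push_cast at h3
      have h5 : (j : ℝ) ≤ (b - a) / τ + 1 := by
        rw [sub_div]
        linarith
      calc (j : ℝ) * τ ≤ ((b - a) / τ + 1) * τ := by gcongr
        _ = b - a + τ := by field_simp
        _ ≤ _ := by linarith
    have h6 := hN m hm
    have h7 : A * (j * τ) ≤ A * (2 * (e / (4 * (A + 1)))) :=
      mul_le_mul_of_nonneg_left (by linarith) hA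
    have h8 : A * (2 * (e / (4 * (A + 1)))) ≤ e / 2 := by
      rw [show A * (2 * (e / (4 * (A + 1)))) = e / 2 * (A / (A + 1)) by field_simp; ring]
      exact mul_le_of_le_one_right (by linarith) ((div_le_one (by linarith)).2 (by linarith))
    linarith
  have hspace : |scheme C f m (p.1, p.2) - scheme C f m (p.1, q.2)| ≤ e / 4 := by
    have := (iter_bound_shift hB hC hh hf ⌊p.1 / τ⌋₊).2 (p.2 - q.2) (e / 4)
      (h2 _ (hxy.trans (min_le_left _ _))) q.2
    rwa [add_sub_cancel] at this
  have htt : |scheme C f m (p.1, q.2) - scheme C f m (q.1, q.2)| ≤ 3 * e / 4 := by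
    have hpq' := abs_le.1 (hpq.trans (min_le_right _ _))
    rcases le_total q.1 p.1 with h | h
    · exact hfl _ _ _ h (by linarith)
    · rw [abs_sub_comm]
      exact hfl _ _ _ h (by linarith)
  have := abs_sub_le (scheme C f m p) (scheme C f m (p.1, q.2)) (scheme C f m q)
  linarith

/-- A uniformly continuous limit of the scheme along a subsequence. -/
structure IsSchemeLimit (B C : ℝ) (f : ℝ → ℝ) (ν : ℕ → ℕ) (W : ℝ × ℝ → ℝ) : Prop where
  mono : StrictMono ν
  tendsto : ∀ p, Tendsto (fun j => scheme C f (ν j) p) atTop (𝓝 (W p))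

/-- The Arzelà-Ascoli argument for functions that are equicontinuous only asymptotically:
compactness of a product of intervals gives convergence at rational points, and the asymptotic
modulus makes the values Cauchy at every other point. -/
theorem exists_isSchemeLimit {f : ℝ → ℝ} (hf : IsBUC B f) :
    ∃ ν W, IsSchemeLimit B C f ν W := by
  have hK : IsCompact (Set.pi univ fun _ : ℚ × ℚ => Icc (-B) B) :=
    isCompact_univ_pi fun _ => isCompact_Icc
  obtain ⟨a, -, ν, hν, hlim⟩ := hK.tendsto_subseq
    (x := fun m (q : ℚ × ℚ) => scheme C f m ((q.1 : ℝ), (q.2 : ℝ)))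
    (fun m q _ => abs_le.1 ((isBUC_iter hB hC (mesh_pos m) hf _).bound _))
  rw [tendsto_pi_nhds] at hlim
  have hcau : ∀ p, ∃ w, Tendsto (fun j => scheme C f (ν j) p) atTop (𝓝 w) := by
    intro p
    apply cauchySeq_tendsto_of_complete
    rw [Metric.cauchySeq_iff']
    intro e he
    obtain ⟨δ, hδ, N, hN⟩ := scheme_equicontinuous hB hC hf (show 0 < e / 4 by linarith)
    obtain ⟨q₁, hq₁, hq₁'⟩ := exists_rat_btwn (show p.1 < p.1 + δ by linarith)
    obtain ⟨q₂, hq₂, hq₂'⟩ := exists_rat_btwn (show p.2 < p.2 + δ by linarith)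
    have h1 : |p.1 - q₁| ≤ δ := by rw [abs_le]; constructor <;> linarith
    have h2 : |p.2 - q₂| ≤ δ := by rw [abs_le]; constructor <;> linarith
    obtain ⟨N', hN'⟩ := Metric.cauchySeq_iff'.1 (hlim (q₁, q₂)).cauchySeq (e / 4) (by linarith)
    refine ⟨max N N', fun n hn => ?_⟩
    have e1 := hN (ν n) (((le_max_left _ _).trans hn).trans (hν.id_le n)) p (q₁, q₂) h1 h2
    have e2 := hN (ν (max N N')) ((le_max_left _ _).trans (hν.id_le _)) p (q₁, q₂) h1 h2
    have e3 := hN' n ((le_max_right _ _).trans hn)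
    have e4 := hN' (max N N') (le_max_right _ _)
    rw [Real.dist_eq] at e3 e4 ⊢
    simp only [Function.comp_apply] at e3 e4
    rw [abs_le] at e1 e2
    rw [abs_lt] at e3 e4 ⊢
    constructor <;> linarith [e1.1, e1.2, e2.1, e2.2, e3.1, e3.2, e4.1, e4.2]
  choose W hW using hcau
  exact ⟨ν, W, hν, hW⟩

/-! ### Elementary properties of the limit of the scheme. -/

variable {f : ℝ → ℝ} {ν : ℕ → ℕ} {W : ℝ × ℝ → ℝ} (hf : IsBUC B f)
  (hW : IsSchemeLimit B C f ν W)
include hf hW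

lemma IsSchemeLimit.bound (p : ℝ × ℝ) : |W p| ≤ B :=
  le_of_tendsto (hW.tendsto p).abs
    (Eventually.of_forall fun _ => (isBUC_iter hB hC (mesh_pos _) hf _).bound _)

omit hB hC hf in
lemma IsSchemeLimit.initial (x : ℝ) : W (0, x) = f x := by
  refine tendsto_nhds_unique (hW.tendsto (0, x)) ?_
  have : ∀ m, scheme C f m (0, x) = f x := fun m => by
    unfold scheme
    simp [iter]
  simp only [this]
  exact tendsto_const_nhds

lemma IsSchemeLimit.modulus {e : ℝ} (he : 0 < e) : ∃ δ > 0, ∀ p q : ℝ × ℝ, |p.1 - q.1| ≤ δ →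
    |p.2 - q.2| ≤ δ → |W p - W q| ≤ e := by
  obtain ⟨δ, hδ, N, hN⟩ := scheme_equicontinuous hB hC hf he
  refine ⟨δ, hδ, fun p q h1 h2 => ?_⟩
  refine le_of_tendsto ((hW.tendsto p).sub (hW.tendsto q)).abs ?_
  filter_upwards [eventually_ge_atTop N] with j hj
  exact hN _ (hj.trans (hW.mono.id_le j)) p q h1 h2

lemma IsSchemeLimit.continuous : Continuous W := by
  rw [Metric.continuous_iff]
  intro p e he
  obtain ⟨δ, hδ, h⟩ := hW.modulus hB hC hf (show 0 < e / 2 by linarith)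
  refine ⟨δ, hδ, fun q hq => ?_⟩
  rw [Prod.dist_eq, max_lt_iff, Real.dist_eq, Real.dist_eq] at hq
  rw [Real.dist_eq]
  linarith [h q p hq.1.le hq.2.le]

/-- Convergence along convergent sequences of points. -/
lemma IsSchemeLimit.tendsto_comp {ι : Type*} {l : Filter ι} {i : ι → ℕ} (hi : Tendsto i l atTop)
    {q : ι → ℝ × ℝ} {p : ℝ × ℝ} (hq : Tendsto q l (𝓝 p)) :
    Tendsto (fun j => scheme C f (ν (i j)) (q j)) l (𝓝 (W p)) := by
  rw [Metric.tendsto_nhds]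
  intro e he
  obtain ⟨δ, hδ, N, hN⟩ := scheme_equicontinuous hB hC hf (show 0 < e / 2 by linarith)
  have h1 := Metric.tendsto_nhds.1 ((hW.tendsto p).comp hi) (e / 2) (by linarith)
  have h2 := Metric.tendsto_nhds.1 hq δ hδ
  filter_upwards [h1, h2, hi.eventually_ge_atTop N] with j e1 e2 e3
  rw [Prod.dist_eq, max_lt_iff, Real.dist_eq, Real.dist_eq] at e2
  have e4 := hN (ν (i j)) (e3.trans (hW.mono.id_le _)) (q j) p e2.1.le e2.2.le
  rw [Real.dist_eq, Function.comp_apply] at e1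
  rw [Real.dist_eq]
  have := abs_sub_le (scheme C f (ν (i j)) (q j)) (scheme C f (ν (i j)) p) (W p)
  linarith

end Time

/-! ### The Hamiltonian in terms of second differences -/

/-- The part of the nonlocal operator near the singularity. -/
def inner (r : ℝ) (f : ℝ → ℝ) (x : ℝ) : ℝ := ∫ z in Ioc 0 r, secondDiff f x z / z ^ 2

lemma isOpen_Q : IsOpen Q := isOpen_Ioi.prod isOpen_univ

lemma mem_Q {t x : ℝ} : (t, x) ∈ Q ↔ 0 < t := by simp [Q]

section Test
variable {φ : ℝ × ℝ → ℝ} (hφ : ContDiffOn ℝ 2 φ Q)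
include hφ

lemma hasStrictFDerivAt_of_test {t : ℝ} (ht : 0 < t) (x : ℝ) :
    HasStrictFDerivAt φ (fderiv ℝ φ (t, x)) (t, x) :=
  ((hφ.contDiffAt (isOpen_Q.mem_nhds (mem_Q.2 ht))).hasStrictFDerivAt (by norm_num))

lemma hasDerivAt_dt {t : ℝ} (ht : 0 < t) (x : ℝ) :
    HasDerivAt (fun s => φ (s, x)) (fderiv ℝ φ (t, x) (1, 0)) t := by
  have h1 : HasDerivAt (fun s : ℝ => (s, x)) (1, 0) t :=
    (hasDerivAt_id t).prodMk (hasDerivAt_const t x)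
  exact HasFDerivAt.comp_hasDerivAt (f := fun s : ℝ => (s, x)) t
    (hasStrictFDerivAt_of_test hφ ht x).hasFDerivAt h1

lemma hasDerivAt_dx {t : ℝ} (ht : 0 < t) (x : ℝ) :
    HasDerivAt (fun y => φ (t, y)) (fderiv ℝ φ (t, x) (0, 1)) x := by
  have h1 : HasDerivAt (fun y : ℝ => (t, y)) (0, 1) x :=
    (hasDerivAt_const x t).prodMk (hasDerivAt_id x)
  exact HasFDerivAt.comp_hasDerivAt (f := fun y : ℝ => (t, y)) x
    (hasStrictFDerivAt_of_test hφ ht x).hasFDerivAt h1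

lemma dt_eq {t : ℝ} (ht : 0 < t) (x : ℝ) : dt φ t x = fderiv ℝ φ (t, x) (1, 0) :=
  (hasDerivAt_dt hφ ht x).deriv

lemma dx_eq {t : ℝ} (ht : 0 < t) (x : ℝ) : dx φ t x = fderiv ℝ φ (t, x) (0, 1) :=
  (hasDerivAt_dx hφ ht x).deriv

lemma continuous_slice_of_test {t : ℝ} (ht : 0 < t) : Continuous fun y => φ (t, y) :=
  continuous_iff_continuousAt.2 fun x => (hasDerivAt_dx hφ ht x).continuousAt

/-- The derivative of φ is Lipschitz on a compact box inside `Q`, and the mean value inequality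
applies to φ minus its linear part. Uniformity in t is needed later, where the times of the discrete
problems only converge to the contact time. -/
lemma exists_taylor_le {a b R : ℝ} (ha : 0 < a) : ∃ K ≥ 0, ∀ t ∈ Icc a b, ∀ x z,
    |x| ≤ R → |z| ≤ R → |φ (t, x + z) - φ (t, x) - dx φ t x * z| ≤ K * z ^ 2 := by
  have h1 : ContDiffOn ℝ 1 (fderiv ℝ φ) Q := hφ.fderiv_of_isOpen isOpen_Q (by norm_num)
  have h2 : ContDiffOn ℝ 1 (fderiv ℝ φ) (Icc a b ×ˢ Icc (-(2 * R)) (2 * R)) :=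
    h1.mono fun p hp => ⟨ha.trans_le hp.1.1, mem_univ _⟩
  obtain ⟨K, hK⟩ := h2.exists_lipschitzOnWith (by norm_num)
    ((convex_Icc a b).prod (convex_Icc _ _)) (isCompact_Icc.prod isCompact_Icc)
  refine ⟨K, K.2, fun t ht x z hx hz => ?_⟩
  have ht0 : 0 < t := ha.trans_le ht.1
  rw [abs_le] at hx hz
  have hx' : ∀ y ∈ uIcc x (x + z), (t, y) ∈ Icc a b ×ˢ Icc (-(2 * R)) (2 * R) ∧ |y - x| ≤ |z| := by
    intro y hy
    rcases le_total 0 z with h | h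
    · rw [uIcc_of_le (by linarith)] at hy
      refine ⟨⟨ht, by simp only; linarith [hy.1], by simp only; linarith [hy.2]⟩, ?_⟩
      rw [abs_of_nonneg h, abs_le]
      constructor <;> linarith [hy.1, hy.2]
    · rw [uIcc_of_ge (by linarith)] at hy
      refine ⟨⟨ht, by simp only; linarith [hy.1], by simp only; linarith [hy.2]⟩, ?_⟩
      rw [abs_of_nonpos h, abs_le]
      constructor <;> linarith [hy.1, hy.2]
  have hd : ∀ y ∈ uIcc x (x + z), HasDerivWithinAt (fun y => φ (t, y) - dx φ t x * y)
      (fderiv ℝ φ (t, y) (0, 1) - dx φ t x) (uIcc x (x + z)) y := by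
    intro y hy
    have := (hasDerivAt_dx hφ ht0 y).sub ((hasDerivAt_id y).const_mul (dx φ t x))
    simp only [mul_one] at this
    exact this.hasDerivWithinAt
  have hb : ∀ y ∈ uIcc x (x + z), ‖fderiv ℝ φ (t, y) (0, 1) - dx φ t x‖ ≤ K * |z| := by
    intro y hy
    rw [dx_eq hφ ht0, ← sub_apply]
    have h3 := hK.dist_le_mul _ (hx' y hy).1 _ (hx' x left_mem_uIcc).1
    rw [dist_eq_norm, Prod.dist_eq, dist_self, max_eq_right dist_nonneg, Real.dist_eq] at h3
    calc _ ≤ ‖fderiv ℝ φ (t, y) - fderiv ℝ φ (t, x)‖ * ‖((0 : ℝ), (1 : ℝ))‖ :=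
          ContinuousLinearMap.le_opNorm _ _
      _ = ‖fderiv ℝ φ (t, y) - fderiv ℝ φ (t, x)‖ := by simp [Prod.norm_def]
      _ ≤ K * |y - x| := h3
      _ ≤ K * |z| := mul_le_mul_of_nonneg_left (hx' y hy).2 K.2
  have := (convex_uIcc x (x + z)).norm_image_sub_le_of_norm_hasDerivWithin_le hd hb
    left_mem_uIcc right_mem_uIcc
  rw [Real.norm_eq_abs, Real.norm_eq_abs, add_sub_cancel_left, mul_assoc, ← sq, sq_abs] at this
  convert this using 2
  ring

lemma exists_secondDiff_le {a b R : ℝ} (ha : 0 < a) : ∃ K ≥ 0, ∀ t ∈ Icc a b, ∀ x z,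
    |x| ≤ R → |z| ≤ R → |secondDiff (fun y => φ (t, y)) x z| ≤ K * z ^ 2 := by
  obtain ⟨K, hK, h⟩ := exists_taylor_le hφ (b := b) (R := R) ha
  refine ⟨2 * K, by positivity, fun t ht x z hx hz => ?_⟩
  have h1 := h t ht x z hx hz
  have h2 := h t ht x (-z) hx (by rwa [abs_neg])
  rw [neg_sq, ← sub_eq_add_neg] at h2
  unfold secondDiff
  rw [abs_le] at h1 h2 ⊢
  constructor <;> linarith [h1.1, h1.2, h2.1, h2.2]

lemma integrableOn_inner {t : ℝ} (ht : 0 < t) (ρ x : ℝ) :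
    IntegrableOn (fun z => secondDiff (fun y => φ (t, y)) x z / z ^ 2) (Ioc 0 ρ) := by
  obtain ⟨K, hK, h⟩ := exists_secondDiff_le hφ (b := t) (R := max |x| ρ) ht
  have hc := (continuous_slice_of_test hφ ht).measurable
  have hm : Measurable fun z => secondDiff (fun y => φ (t, y)) x z / z ^ 2 := by
    unfold secondDiff
    exact (((hc.comp (measurable_const.add measurable_id)).add
      (hc.comp (measurable_const.sub measurable_id))).sub_const _).div (by fun_prop)
  refine Measure.integrableOn_of_bounded (M := K) (by simp) hm.aestronglyMeasurable
    ((ae_restrict_iff' measurableSet_Ioc).2 (Eventually.of_forall fun z hz => ?_))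
  rw [Real.norm_eq_abs, abs_div, abs_of_nonneg (sq_nonneg z)]
  refine div_le_of_le_mul₀ (sq_nonneg z) hK (h t ⟨le_rfl, le_rfl⟩ x z (le_max_left _ _) ?_)
  rw [abs_of_pos hz.1]
  exact hz.2.trans (le_max_right _ _)

/-- The compensating linear term is odd and disappears when z is paired with -z on the symmetric
interval. -/
lemma hamiltonian_eq {ρ t : ℝ} {u : ℝ × ℝ → ℝ} (hρ : 0 < ρ) (ht : 0 < t) (x : ℝ) :
    hamiltonian ρ φ u t x =
      (inner ρ (fun y => φ (t, y)) x + outer ρ (fun y => u (t, y)) x) * |dx φ t x| := by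
  unfold hamiltonian
  congr 2
  obtain ⟨K, hK, h⟩ := exists_taylor_le hφ (b := t) (R := max |x| ρ) ht
  set g : ℝ → ℝ := fun z => (φ (t, x + z) - φ (t, x) - dx φ t x * z) / z ^ 2 with hg
  have hc := (continuous_slice_of_test hφ ht).measurable
  have hgm : Measurable g :=
    (((hc.comp (measurable_const.add measurable_id)).sub_const _).sub (by fun_prop)).div
      (by fun_prop)
  have hgi : IntegrableOn g (Ioc (-ρ) ρ) := by
    refine Measure.integrableOn_of_bounded (M := K) (by simp) hgm.aestronglyMeasurable
      ((ae_restrict_iff' measurableSet_Ioc).2 (Eventually.of_forall fun z hz => ?_))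
    rw [Real.norm_eq_abs, hg, abs_div, abs_of_nonneg (sq_nonneg z)]
    refine div_le_of_le_mul₀ (sq_nonneg z) hK (h t ⟨le_rfl, le_rfl⟩ x z (le_max_left _ _) ?_)
    exact (abs_le.2 ⟨hz.1.le, hz.2⟩).trans (le_max_right _ _)
  have hi : IntervalIntegrable g volume (-ρ) ρ :=
    (intervalIntegrable_iff_integrableOn_Ioc_of_le (by linarith)).2 hgi
  have hi1 : IntervalIntegrable g volume (-ρ) 0 :=
    hi.mono_set (by rw [uIcc_of_le (by linarith), uIcc_of_le (by linarith)]
                    exact Icc_subset_Icc_right hρ.le)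
  have hi2 : IntervalIntegrable g volume 0 ρ :=
    hi.mono_set (by rw [uIcc_of_le (by linarith), uIcc_of_le (by linarith)]
                    exact Icc_subset_Icc_left (by linarith))
  have hi3 : IntervalIntegrable (fun z => g (-z)) volume 0 ρ := by
    rw [IntervalIntegrable.iff_comp_neg]
    simpa using hi1.symm
  calc ∫ z in Ioo (-ρ) ρ, g z = ∫ z in (-ρ)..ρ, g z := by
        rw [intervalIntegral.integral_of_le (by linarith), integral_Ioc_eq_integral_Ioo]
    _ = (∫ z in (0 : ℝ)..ρ, g (-z)) + ∫ z in (0 : ℝ)..ρ, g z := by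
        rw [intervalIntegral.integral_comp_neg, neg_zero,
          intervalIntegral.integral_add_adjacent_intervals hi1 hi2]
    _ = ∫ z in (0 : ℝ)..ρ, (g (-z) + g z) := (intervalIntegral.integral_add hi3 hi2).symm
    _ = _ := by
        rw [intervalIntegral.integral_of_le hρ.le, inner]
        congr 1
        ext z
        simp only [hg, secondDiff]
        rw [neg_sq, ← add_div, ← sub_eq_add_neg]
        ring

/-- At a contact point from above the increments of u are at most those of φ, so evaluating the
shell between r and ρ on φ instead of u increases the operator. An inequality with a small radius is
therefore the stronger one. -/
lemma inner_add_outer_mono {r ρ C t : ℝ} {u : ℝ → ℝ} (hr : 0 < r) (hrρ : r ≤ ρ) (ht : 0 < t)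
    {x : ℝ} (hu : Measurable u) (huC : ∀ x, |u x| ≤ C)
    (h : ∀ z, u (x + z) - u x ≤ φ (t, x + z) - φ (t, x)) :
    inner r (fun y => φ (t, y)) x + outer r u x ≤
      inner ρ (fun y => φ (t, y)) x + outer ρ u x := by
  rw [outer_eq hr hu huC, outer_eq (hr.trans_le hrρ) hu huC]
  unfold inner
  rw [← Ioc_union_Ioc_eq_Ioc hr.le hrρ, ← Ioc_union_Ioi_eq_Ioi hrρ,
    setIntegral_union (Ioc_disjoint_Ioc_of_le le_rfl) measurableSet_Ioc
      ((integrableOn_inner hφ ht ρ x).mono_set (Ioc_subset_Ioc_right hrρ))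
      ((integrableOn_inner hφ ht ρ x).mono_set (Ioc_subset_Ioc_left hr.le)),
    setIntegral_union (Ioc_disjoint_Ioi le_rfl) measurableSet_Ioi
      ((integrableOn_secondDiff hr hu huC x).mono_set Ioc_subset_Ioi_self)
      ((integrableOn_secondDiff hr hu huC x).mono_set (Ioi_subset_Ioi hrρ))]
  have : ∫ z in Ioc r ρ, secondDiff u x z / z ^ 2
      ≤ ∫ z in Ioc r ρ, secondDiff (fun y => φ (t, y)) x z / z ^ 2 := by
    refine setIntegral_mono_on ((integrableOn_secondDiff hr hu huC x).mono_set Ioc_subset_Ioi_self)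
      ((integrableOn_inner hφ ht ρ x).mono_set (Ioc_subset_Ioc_left hr.le)) measurableSet_Ioc
      fun z _ => ?_
    refine div_le_div_of_nonneg_right ?_ (sq_nonneg z)
    have h1 := h z
    have h2 := h (-z)
    rw [← sub_eq_add_neg] at h2
    unfold secondDiff
    linarith
  linarith

end Test

/-- Strict differentiability allows both end points of the difference quotient to move, as they do
for near-maximum points of the discrete problems. -/
lemma tendsto_slope_of_hasStrictFDerivAt {ι : Type*} {l : Filter ι} {φ : ℝ × ℝ → ℝ}
    {L : ℝ × ℝ →L[ℝ] ℝ} {p v : ℝ × ℝ} (hφ : HasStrictFDerivAt φ L p) {a b : ι → ℝ × ℝ}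
    (ha : Tendsto a l (𝓝 p)) (hb : Tendsto b l (𝓝 p)) {τ : ι → ℝ} (hτ : ∀ j, τ j ≠ 0)
    (hab : ∀ j, a j - b j = τ j • v) :
    Tendsto (fun j => (φ (a j) - φ (b j)) / τ j) l (𝓝 (L v)) := by
  have h1 := hφ.isLittleO.comp_tendsto (ha.prodMk_nhds hb)
  have h2 : (fun j => φ (a j) - φ (b j) - L (τ j • v)) =o[l] fun j => τ j := by
    have h3 : (fun j => a j - b j) =O[l] fun j => τ j := by
      simp only [hab]
      refine Asymptotics.IsBigO.of_bound ‖v‖ (Eventually.of_forall fun j => ?_)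
      rw [norm_smul, mul_comm]
    refine (h1.trans_isBigO h3).congr_left fun j => ?_
    simp only [Function.comp_apply, hab]
  have h4 := h2.tendsto_div_nhds_zero
  have h5 : ∀ j, (φ (a j) - φ (b j)) / τ j
      = (φ (a j) - φ (b j) - L (τ j • v)) / τ j + L v := by
    intro j
    rw [map_smul, smul_eq_mul]
    field_simp [hτ j]
    ring
  simp only [h5]
  simpa using h4.add_const (L v)

/-! ### The limit of the scheme is a viscosity solution -/

section Limit
variable {B C : ℝ} {f : ℝ → ℝ} {ν : ℕ → ℕ} {W φ : ℝ × ℝ → ℝ} {t₀ x₀ : ℝ}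

/-- Near-maximum points of the discrete problem which converge to the strict maximum point. -/
lemma IsSchemeLimit.exists_near_max (hB : 0 < B) (hC : C = 24 * B) (hf : IsBUC B f)
    (hW : IsSchemeLimit B C f ν W) (hφ : ContinuousOn φ Q) {r₀ : ℝ} (hr₀ : 0 < r₀)
    (hrt : r₀ < t₀)
    (hmax : ∀ t > 0, ∀ x, W (t, x) - φ (t, x) + ((t - t₀) ^ 2 + (x - x₀) ^ 4)
      ≤ W (t₀, x₀) - φ (t₀, x₀)) :
    ∃ (i k : ℕ → ℕ) (y : ℕ → ℝ), Tendsto i atTop atTop ∧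
      Tendsto (fun j => ((k j : ℝ) * timeStep C (mesh (ν (i j))), y j)) atTop (𝓝 (t₀, x₀)) ∧
      Tendsto (fun j => iter C (mesh (ν (i j))) f (k j) (y j)) atTop (𝓝 (W (t₀, x₀))) ∧
      ∀ᶠ j in atTop, ∀ (k' : ℕ) y', |k' * timeStep C (mesh (ν (i j))) - t₀| ≤ r₀ → |y' - x₀| ≤ r₀ →
        iter C (mesh (ν (i j))) f k' y' - φ (k' * timeStep C (mesh (ν (i j))), y') ≤
          iter C (mesh (ν (i j))) f (k j) (y j) - φ (k j * timeStep C (mesh (ν (i j))), y j)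
            + timeStep C (mesh (ν (i j))) * mesh (ν (i j)) := by
  have hC0 : 0 < C := by linarith
  set τ : ℕ → ℝ := fun m => timeStep C (mesh m) with hτdef
  have hτ : ∀ m, 0 < τ m := fun m => timeStep_pos hC0 (mesh_pos m)
  set D : Set (ℝ × ℝ) := Icc (t₀ - r₀) (t₀ + r₀) ×ˢ Icc (x₀ - r₀) (x₀ + r₀) with hD
  have hDc : IsCompact D := isCompact_Icc.prod isCompact_Icc
  have hDQ : D ⊆ Q := fun p hp => ⟨by have := hp.1.1; simp only [mem_Ioi]; linarith, mem_univ _⟩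
  have hmemD : ∀ t x, |t - t₀| ≤ r₀ → |x - x₀| ≤ r₀ → (t, x) ∈ D := by
    intro t x h1 h2
    rw [abs_le] at h1 h2
    exact ⟨⟨by simp only; linarith, by simp only; linarith⟩,
      ⟨by simp only; linarith, by simp only; linarith⟩⟩
  obtain ⟨M, hM⟩ := hDc.exists_bound_of_continuousOn (hφ.mono hDQ)
  have hnear : ∀ m, ∃ (k : ℕ) (y : ℝ), τ m ≤ r₀ → (k * τ m, y) ∈ D ∧
      ∀ (k' : ℕ) y', |k' * τ m - t₀| ≤ r₀ → |y' - x₀| ≤ r₀ →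
        iter C (mesh m) f k' y' - φ (k' * τ m, y') ≤
          iter C (mesh m) f k y - φ (k * τ m, y) + τ m * mesh m := by
    intro m
    by_cases hm : τ m ≤ r₀
    swap
    · exact ⟨0, 0, fun h => absurd h hm⟩
    -- A maximum over the box is approximated up to τ times the mesh size, an error that is still
    -- small after division by τ. The condition τ ≤ r₀ guarantees that some grid time lies in the
    -- box.
    set A : Set ℝ := {w | ∃ (k : ℕ) (y : ℝ), |k * τ m - t₀| ≤ r₀ ∧ |y - x₀| ≤ r₀ ∧
      w = iter C (mesh m) f k y - φ (k * τ m, y)} with hA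
    have hne : A.Nonempty := by
      refine ⟨_, ⌊t₀ / τ m⌋₊, x₀, ?_, by simpa using hr₀.le, rfl⟩
      have h1 := Nat.floor_le (show 0 ≤ t₀ / τ m from div_nonneg (by linarith) (hτ m).le)
      have h2 := Nat.lt_floor_add_one (t₀ / τ m)
      rw [le_div_iff₀ (hτ m)] at h1
      rw [div_lt_iff₀ (hτ m), add_mul, one_mul] at h2
      rw [abs_le]
      constructor <;> linarith
    have hbdd : BddAbove A := by
      refine ⟨B + M, ?_⟩
      rintro w ⟨k, y, h1, h2, rfl⟩
      have h3 := (abs_le.1 ((isBUC_iter hB hC (mesh_pos m) hf k).bound y)).2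
      have h4 := (abs_le.1 (hM _ (hmemD _ _ h1 h2))).1
      linarith
    have hpos : 0 < τ m * mesh m := mul_pos (hτ m) (mesh_pos m)
    obtain ⟨w, ⟨k, y, h1, h2, rfl⟩, hw⟩ :=
      exists_lt_of_lt_csSup hne (show sSup A - τ m * mesh m < sSup A by linarith)
    refine ⟨k, y, fun _ => ⟨hmemD _ _ h1 h2, fun k' y' h1' h2' => ?_⟩⟩
    have := le_csSup hbdd (show _ ∈ A from ⟨k', y', h1', h2', rfl⟩)
    linarith
  choose k y hky using hnear
  have hτ0 : Tendsto τ atTop (𝓝 0) := tendsto_timeStep C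
  have hτν := hτ0.comp hW.mono.tendsto_atTop
  have hev : ∀ᶠ j in atTop, τ (ν j) ≤ r₀ := hτν.eventually_le_const hr₀
  obtain ⟨p, hp, ψ, hψ, hlim⟩ := hDc.tendsto_subseq'
    (x := fun j => ((k (ν j) : ℝ) * τ (ν j), y (ν j)))
    ((hev.mono fun j hj => (hky _ hj).1).frequently)
  have hψt := hψ.tendsto_atTop
  have hval : ∀ j, scheme C f (ν (ψ j)) ((k (ν (ψ j)) : ℝ) * τ (ν (ψ j)), y (ν (ψ j)))
      = iter C (mesh (ν (ψ j))) f (k (ν (ψ j))) (y (ν (ψ j))) := by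
    intro j
    unfold scheme
    simp only
    rw [mul_div_cancel_right₀ _ (hτ _).ne', Nat.floor_natCast]
  have hconv : Tendsto (fun j => iter C (mesh (ν (ψ j))) f (k (ν (ψ j))) (y (ν (ψ j)))) atTop
      (𝓝 (W p)) := by
    have := hW.tendsto_comp hB hC hf hψt hlim
    simpa only [Function.comp_apply, hval] using this
  have hmesh : Tendsto (fun j => mesh (ν (ψ j))) atTop (𝓝 0) :=
    tendsto_mesh.comp (hW.mono.tendsto_atTop.comp hψt)
  have hfloor : Tendsto (fun j => (⌊t₀ / τ (ν (ψ j))⌋₊ : ℝ) * τ (ν (ψ j))) atTop (𝓝 t₀) := by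
    have hτψ := hτν.comp hψt
    refine tendsto_of_tendsto_of_tendsto_of_le_of_le (g := fun j => t₀ - τ (ν (ψ j)))
      (h := fun _ => t₀) ?_ tendsto_const_nhds (fun j => ?_) (fun j => ?_)
    · simpa using tendsto_const_nhds.sub hτψ
    · have h2 := Nat.lt_floor_add_one (t₀ / τ (ν (ψ j)))
      rw [div_lt_iff₀ (hτ _), add_mul, one_mul] at h2
      simp only
      linarith
    · have h1 := Nat.floor_le
        (show 0 ≤ t₀ / τ (ν (ψ j)) from div_nonneg (by linarith) (hτ _).le)
      rwa [le_div_iff₀ (hτ _)] at h1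
  have hcomp : W (t₀, x₀) - φ (t₀, x₀) ≤ W p - φ p := by
    have h1 : Tendsto (fun j => scheme C f (ν (ψ j)) (t₀, x₀)
        - φ ((⌊t₀ / τ (ν (ψ j))⌋₊ : ℝ) * τ (ν (ψ j)), x₀)) atTop
        (𝓝 (W (t₀, x₀) - φ (t₀, x₀))) := by
      refine ((hW.tendsto _).comp hψt).sub ?_
      have hc : ContinuousAt φ (t₀, x₀) :=
        hφ.continuousAt (isOpen_Q.mem_nhds (mem_Q.2 (by linarith)))
      exact hc.tendsto.comp (hfloor.prodMk_nhds tendsto_const_nhds)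
    have h2 : Tendsto (fun j => iter C (mesh (ν (ψ j))) f (k (ν (ψ j))) (y (ν (ψ j)))
        - φ ((k (ν (ψ j)) : ℝ) * τ (ν (ψ j)), y (ν (ψ j))) + τ (ν (ψ j)) * mesh (ν (ψ j))) atTop
        (𝓝 (W p - φ p + 0 * 0)) := by
      refine (hconv.sub ?_).add ((hτν.comp hψt).mul hmesh)
      have hc : ContinuousAt φ p := hφ.continuousAt (isOpen_Q.mem_nhds (hDQ hp))
      exact hc.tendsto.comp hlim
    rw [mul_zero, add_zero] at h2
    refine le_of_tendsto_of_tendsto h1 h2 ?_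
    filter_upwards [hψt.eventually hev, (Metric.tendsto_nhds.1 hfloor) r₀ hr₀] with j hj hj'
    rw [Real.dist_eq] at hj'
    exact (hky _ hj).2 _ x₀ hj'.le (by simpa using hr₀.le)
  -- The limit point is again a maximum, and the gap (t - t₀)² + (x - x₀)⁴ identifies it.
  have hpeq : p = (t₀, x₀) := by
    have h1 := hmax p.1 (hDQ hp).1 p.2
    have h2 : (p.1 - t₀) ^ 2 + (p.2 - x₀) ^ 4 ≤ 0 := by linarith
    have h3 : (p.1 - t₀) ^ 2 = 0 := by
      nlinarith [sq_nonneg (p.1 - t₀), sq_nonneg ((p.2 - x₀) ^ 2)]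
    have h4 : (p.2 - x₀) ^ 4 = 0 := by
      nlinarith [sq_nonneg (p.1 - t₀), sq_nonneg ((p.2 - x₀) ^ 2)]
    have h5 := pow_eq_zero_iff (by norm_num) |>.1 h3
    have h6 := pow_eq_zero_iff (by norm_num) |>.1 h4
    exact Prod.ext (by simp only; linarith) (by simp only; linarith)
  subst hpeq
  refine ⟨ψ, fun j => k (ν (ψ j)), fun j => y (ν (ψ j)), hψt, hlim, hconv, ?_⟩
  filter_upwards [hψt.eventually hev] with j hj using (hky _ hj).2

/-- The test function near the point, the numerical solution away from it. -/
def patch (r : ℝ) (x : ℝ) (f g : ℝ → ℝ) (y : ℝ) : ℝ :=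
  open Classical in if |y - x| < r then f y else g y

lemma measurable_patch {r x : ℝ} {f g : ℝ → ℝ} (hf : Measurable f) (hg : Measurable g) :
    Measurable (patch r x f g) :=
  Measurable.ite (measurableSet_lt (by fun_prop) measurable_const) hf hg

lemma patch_near {r x y : ℝ} {f g : ℝ → ℝ} (h : |y - x| < r) : patch r x f g y = f y := if_pos h

lemma patch_far {r x y : ℝ} {f g : ℝ → ℝ} (h : r ≤ |y - x|) : patch r x f g y = g y :=
  if_neg (not_lt.2 h)

/-- Convergence of the discretized nonlocal operator. -/
lemma tendsto_outer_patch {r K C' t : ℝ} (hr : 0 < r) {h x : ℕ → ℝ}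
    (hh : Tendsto h atTop (𝓝 0)) (hh0 : ∀ j, 0 < h j) {F G : ℕ → ℝ → ℝ}
    (hF : ∀ᶠ j in atTop, Measurable (F j)) (hG : ∀ᶠ j in atTop, Measurable (G j))
    (hb : ∀ᶠ j in atTop, ∀ y, |patch r (x j) (F j) (G j) y| ≤ C')
    (hK : ∀ᶠ j in atTop, ∀ z, |z| ≤ r → |secondDiff (F j) (x j) z| ≤ K * z ^ 2)
    {f₀ g₀ : ℝ → ℝ} (hg₀ : Measurable g₀) (hg₀C : ∀ x, |g₀ x| ≤ C')
    (hlf : ∀ z, |z| < r → Tendsto (fun j => F j (x j + z) - F j (x j)) atTop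
      (𝓝 (f₀ (t + z) - f₀ t)))
    (hlF : Tendsto (fun j => F j (x j)) atTop (𝓝 (g₀ t)))
    (hlg : ∀ z, Tendsto (fun j => G j (x j + z)) atTop (𝓝 (g₀ (t + z))))
    (hfi : IntegrableOn (fun z => secondDiff f₀ t z / z ^ 2) (Ioc 0 r)) :
    Tendsto (fun j => outer (h j) (patch r (x j) (F j) (G j)) (x j)) atTop
      (𝓝 (inner r f₀ t + outer r g₀ t)) := by
  set L : ℝ → ℝ := fun z => if z ≤ r then secondDiff f₀ t z / z ^ 2 else
    secondDiff g₀ t z / z ^ 2 with hL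
  have hC' : 0 ≤ C' := (abs_nonneg _).trans (hg₀C 0)
  have hK0 : 0 ≤ K := by
    obtain ⟨j, hj⟩ := hK.exists
    have := (abs_nonneg _).trans (hj r (abs_of_pos hr).le)
    exact nonneg_of_mul_nonneg_left this (by positivity)
  have hsum : inner r f₀ t + outer r g₀ t = ∫ z in Ioi 0, L z := by
    have hL1 : EqOn (fun z => secondDiff f₀ t z / z ^ 2) L (Ioc 0 r) := fun z hz => by
      simp only [hL, if_pos hz.2]
    have hL2 : EqOn (fun z => secondDiff g₀ t z / z ^ 2) L (Ioi r) := fun z hz => by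
      simp only [hL, if_neg (not_le.2 (mem_Ioi.1 hz))]
    rw [outer_eq hr hg₀ hg₀C, inner, ← Ioc_union_Ioi_eq_Ioi hr.le,
      setIntegral_union (Ioc_disjoint_Ioi le_rfl) measurableSet_Ioi
        (hfi.congr_fun hL1 measurableSet_Ioc)
        ((integrableOn_secondDiff hr hg₀ hg₀C t).congr_fun hL2 measurableSet_Ioi),
      setIntegral_congr_fun measurableSet_Ioc hL1, setIntegral_congr_fun measurableSet_Ioi hL2]
  set w : ℕ → ℝ → ℝ := fun j => patch r (x j) (F j) (G j) with hw
  set H : ℕ → ℝ → ℝ := fun j z =>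
    (Ioi (h j)).indicator (fun z => secondDiff (w j) (x j) z / z ^ 2) z with hH
  have hwm : ∀ᶠ j in atTop, Measurable (w j) := by
    filter_upwards [hF, hG] with j h1 h2 using measurable_patch h1 h2
  have hout : ∀ᶠ j in atTop, outer (h j) (w j) (x j) = ∫ z in Ioi 0, H j z := by
    filter_upwards [hwm, hb] with j h1 h2
    rw [outer_eq (hh0 j) h1 h2, setIntegral_indicator measurableSet_Ioi, Ioi_inter_Ioi,
      max_eq_right (hh0 j).le]
  rw [hsum]
  refine Tendsto.congr' (hout.mono fun _ h => h.symm) ?_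
  -- Near the singularity the second differences of the smooth part are quadratic, away from it the
  -- values are bounded; neither bound sees the truncation radius.
  set bound : ℝ → ℝ := fun z => if z < r then K else 4 * C' * (1 / z ^ 2) with hbound
  have hwx : ∀ j, w j (x j) = F j (x j) := fun j => patch_near (by simpa using hr)
  have hnear : ∀ j z, |z| < r → w j (x j + z) = F j (x j + z) := fun j z hz =>
    patch_near (by simpa using hz)
  have hfar : ∀ j z, r ≤ |z| → w j (x j + z) = G j (x j + z) := fun j z hz =>
    patch_far (by simpa using hz)
  refine tendsto_integral_filter_of_dominated_convergence bound ?_ ?_ ?_ ?_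
  · filter_upwards [hwm] with j h1
    refine (Measurable.indicator ?_ measurableSet_Ioi).aestronglyMeasurable
    unfold secondDiff
    fun_prop
  · filter_upwards [hb, hK] with j h1 h2
    refine (ae_restrict_iff' measurableSet_Ioi).2 (Eventually.of_forall fun z hz => ?_)
    have hz0 : 0 < z := hz
    have hb0 : 0 ≤ bound z := by
      simp only [hbound]
      split_ifs <;> positivity
    rw [hH, Real.norm_eq_abs]
    by_cases hzh : z ∈ Ioi (h j)
    swap
    · simp only [indicator_of_notMem hzh, abs_zero]
      exact hb0
    simp only [indicator_of_mem hzh]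
    rw [abs_div, abs_of_nonneg (sq_nonneg z), div_le_iff₀ (by positivity)]
    simp only [hbound]
    split_ifs with hzr
    · have h3 : secondDiff (w j) (x j) z = secondDiff (F j) (x j) z := by
        unfold secondDiff
        rw [hnear j z (by rwa [abs_of_pos hz0]), hwx, sub_eq_add_neg (x j),
          hnear j (-z) (by rwa [abs_neg, abs_of_pos hz0])]
      rw [h3]
      exact h2 z (by rw [abs_of_pos hz0]; exact hzr.le)
    · rw [mul_assoc, one_div, inv_mul_cancel₀ (by positivity), mul_one]
      exact abs_secondDiff_le h1 (x j) z
  · rw [← IntegrableOn, ← Ioo_union_Ici_eq_Ioi hr]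
    refine IntegrableOn.union ?_ ?_
    · refine IntegrableOn.congr_fun (f := fun _ => K) (integrableOn_const (by simp)) ?_
        measurableSet_Ioo
      intro z hz
      simp only [hbound, if_pos hz.2]
    · refine IntegrableOn.congr_fun ((integrableOn_inv_sq_Ici hr).const_mul (4 * C')) ?_
        measurableSet_Ici
      intro z hz
      simp only [hbound, if_neg (not_lt.2 (mem_Ici.1 hz))]
  -- The patched function may jump at distance r, which is a null set of z.
  · have hne : ∀ᵐ z : ℝ ∂volume.restrict (Ioi 0), z ≠ r :=
      ae_restrict_of_ae (by simp [ae_iff])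
    filter_upwards [hne, ae_restrict_mem measurableSet_Ioi] with z hzr hz
    have hz0 : 0 < z := hz
    have hev : ∀ᶠ j in atTop, H j z = secondDiff (w j) (x j) z / z ^ 2 := by
      filter_upwards [hh.eventually_lt_const hz0] with j hj
      simp only [hH]
      rw [indicator_of_mem (mem_Ioi.2 hj)]
    refine Tendsto.congr' (hev.mono fun _ h => h.symm) ?_
    simp only [hL]
    split_ifs with hzr'
    · have hlt : |z| < r := by rw [abs_of_pos hz0]; exact lt_of_le_of_ne hzr' hzr
      have h3 : ∀ j, secondDiff (w j) (x j) z =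
          (F j (x j + z) - F j (x j)) + (F j (x j + -z) - F j (x j)) := by
        intro j
        unfold secondDiff
        rw [hnear j z hlt, hwx, sub_eq_add_neg (x j), hnear j (-z) (by rwa [abs_neg])]
        ring
      have h4 : secondDiff f₀ t z = (f₀ (t + z) - f₀ t) + (f₀ (t + -z) - f₀ t) := by
        unfold secondDiff
        rw [sub_eq_add_neg t]
        ring
      simp only [h3, h4]
      exact ((hlf z hlt).add (hlf (-z) (by rwa [abs_neg]))).div_const _
    · have hge : r ≤ |z| := by rw [abs_of_pos hz0]; exact (not_le.1 hzr').le
      have h3 : ∀ j, secondDiff (w j) (x j) z =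
          G j (x j + z) + G j (x j + -z) - 2 * F j (x j) := by
        intro j
        unfold secondDiff
        rw [hfar j z hge, hwx, sub_eq_add_neg (x j), hfar j (-z) (by rwa [abs_neg])]
      have h4 : secondDiff g₀ t z = g₀ (t + z) + g₀ (t + -z) - 2 * g₀ t := by
        unfold secondDiff
        rw [sub_eq_add_neg t]
      simp only [h3, h4]
      exact (((hlg z).add (hlg (-z))).sub (hlF.const_mul 2)).div_const _

end Limit

section Limit
variable {B C : ℝ} {f : ℝ → ℝ} {ν : ℕ → ℕ} {W φ : ℝ × ℝ → ℝ} {t₀ x₀ : ℝ}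

/-- The viscosity inequality at a strict maximum point, with a small radius. -/
lemma IsSchemeLimit.viscosity_strict (hB : 0 < B) (hC : C = 24 * B) (hf : IsBUC B f)
    (hW : IsSchemeLimit B C f ν W) (hφ : ContDiffOn ℝ 2 φ Q) (ht₀ : 0 < t₀)
    (hmax : ∀ t > 0, ∀ x, W (t, x) - φ (t, x) + ((t - t₀) ^ 2 + (x - x₀) ^ 4)
      ≤ W (t₀, x₀) - φ (t₀, x₀)) :
    ∃ r₁ > 0, ∀ r, 0 < r → r < r₁ → dt φ t₀ x₀ ≤
      (inner r (fun y => φ (t₀, y)) x₀ + outer r (fun y => W (t₀, y)) x₀) * |dx φ t₀ x₀| := by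
  have hC0 : 0 < C := by linarith
  have hcont := hφ.continuousOn
  have hcat : ContinuousAt φ (t₀, x₀) := hcont.continuousAt (isOpen_Q.mem_nhds (mem_Q.2 ht₀))
  -- An oscillation of at most B / 2 around the centre keeps the patched functions below 3B, inside
  -- the range where the scheme is monotone.
  obtain ⟨r₂, hr₂, hosc⟩ := Metric.continuousAt_iff.1 hcat (B / 2) (by linarith)
  set r₀ := min (r₂ / 2) (t₀ / 2) with hr₀d
  have hr₀ : 0 < r₀ := by positivity
  have hr₀2 : r₀ < r₂ := (min_le_left _ _).trans_lt (by linarith)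
  have hr₀t : r₀ < t₀ := (min_le_right _ _).trans_lt (by linarith)
  have hosc' : ∀ t x, |t - t₀| ≤ r₀ → |x - x₀| ≤ r₀ → |φ (t, x) - φ (t₀, x₀)| ≤ B / 2 := by
    intro t x h1 h2
    have := hosc (x := (t, x)) (by
      rw [Prod.dist_eq, max_lt_iff, Real.dist_eq, Real.dist_eq]
      exact ⟨h1.trans_lt hr₀2, h2.trans_lt hr₀2⟩)
    rw [Real.dist_eq] at this
    exact this.le
  obtain ⟨i, k, y, hi, hty, hiter, hnear⟩ := hW.exists_near_max hB hC hf hcont hr₀ hr₀t hmax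
  have hm : Tendsto (fun j => ν (i j)) atTop atTop := hW.mono.tendsto_atTop.comp hi
  obtain ⟨K, hK, hsd⟩ := exists_secondDiff_le hφ (a := t₀ - r₀) (b := t₀ + r₀)
    (R := |x₀| + r₀) (by linarith)
  refine ⟨r₀ / 2, by linarith, fun r hr hr1 => ?_⟩
  set h : ℕ → ℝ := fun j => mesh (ν (i j)) with hh
  set τ : ℕ → ℝ := fun j => timeStep C (mesh (ν (i j))) with hτ
  set t : ℕ → ℝ := fun j => (k j : ℝ) * τ j with ht
  set s : ℕ → ℝ := fun j => t j - τ j with hs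
  have hh0 : ∀ j, 0 < h j := fun j => mesh_pos _
  have hτ0 : ∀ j, 0 < τ j := fun j => timeStep_pos hC0 (hh0 j)
  have hhl : Tendsto h atTop (𝓝 0) := tendsto_mesh.comp hm
  have hτl : Tendsto τ atTop (𝓝 0) := (tendsto_timeStep C).comp hm
  have htl : Tendsto t atTop (𝓝 t₀) := (continuous_fst.tendsto _).comp hty
  have hyl : Tendsto y atTop (𝓝 x₀) := (continuous_snd.tendsto _).comp hty
  have hsl : Tendsto s atTop (𝓝 t₀) := by simpa using htl.sub hτl
  -- With this constant, slack included, φ + c lies above the iterates in the box and nearly touches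
  -- them at (t, y). It is used one time step earlier, at s = t - τ.
  set c : ℕ → ℝ := fun j => iter C (h j) f (k j) (y j) - φ (t j, y j) + τ j * h j with hc
  have hcl : Tendsto c atTop (𝓝 (W (t₀, x₀) - φ (t₀, x₀))) := by
    have := (hiter.sub (hcat.tendsto.comp hty)).add (hτl.mul hhl)
    simpa using this
  set F : ℕ → ℝ → ℝ := fun j z => φ (s j, z) + c j with hF
  -- The subtraction of naturals is genuine only once k ≥ 1, which holds for large j because t₀ > 0
  -- (`ev6`).
  set G : ℕ → ℝ → ℝ := fun j => iter C (h j) f (k j - 1) with hG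
  set w : ℕ → ℝ → ℝ := fun j => patch r (y j) (F j) (G j) with hw
  -- eventual facts
  have ev1 : ∀ᶠ j in atTop, |t j - t₀| ≤ r₀ := by
    filter_upwards [Metric.tendsto_nhds.1 htl r₀ hr₀] with j hj
    rw [Real.dist_eq] at hj; exact hj.le
  have ev2 : ∀ᶠ j in atTop, |s j - t₀| ≤ r₀ := by
    filter_upwards [Metric.tendsto_nhds.1 hsl r₀ hr₀] with j hj
    rw [Real.dist_eq] at hj; exact hj.le
  have ev3 : ∀ᶠ j in atTop, |y j - x₀| ≤ r₀ / 2 := by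
    filter_upwards [Metric.tendsto_nhds.1 hyl (r₀ / 2) (by linarith)] with j hj
    rw [Real.dist_eq] at hj; exact hj.le
  have ev4 : ∀ᶠ j in atTop, h j < r := hhl.eventually_lt_const hr
  have ev5 : ∀ᶠ j in atTop, τ j * h j ≤ B := by
    have := hτl.mul hhl
    rw [mul_zero] at this
    exact this.eventually_le_const hB
  have ev6 : ∀ᶠ j in atTop, 1 ≤ k j := by
    filter_upwards [htl.eventually_const_lt ht₀] with j hj
    by_contra hk
    have : k j = 0 := by omega
    simp [ht, this] at hj
  have hsk : ∀ᶠ j in atTop, s j = ((k j - 1 : ℕ) : ℝ) * τ j := by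
    filter_upwards [ev6] with j hj
    simp only [hs, ht]
    rw [Nat.cast_sub hj]
    push_cast
    ring
  have hspos : ∀ᶠ j in atTop, 0 < s j := by
    filter_upwards [ev2] with j hj
    linarith [(abs_le.1 hj).1]
  have hFm : ∀ᶠ j in atTop, Measurable (F j) := by
    filter_upwards [hspos] with j hj
    exact (continuous_slice_of_test hφ hj).measurable.add_const _
  have hGb : ∀ j, IsBUC B (G j) := fun j => isBUC_iter hB hC (hh0 j) hf _
  have hGm : ∀ j, Measurable (G j) := fun j => (hGb j).continuous.measurable
  have hwb : ∀ᶠ j in atTop, ∀ z, |w j z| ≤ 3 * B := by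
    filter_upwards [ev1, ev2, ev3, ev5] with j h1 h2 h3 h5 z
    by_cases hz : |z - y j| < r
    · simp only [hw]
      rw [patch_near hz]
      have h4 : |z - x₀| ≤ r₀ := by
        have := abs_sub_le z (y j) x₀
        linarith
      have a1 := abs_le.1 (hosc' _ _ h2 h4)
      have a2 := abs_le.1 (hosc' _ _ h1 (h3.trans (by linarith)))
      have a3 := abs_le.1 ((isBUC_iter hB hC (hh0 j) hf (k j)).bound (y j))
      have a4 : 0 < τ j * h j := mul_pos (hτ0 j) (hh0 j)
      simp only [hF, hc]
      rw [abs_le]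
      constructor <;> linarith
    · simp only [hw]
      rw [patch_far (not_lt.1 hz)]
      exact ((hGb j).bound z).trans (by linarith)
  have hGw : ∀ᶠ j in atTop, ∀ z, G j z ≤ w j z := by
    filter_upwards [ev2, ev3, hsk, hnear] with j h2 h3 h4 h5 z
    by_cases hz : |z - y j| < r
    · simp only [hw]
      rw [patch_near hz]
      have h6 : |z - x₀| ≤ r₀ := by
        have := abs_sub_le z (y j) x₀
        linarith
      have := h5 (k j - 1) z (by rw [← h4]; exact h2) h6
      rw [← h4] at this
      simp only [hF, hG, hc]
      linarith
    · simp only [hw]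
      rw [patch_far (not_lt.1 hz)]
  -- Monotonicity compares the step from the previous iterate with the step from the patched
  -- function above it. Dividing the slack τh by τ leaves the summand h.
  have hstep : ∀ᶠ j in atTop, (φ (t j, y j) - φ (s j, y j)) / τ j ≤ h j + rate (h j) (w j) (y j) := by
    filter_upwards [hGw, hwb, hFm, ev6] with j h1 h2 h3 h6
    have h4 := step_mono hC0 (hh0 j) (hGm j) (measurable_patch h3 (hGm j))
      (fun z => ((hGb j).bound z).trans (by linarith)) (fun z => (h2 z).trans (by linarith))
      h1 (y j)
    have h5 : step C (h j) (G j) (y j) = iter C (h j) f (k j) (y j) := by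
      have : k j = (k j - 1) + 1 := by omega
      conv_rhs => rw [this]
      rfl
    have h7 : w j (y j) = φ (s j, y j) + c j := patch_near (by simpa using hr)
    rw [h5] at h4
    rw [div_le_iff₀ (hτ0 j)]
    change iter C (h j) f (k j) (y j) ≤ w j (y j) + τ j * rate (h j) (w j) (y j) at h4
    rw [h7] at h4
    simp only [hc] at h4
    linarith
  -- limits
  have hsy : Tendsto (fun j => (s j, y j)) atTop (𝓝 (t₀, x₀)) := hsl.prodMk_nhds hyl
  have hstrict := hasStrictFDerivAt_of_test hφ ht₀ x₀
  have l1 : Tendsto (fun j => (φ (t j, y j) - φ (s j, y j)) / τ j) atTop (𝓝 (dt φ t₀ x₀)) := by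
    rw [dt_eq hφ ht₀]
    exact tendsto_slope_of_hasStrictFDerivAt hstrict (htl.prodMk_nhds hyl) hsy
      (fun j => (hτ0 j).ne') (fun j => by simp [hs])
  have l2 : Tendsto (fun j => (φ (s j, y j + h j) - φ (s j, y j)) / h j) atTop
      (𝓝 (dx φ t₀ x₀)) := by
    rw [dx_eq hφ ht₀]
    refine tendsto_slope_of_hasStrictFDerivAt hstrict (hsl.prodMk_nhds ?_) hsy
      (fun j => (hh0 j).ne') (fun j => by simp)
    simpa using hyl.add hhl
  have l3 : Tendsto (fun j => (φ (s j, y j - h j) - φ (s j, y j)) / h j) atTop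
      (𝓝 (-dx φ t₀ x₀)) := by
    have := tendsto_slope_of_hasStrictFDerivAt hstrict (v := (0, -1))
      (a := fun j => (s j, y j - h j)) (hsl.prodMk_nhds (by simpa using hyl.sub hhl)) hsy
      (fun j => (hh0 j).ne') (fun j => by simp)
    rw [dx_eq hφ ht₀, ← map_neg]
    simpa using this
  -- Forward and backward quotients tend to plus and minus the slope, so both upwind slopes are
  -- consistent with its modulus.
  have habs : ∀ p : ℝ, max (max p (-p)) 0 = |p| := fun p => max_eq_left (abs_nonneg p)
  have hwy : ∀ j, w j (y j) = φ (s j, y j) + c j := fun j => patch_near (by simpa using hr)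
  have hwp : ∀ᶠ j in atTop, w j (y j + h j) = φ (s j, y j + h j) + c j ∧
      w j (y j - h j) = φ (s j, y j - h j) + c j := by
    filter_upwards [ev4] with j h4
    constructor
    · exact patch_near (by simpa [abs_of_pos (hh0 j)] using h4)
    · exact patch_near (by simpa [abs_of_pos (hh0 j)] using h4)
  have l4 : Tendsto (fun j => up (h j) (w j) (y j)) atTop (𝓝 |dx φ t₀ x₀|) := by
    rw [← habs]
    refine Tendsto.congr' ?_ ((l2.max l3).max tendsto_const_nhds)
    filter_upwards [hwp] with j hj
    unfold up
    rw [hwy, hj.1, hj.2, add_sub_add_right_eq_sub, add_sub_add_right_eq_sub]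
  have l5 : Tendsto (fun j => up (h j) (fun z => -w j z) (y j)) atTop (𝓝 |dx φ t₀ x₀|) := by
    rw [← abs_neg, ← habs]
    refine Tendsto.congr' ?_ ((l2.neg.max l3.neg).max tendsto_const_nhds)
    filter_upwards [hwp] with j hj
    unfold up
    simp only [hwy, hj.1, hj.2]
    congr 2 <;> ring
  have l6 := tendsto_outer_patch (K := K) (C' := 3 * B) (t := x₀) (x := y) (F := F) (G := G)
    (f₀ := fun y => φ (t₀, y)) (g₀ := fun y => W (t₀, y)) hr hhl hh0 hFm
    (Eventually.of_forall hGm) hwb (by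
      filter_upwards [ev2, ev3] with j h2 h3 z hz
      have h4 : secondDiff (F j) (y j) z = secondDiff (fun y => φ (s j, y)) (y j) z := by
        simp only [secondDiff, hF]
        ring
      rw [h4]
      rw [abs_le] at h2
      refine hsd _ ⟨by linarith [h2.1], by linarith [h2.2]⟩ _ _ ?_ ?_
      · have := abs_sub_abs_le_abs_sub (y j) x₀
        linarith
      · linarith [abs_nonneg x₀])
    ((hW.continuous hB hC hf).comp (by fun_prop)).measurable
    (fun x => (hW.bound hB hC hf _).trans (by linarith))
    (by
      intro z hz
      have hcz : ContinuousAt φ (t₀, x₀ + z) :=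
        hcont.continuousAt (isOpen_Q.mem_nhds (mem_Q.2 ht₀))
      have := (hcz.tendsto.comp (hsl.prodMk_nhds (hyl.add_const z))).sub (hcat.tendsto.comp hsy)
      refine this.congr fun j => ?_
      simp [hF])
    (by
      have := (hcat.tendsto.comp hsy).add hcl
      simpa using this)
    (by
      intro z
      have h1 : Tendsto (fun j => (s j, y j + z)) atTop (𝓝 (t₀, x₀ + z)) :=
        hsl.prodMk_nhds (hyl.add_const z)
      refine Tendsto.congr' ?_ (hW.tendsto_comp hB hC hf hi h1)
      filter_upwards [hsk] with j hj
      unfold scheme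
      simp only [hG, hj]
      rw [mul_div_cancel_right₀ _ (hτ0 j).ne', Nat.floor_natCast])
    (integrableOn_inner hφ ht₀ r x₀)
  set I := inner r (fun y => φ (t₀, y)) x₀ + outer r (fun y => W (t₀, y)) x₀ with hI
  have l7 : Tendsto (fun j => h j + rate (h j) (w j) (y j)) atTop
      (𝓝 (0 + (max I 0 * |dx φ t₀ x₀| - max (-I) 0 * |dx φ t₀ x₀|))) := by
    unfold rate
    exact hhl.add (((l6.max tendsto_const_nhds).mul l4).sub
      ((l6.neg.max tendsto_const_nhds).mul l5))
  have hfin := le_of_tendsto_of_tendsto l1 l7 hstep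
  have hI' : max I 0 - max (-I) 0 = I := by
    rcases le_total 0 I with h | h
    · rw [max_eq_left h, max_eq_right (by linarith), sub_zero]
    · rw [max_eq_right h, max_eq_left (by linarith)]; ring
  calc _ ≤ _ := hfin
    _ = (max I 0 - max (-I) 0) * |dx φ t₀ x₀| := by ring
    _ = _ := by rw [hI']

/-- Adding (s - t)² + (y - x)⁴ to φ makes the maximum strict and leaves the first derivatives at the
contact point unchanged; the inner integral over radius r grows by at most 2r³. The radius is
enlarged to ρ by `inner_add_outer_mono`, and then r tends to 0. -/
theorem IsSchemeLimit.isSubsolution (hB : 0 < B) (hC : C = 24 * B) (hf : IsBUC B f)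
    (hW : IsSchemeLimit B C f ν W) {ρ : ℝ} (hρ : 0 < ρ) : IsSubsolution ρ W := by
  have hWc := hW.continuous hB hC hf
  have hWb := hW.bound hB hC hf
  refine ⟨hWc.continuousOn.upperSemicontinuousOn, ⟨B, fun p _ => hWb p⟩, ?_⟩
  intro φ hφ t x htx hmax
  have ht : 0 < t := mem_Q.1 htx
  have key : dt φ t x ≤ hamiltonian ρ φ W t x := by
    rw [hamiltonian_eq hφ hρ ht]
    set q : ℝ × ℝ → ℝ := fun p => (p.1 - t) ^ 2 + (p.2 - x) ^ 4 with hq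
    have hq2 : ContDiffOn ℝ 2 (fun p => φ p + q p) Q := hφ.add (by fun_prop)
    obtain ⟨r₁, hr₁, h⟩ := hW.viscosity_strict hB hC hf hq2 ht (x₀ := x) (by
      intro t' ht' x'
      have := hmax (show (t', x') ∈ Q from mem_Q.2 ht')
      simp only [mem_ofPred_eq] at this
      simp only [hq]
      have e1 : (t - t) ^ 2 + (x - x) ^ 4 = 0 := by ring
      linarith)
    have hdt : dt (fun p => φ p + q p) t x = dt φ t x := by
      have h1 := (hasDerivAt_dt hφ ht x).add
        ((((hasDerivAt_id t).sub_const t).pow 2).add_const ((x - x) ^ 4))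
      rw [dt_eq hφ ht]
      refine (h1.congr_deriv ?_).deriv
      simp
    have hdx : dx (fun p => φ p + q p) t x = dx φ t x := by
      have h1 := (hasDerivAt_dx hφ ht x).add
        ((((hasDerivAt_id x).sub_const x).pow 4).const_add ((t - t) ^ 2))
      rw [dx_eq hφ ht]
      refine (h1.congr_deriv ?_).deriv
      simp
    rw [hdt, hdx] at h
    have hin : ∀ r > 0, inner r (fun y => φ (t, y) + q (t, y)) x
        ≤ inner r (fun y => φ (t, y)) x + 2 * r ^ 3 := by
      intro r hr
      have e1 : ∀ z, z ∈ Ioc 0 r → secondDiff (fun y => φ (t, y) + q (t, y)) x z / z ^ 2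
          ≤ secondDiff (fun y => φ (t, y)) x z / z ^ 2 + 2 * r ^ 2 := by
        intro z hz
        have hz0 : 0 < z := hz.1
        have e2 : secondDiff (fun y => φ (t, y) + q (t, y)) x z
            = secondDiff (fun y => φ (t, y)) x z + 2 * z ^ 2 * z ^ 2 := by
          simp only [secondDiff, hq]
          ring
        rw [e2, add_div, mul_div_cancel_right₀ _ (by positivity)]
        have : z ^ 2 ≤ r ^ 2 := by gcongr; exact hz.2
        linarith
      have e3 : IntegrableOn (fun _ : ℝ => 2 * r ^ 2) (Ioc 0 r) := integrableOn_const (by simp)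
      have e4 := integrableOn_inner hφ ht r x
      have e5 := setIntegral_mono_on (integrableOn_inner hq2 ht r x) (e4.add e3)
        measurableSet_Ioc e1
      simp only [Pi.add_apply] at e5
      rw [integral_add e4 e3, setIntegral_const] at e5
      unfold inner
      refine e5.trans (le_of_eq ?_)
      simp [hr.le]
      ring
    have hmono : ∀ r, 0 < r → r ≤ ρ → inner r (fun y => φ (t, y)) x + outer r (fun y => W (t, y)) x
        ≤ inner ρ (fun y => φ (t, y)) x + outer ρ (fun y => W (t, y)) x := fun r hr hrρ =>
      inner_add_outer_mono hφ hr hrρ ht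
        (hWc.comp (by fun_prop : Continuous fun y : ℝ => (t, y))).measurable (fun y => hWb _)
        fun z => by
          have := hmax (show (t, x + z) ∈ Q from htx)
          simp only [mem_ofPred_eq] at this
          linarith
    set A := inner ρ (fun y => φ (t, y)) x + outer ρ (fun y => W (t, y)) x with hA
    have hlim : Tendsto (fun r : ℝ => (A + 2 * r ^ 3) * |dx φ t x|) (𝓝[>] 0)
        (𝓝 (A * |dx φ t x|)) := by
      have : Continuous fun r : ℝ => (A + 2 * r ^ 3) * |dx φ t x| := by fun_prop
      have h2 := this.tendsto 0
      simp only [ne_eq, OfNat.ofNat_ne_zero, not_false_eq_true, zero_pow, mul_zero, add_zero] at h2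
      exact h2.mono_left nhdsWithin_le_nhds
    refine ge_of_tendsto hlim ?_
    filter_upwards [Ioo_mem_nhdsGT (show (0 : ℝ) < min r₁ ρ by positivity)] with r hr
    refine (h r hr.1 (hr.2.trans_le (min_le_left _ _))).trans ?_
    refine mul_le_mul_of_nonneg_right ?_ (abs_nonneg _)
    have h3 := hin r hr.1
    have h4 := hmono r hr.1 (hr.2.le.trans (min_le_right _ _))
    linarith
  -- The limit satisfies `key` for every slope, so the quartic case only needs that the factor |φ_x|
  -- is zero there.
  refine ⟨fun _ => key, fun hqu => key.trans (le_of_eq ?_)⟩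
  obtain ⟨c, g, hcg⟩ := hqu
  have hd : dx φ t x = 0 := by
    have h1 : (fun y => φ (t, y)) = fun y => c * (y - x) ^ 4 + g t := by
      ext y
      rw [hcg t ht, (show Even 4 by decide).pow_abs]
    unfold dx
    rw [h1]
    have := ((((hasDerivAt_id x).sub_const x).pow 4).const_mul c).add_const (g t)
    refine (this.congr_deriv ?_).deriv
    simp
  unfold hamiltonian
  rw [hd, abs_zero, mul_zero]

lemma IsSchemeLimit.neg (hW : IsSchemeLimit B C f ν W) :
    IsSchemeLimit B C (fun y => -f y) ν (fun p => -W p) where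
  mono := hW.mono
  tendsto p := by
    have := (hW.tendsto p).neg
    refine this.congr fun j => ?_
    unfold scheme
    rw [iter_neg]

end Limit

/-! ### Reflection -/

lemma dt_neg (φ : ℝ × ℝ → ℝ) (t x : ℝ) : dt (fun p => -φ p) t x = -dt φ t x := by
  unfold dt
  exact deriv.fun_neg

lemma dx_neg (φ : ℝ × ℝ → ℝ) (t x : ℝ) : dx (fun p => -φ p) t x = -dx φ t x := by
  unfold dx
  exact deriv.fun_neg

lemma hamiltonian_neg (ρ : ℝ) (φ u : ℝ × ℝ → ℝ) (t x : ℝ) :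
    hamiltonian ρ (fun p => -φ p) (fun p => -u p) t x = -hamiltonian ρ φ u t x := by
  unfold hamiltonian
  rw [dx_neg, abs_neg, ← neg_mul, neg_add, ← integral_neg, ← integral_neg]
  congr 3
  · ext z; ring
  · ext z; ring

lemma isQuarticAt_neg {φ : ℝ × ℝ → ℝ} {x : ℝ} (h : IsQuarticAt φ x) :
    IsQuarticAt (fun p => -φ p) x := by
  obtain ⟨c, g, h⟩ := h
  refine ⟨-c, fun s => -g s, fun s hs y => ?_⟩
  simp only [h s hs y]
  ring

lemma boundedOnQ_neg {u : ℝ × ℝ → ℝ} (h : BoundedOnQ u) : BoundedOnQ fun p => -u p := by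
  obtain ⟨C, h⟩ := h
  exact ⟨C, fun p hp => by simpa using h p hp⟩

lemma isSubsolution_neg {ρ : ℝ} {v : ℝ × ℝ → ℝ} (h : IsSupersolution ρ v) :
    IsSubsolution ρ fun p => -v p := by
  obtain ⟨h1, h2, h3⟩ := h
  refine ⟨fun p hp a ha => ?_, boundedOnQ_neg h2, fun φ hφ t x htx hmax => ?_⟩
  · filter_upwards [h1 p hp (-a) (by simpa using neg_lt_neg ha)] with q hq
    linarith
  · obtain ⟨h4, h5⟩ := h3 (fun p => -φ p) hφ.neg t x htx (fun q hq => by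
      have := hmax hq
      simp only [mem_ofPred_eq] at this ⊢
      linarith)
    refine ⟨fun hd => ?_, fun hq => ?_⟩
    · have := h4 (by rw [dx_neg]; exact neg_ne_zero.2 hd)
      have h6 := hamiltonian_neg ρ φ (fun p => -v p) t x
      simp only [neg_neg] at h6
      rw [h6, dt_neg] at this
      linarith
    · have := h5 (isQuarticAt_neg hq)
      rw [dt_neg] at this
      linarith

lemma isSupersolution_neg {ρ : ℝ} {v : ℝ × ℝ → ℝ} (h : IsSubsolution ρ v) :
    IsSupersolution ρ fun p => -v p := by
  obtain ⟨h1, h2, h3⟩ := h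
  refine ⟨fun p hp a ha => ?_, boundedOnQ_neg h2, fun φ hφ t x htx hmax => ?_⟩
  · filter_upwards [h1 p hp (-a) (by simpa using neg_lt_neg ha)] with q hq
    linarith
  · obtain ⟨h4, h5⟩ := h3 (fun p => -φ p) hφ.neg t x htx (fun q hq => by
      have := hmax hq
      simp only [mem_ofPred_eq] at this ⊢
      linarith)
    refine ⟨fun hd => ?_, fun hq => ?_⟩
    · have := h4 (by rw [dx_neg]; exact neg_ne_zero.2 hd)
      have h6 := hamiltonian_neg ρ φ (fun p => -v p) t x
      simp only [neg_neg] at h6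
      rw [h6, dt_neg] at this
      linarith
    · have := h5 (isQuarticAt_neg hq)
      rw [dt_neg] at this
      linarith

/-! ### Changing the radius in the definition of subsolutions -/

open scoped Manifold ContDiff in
/-- An upper semicontinuous function is approximated from above by smooth functions. -/
lemma exists_smooth_above {U : ℝ × ℝ → ℝ} {C t ε : ℝ} (hU : UpperSemicontinuousOn U Q)
    (hC : ∀ p ∈ Q, |U p| ≤ C) (ht : 0 < t) (hε : 0 < ε) (hε1 : ε ≤ 1) :
    ∃ w : ℝ × ℝ → ℝ, ContDiff ℝ 2 w ∧ (∀ p ∈ Q, U p ≤ w p ∧ w p ≤ C + 1) ∧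
      ∀ x, ∃ q ∈ Q, dist q (t, x) < ε ∧ w (t, x) ≤ U q + ε := by
  -- The admissible values at each point form an interval and are locally met by a constant, so a
  -- partition of unity glues them. Closeness to U is required only for times at least t / 2: near
  -- the boundary of `Q` the constant C does.
  set A : ℝ × ℝ → Set ℝ := fun p => {y | y ≤ C + 1 ∧ (p ∈ Q → U p ≤ y) ∧
    (t / 2 ≤ p.1 → ∃ q ∈ Q, dist q p < ε ∧ y ≤ U q + ε)} with hA
  have hconv : ∀ p, Convex ℝ (A p) := by
    intro p
    apply Set.OrdConnected.convex
    refine ⟨fun y hy y' hy' z hz => ⟨hz.2.trans hy'.1, fun h => (hy.2.1 h).trans hz.1, fun h => ?_⟩⟩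
    obtain ⟨q, h1, h2, h3⟩ := hy'.2.2 h
    exact ⟨q, h1, h2, hz.2.trans h3⟩
  have hloc : ∀ p, ∃ y, ∀ᶠ p' in 𝓝 p, y ∈ A p' := by
    intro p
    by_cases hp : t / 2 ≤ p.1
    · have hpQ : p ∈ Q := ⟨by simp only [mem_Ioi]; linarith, mem_univ _⟩
      refine ⟨U p + ε, ?_⟩
      have h1 := hU p hpQ (U p + ε) (by linarith)
      rw [isOpen_Q.nhdsWithin_eq hpQ] at h1
      filter_upwards [h1, Metric.ball_mem_nhds p hε] with p' h2 h3
      refine ⟨by linarith [(abs_le.1 (hC p hpQ)).2], fun _ => h2.le, fun _ => ⟨p, hpQ, ?_, le_rfl⟩⟩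
      rw [dist_comm]
      exact h3
    · have : Iio (t / 2) ×ˢ univ ∈ 𝓝 p :=
        (isOpen_Iio.prod isOpen_univ).mem_nhds ⟨not_le.1 hp, mem_univ _⟩
      refine ⟨C, ?_⟩
      filter_upwards [this] with p' hp'
      exact ⟨by linarith, fun h => (abs_le.1 (hC _ h)).2, fun h => absurd hp'.1 (not_lt.2 h)⟩
  obtain ⟨w, hw⟩ := exists_contMDiffMap_forall_mem_convex_of_local_const (n := (2 : ℕ∞))
    𝓘(ℝ, ℝ × ℝ) hconv hloc
  refine ⟨w, by simpa using w.contMDiff.contDiff, fun p hp => ⟨(hw p).2.1 hp, (hw p).1⟩,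
    fun x => (hw (t, x)).2.2 ?_⟩
  simp only
  linarith

/-- Subsolutions may be tested with a smaller radius. -/
lemma IsSubsolution.le_hamiltonian {ρ ρ' t x : ℝ} {U φ : ℝ × ℝ → ℝ} (hU : IsSubsolution ρ U)
    (hρ' : 0 < ρ') (hρρ : ρ' < ρ) (hφ : ContDiffOn ℝ 2 φ Q) (htx : (t, x) ∈ Q)
    (hmax : IsMaxOn (fun p => U p - φ p) Q (t, x)) (hd : dx φ t x ≠ 0) :
    dt φ t x ≤ hamiltonian ρ' φ U t x := by
  obtain ⟨husc, ⟨C, hC⟩, hsub⟩ := hU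
  have ht : 0 < t := mem_Q.1 htx
  have hρ : 0 < ρ := hρ'.trans hρρ
  set e := U (t, x) - φ (t, x) with he
  have hle : ∀ p ∈ Q, U p ≤ φ p + e := fun p hp => by
    have := hmax hp
    simp only [mem_ofPred_eq] at this
    linarith
  have hε : ∀ k : ℕ, 0 < 1 / ((k : ℝ) + 1) := fun k => by positivity
  have hε1 : ∀ k : ℕ, 1 / ((k : ℝ) + 1) ≤ 1 := fun k => by
    rw [div_le_one (by positivity)]
    linarith [(Nat.cast_nonneg k : (0 : ℝ) ≤ k)]
  choose w hw2 hwU hwq using fun k : ℕ => exists_smooth_above husc hC ht (hε k) (hε1 k)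
  -- The cutoff is 1 near x, so the derivatives at the contact point are those of φ, and 0 beyond
  -- ρ', where the test function becomes the smooth majorant of U.
  set χ : ContDiffBump x := ⟨ρ' / 2, ρ', by linarith, by linarith⟩ with hχ
  have hχ1 : ∀ y, |y - x| ≤ ρ' / 2 → χ y = 1 := fun y hy =>
    χ.one_of_mem_closedBall (by rwa [Metric.mem_closedBall, Real.dist_eq])
  have hχ0 : ∀ y, ρ' ≤ |y - x| → χ y = 0 := fun y hy =>
    χ.zero_of_le_dist (by rwa [Real.dist_eq])
  have hχc : ContDiff ℝ 2 χ := χ.contDiff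
  set Φ : ℕ → ℝ × ℝ → ℝ := fun k p => χ p.2 * (φ p + e) + (1 - χ p.2) * w k p with hΦ
  have hΦ2 : ∀ k, ContDiffOn ℝ 2 (Φ k) Q := fun k => by
    have h1 : ContDiffOn ℝ 2 (fun p : ℝ × ℝ => χ p.2) Q :=
      (hχc.comp contDiff_snd).contDiffOn
    exact (h1.mul (hφ.add contDiffOn_const)).add ((contDiffOn_const.sub h1).mul
      (hw2 k).contDiffOn)
  have hΦU : ∀ k, ∀ p ∈ Q, U p ≤ Φ k p := fun k p hp => by
    have h1 := hle p hp
    have h2 := (hwU k p hp).1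
    have h3 := χ.nonneg (x := p.2)
    have h4 := χ.le_one (x := p.2)
    simp only [hΦ]
    nlinarith
  have hΦx : ∀ k s, Φ k (s, x) = φ (s, x) + e := fun k s => by
    simp only [hΦ]
    rw [hχ1 x (by simp; linarith)]
    ring
  have hΦnear : ∀ k y, |y - x| ≤ ρ' / 2 → Φ k (t, y) = φ (t, y) + e := fun k y hy => by
    simp only [hΦ]
    rw [hχ1 y hy]
    ring
  have hdt : ∀ k, dt (Φ k) t x = dt φ t x := fun k => by
    unfold dt
    simp only [hΦx]
    exact deriv_add_const e
  have hdx : ∀ k, dx (Φ k) t x = dx φ t x := fun k => by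
    unfold dx
    have h1 : (fun y => Φ k (t, y)) =ᶠ[𝓝 x] fun y => φ (t, y) + e := by
      filter_upwards [Metric.ball_mem_nhds x (show 0 < ρ' / 2 by linarith)] with y hy
      rw [Metric.mem_ball, Real.dist_eq] at hy
      exact hΦnear k y hy.le
    rw [h1.deriv_eq]
    exact deriv_add_const e
  have hineq : ∀ k, dt φ t x ≤
      (inner ρ (fun y => Φ k (t, y)) x + outer ρ (fun y => U (t, y)) x) * |dx φ t x| := by
    intro k
    have h1 := (hsub (Φ k) (hΦ2 k) t x htx (fun p hp => by
      have := hΦU k p hp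
      simp only [mem_ofPred_eq, hΦx]
      linarith)).1 (by rwa [hdx])
    rwa [hamiltonian_eq (hΦ2 k) hρ ht, hdt, hdx] at h1
  -- the limit of the test functions
  set L : ℝ → ℝ := fun y => χ y * (φ (t, y) + e) + (1 - χ y) * U (t, y) with hL
  have hUm : Measurable fun y => U (t, y) :=
    (upperSemicontinuous_slice husc (mem_Ioi.2 ht)).measurable
  have hUb : ∀ y, |U (t, y)| ≤ C := fun y => hC _ (mem_Q.2 ht)
  have hwlim : ∀ y, Tendsto (fun k => w k (t, y)) atTop (𝓝 (U (t, y))) := by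
    intro y
    rw [tendsto_order]
    refine ⟨fun a ha => Eventually.of_forall fun k => ha.trans_le (hwU k _ (mem_Q.2 ht)).1,
      fun a ha => ?_⟩
    choose q hqQ hqd hqw using fun k => hwq k y
    have hεl : Tendsto (fun k : ℕ => 1 / ((k : ℝ) + 1)) atTop (𝓝 0) :=
      tendsto_one_div_add_atTop_nhds_zero_nat
    have hq : Tendsto q atTop (𝓝[Q] (t, y)) := by
      refine tendsto_nhdsWithin_iff.2 ⟨?_, Eventually.of_forall hqQ⟩
      rw [tendsto_iff_dist_tendsto_zero]
      exact squeeze_zero (fun _ => dist_nonneg) (fun k => (hqd k).le) hεl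
    have h1 := hq.eventually (husc (t, y) (mem_Q.2 ht) ((U (t, y) + a) / 2) (by linarith))
    filter_upwards [h1, hεl.eventually_lt_const (show 0 < (a - U (t, y)) / 2 by linarith)]
      with k h2 h3
    have := hqw k
    linarith
  have hΦlim : ∀ y, Tendsto (fun k => Φ k (t, y)) atTop (𝓝 (L y)) := fun y =>
    tendsto_const_nhds.add ((hwlim y).const_mul _)
  have hc := continuous_slice_of_test hφ ht
  obtain ⟨K, hK, hsd⟩ := exists_secondDiff_le hφ (b := t) (R := max |x| ρ) ht
  obtain ⟨M₀, hM₀⟩ := (isCompact_Icc (a := x - ρ) (b := x + ρ)).exists_bound_of_continuousOn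
    (hc.add continuous_const).continuousOn (f := fun y => φ (t, y) + e)
  set M := max M₀ (C + 1) with hM
  have hΦb : ∀ k y, |y - x| ≤ ρ → |Φ k (t, y)| ≤ M := by
    intro k y hy
    rw [abs_le] at hy
    have h1 := abs_le.1 (hM₀ y ⟨by linarith, by linarith⟩)
    have h2 := hwU k (t, y) (mem_Q.2 ht)
    have h3 := χ.nonneg (x := y)
    have h4 := χ.le_one (x := y)
    have h5 := abs_le.1 (hUb y)
    have h6 : M₀ ≤ M := le_max_left _ _
    have h7 : C + 1 ≤ M := le_max_right _ _
    simp only [hΦ]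
    rw [abs_le]
    constructor <;> nlinarith
  have hsdnear : ∀ k z, |z| ≤ ρ' / 2 → secondDiff (fun y => Φ k (t, y)) x z
      = secondDiff (fun y => φ (t, y)) x z := by
    intro k z hz
    simp only [secondDiff]
    rw [hΦx, hΦnear k _ (by simpa using hz), hΦnear k _ (by simpa using hz)]
    ring
  have hΦm : ∀ k, Measurable fun y => Φ k (t, y) := fun k =>
    (continuous_slice_of_test (hΦ2 k) ht).measurable
  -- Dominated convergence: up to ρ' / 2 the test functions coincide with φ up to a constant, beyond
  -- it z² is bounded below.
  have hlim : Tendsto (fun k => inner ρ (fun y => Φ k (t, y)) x) atTop (𝓝 (inner ρ L x)) := by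
    unfold inner
    refine tendsto_integral_of_dominated_convergence
      (fun _ => max K (4 * M / (ρ' / 2) ^ 2)) (fun k => ?_) ?_ (fun k => ?_) ?_
    · refine Measurable.aestronglyMeasurable ?_
      have := hΦm k
      unfold secondDiff
      exact (((this.comp (measurable_const.add measurable_id)).add
        (this.comp (measurable_const.sub measurable_id))).sub_const _).div (by fun_prop)
    · exact integrableOn_const (by simp)
    · refine (ae_restrict_iff' measurableSet_Ioc).2 (Eventually.of_forall fun z hz => ?_)
      have hz0 : 0 < z := hz.1
      rw [Real.norm_eq_abs, abs_div, abs_of_nonneg (sq_nonneg z)]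
      by_cases hzr : z ≤ ρ' / 2
      · refine le_max_of_le_left (div_le_of_le_mul₀ (sq_nonneg z) hK ?_)
        rw [hsdnear k z (by rwa [abs_of_pos hz0])]
        refine hsd t ⟨le_rfl, le_rfl⟩ x z (le_max_left _ _) ?_
        rw [abs_of_pos hz0]
        exact hz.2.trans (le_max_right _ _)
      · refine le_max_of_le_right ?_
        have h1 : |secondDiff (fun y => Φ k (t, y)) x z| ≤ 4 * M := by
          have a1 := abs_le.1 (hΦb k (x + z) (by simpa [abs_of_pos hz0] using hz.2))
          have a2 := abs_le.1 (hΦb k (x - z) (by simpa [abs_of_pos hz0] using hz.2))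
          have a3 := abs_le.1 (hΦb k x (by simpa using hρ.le))
          unfold secondDiff
          rw [abs_le]
          constructor <;> linarith
        have hM0 : 0 ≤ 4 * M := (abs_nonneg _).trans h1
        have h2 : (ρ' / 2) ^ 2 ≤ z ^ 2 := by
          have := not_le.1 hzr
          gcongr
        exact div_le_div₀ hM0 h1 (by positivity) h2
    · refine Eventually.of_forall fun z => Tendsto.div_const ?_ _
      unfold secondDiff
      exact ((hΦlim _).add (hΦlim _)).sub ((hΦlim _).const_mul 2)
  have hfin := ge_of_tendsto' ((hlim.add_const (outer ρ (fun y => U (t, y)) x)).mul_const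
    |dx φ t x|) hineq
  refine hfin.trans ?_
  rw [hamiltonian_eq hφ hρ' ht]
  refine mul_le_mul_of_nonneg_right ?_ (abs_nonneg _)
  have hLx : L x = φ (t, x) + e := by
    simp only [hL]
    rw [hχ1 x (by simp; linarith)]
    ring
  have hLle : ∀ y, L y ≤ φ (t, y) + e := fun y => by
    have h1 := hle (t, y) (mem_Q.2 ht)
    have h3 := χ.nonneg (x := y)
    have h4 := χ.le_one (x := y)
    simp only [hL]
    nlinarith
  have hLfar : ∀ y, ρ' ≤ |y - x| → L y = U (t, y) := fun y hy => by
    simp only [hL]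
    rw [hχ0 y hy]
    ring
  have hLm : Measurable L := by
    have h1 : Measurable χ := hχc.continuous.measurable
    exact (h1.mul (hc.measurable.add_const _)).add ((measurable_const.sub h1).mul hUm)
  -- Inside ρ' the limit lies below the shifted φ with equality at x; between ρ' and ρ it is U. This
  -- moves the shell from the test function to U.
  have hLsd1 : ∀ z ∈ Ioc 0 ρ', secondDiff L x z / z ^ 2 ≤
      secondDiff (fun y => φ (t, y)) x z / z ^ 2 := by
    intro z hz
    refine div_le_div_of_nonneg_right ?_ (sq_nonneg z)
    unfold secondDiff
    rw [hLx]
    linarith [hLle (x + z), hLle (x - z)]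
  have hLsd2 : EqOn (fun z => secondDiff (fun y => U (t, y)) x z / z ^ 2)
      (fun z => secondDiff L x z / z ^ 2) (Ioc ρ' ρ) := by
    intro z hz
    have hz0 : 0 < z := hρ'.trans hz.1
    simp only [secondDiff]
    rw [hLfar (x + z) (by simpa [abs_of_pos hz0] using hz.1.le),
      hLfar (x - z) (by simpa [abs_of_pos hz0] using hz.1.le), hLx, he]
    ring
  have hLb : ∀ y, |y - x| ≤ ρ → |L y| ≤ M := fun y hy =>
    le_of_tendsto (hΦlim y).abs (Eventually.of_forall fun k => hΦb k y hy)
  have hUi := integrableOn_secondDiff hρ' hUm hUb x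
  have hLi1 : IntegrableOn (fun z => secondDiff L x z / z ^ 2) (Ioc 0 ρ') := by
    have hm : Measurable fun z => secondDiff L x z / z ^ 2 := by
      unfold secondDiff
      fun_prop
    refine Measure.integrableOn_of_bounded (M := max K (4 * M / (ρ' / 2) ^ 2)) (by simp)
      hm.aestronglyMeasurable ((ae_restrict_iff' measurableSet_Ioc).2
        (Eventually.of_forall fun z hz => ?_))
    have hz0 : 0 < z := hz.1
    have hzρ : z ≤ ρ := hz.2.trans hρρ.le
    rw [Real.norm_eq_abs, abs_div, abs_of_nonneg (sq_nonneg z)]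
    by_cases hzr : z ≤ ρ' / 2
    · refine le_max_of_le_left (div_le_of_le_mul₀ (sq_nonneg z) hK ?_)
      have : secondDiff L x z = secondDiff (fun y => φ (t, y)) x z := by
        simp only [secondDiff, hL]
        rw [hχ1 x (by simp; linarith), hχ1 (x + z) (by simpa [abs_of_pos hz0] using hzr),
          hχ1 (x - z) (by simpa [abs_of_pos hz0] using hzr)]
        ring
      rw [this]
      refine hsd t ⟨le_rfl, le_rfl⟩ x z (le_max_left _ _) ?_
      rw [abs_of_pos hz0]
      exact hzρ.trans (le_max_right _ _)
    · refine le_max_of_le_right ?_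
      have h1 : |secondDiff L x z| ≤ 4 * M := by
        have a1 := abs_le.1 (hLb (x + z) (by simpa [abs_of_pos hz0] using hzρ))
        have a2 := abs_le.1 (hLb (x - z) (by simpa [abs_of_pos hz0] using hzρ))
        have a3 := abs_le.1 (hLb x (by simpa using hρ.le))
        unfold secondDiff
        rw [abs_le]
        constructor <;> linarith
      have hM0 : 0 ≤ 4 * M := (abs_nonneg _).trans h1
      have h2 : (ρ' / 2) ^ 2 ≤ z ^ 2 := by
        have := not_le.1 hzr
        gcongr
      exact div_le_div₀ hM0 h1 (by positivity) h2
  rw [outer_eq hρ hUm hUb, outer_eq hρ' hUm hUb]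
  unfold inner
  rw [← Ioc_union_Ioc_eq_Ioc hρ'.le hρρ.le, ← Ioc_union_Ioi_eq_Ioi hρρ.le,
    setIntegral_union (Ioc_disjoint_Ioc_of_le le_rfl) measurableSet_Ioc hLi1
      ((hUi.mono_set Ioc_subset_Ioi_self).congr_fun hLsd2 measurableSet_Ioc),
    setIntegral_union (Ioc_disjoint_Ioi le_rfl) measurableSet_Ioi
      (hUi.mono_set Ioc_subset_Ioi_self) (hUi.mono_set (Ioi_subset_Ioi hρρ.le)),
    ← setIntegral_congr_fun measurableSet_Ioc hLsd2]
  have := setIntegral_mono_on hLi1 (integrableOn_inner hφ ht ρ' x) measurableSet_Ioc hLsd1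
  linarith

/-! ### Quartic test functions for subsolutions -/

lemma abs_inner_quartic_le {c b r x y₀ : ℝ} (hc : 0 ≤ c) (hr : 0 ≤ r) :
    |inner r (fun y => c * (y - y₀) ^ 4 + b) x| ≤ c * (12 * (x - y₀) ^ 2 + 2 * r ^ 2) * r := by
  unfold inner
  have h := norm_setIntegral_le_of_norm_le_const (μ := volume) (s := Ioc 0 r)
    (f := fun z => secondDiff (fun y => c * (y - y₀) ^ 4 + b) x z / z ^ 2)
    (C := c * (12 * (x - y₀) ^ 2 + 2 * r ^ 2)) (by simp) (by
      intro z hz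
      have hz0 : 0 < z := hz.1
      have e : secondDiff (fun y => c * (y - y₀) ^ 4 + b) x z / z ^ 2
          = c * (12 * (x - y₀) ^ 2 + 2 * z ^ 2) := by
        unfold secondDiff
        field_simp
        ring
      have h1 : z ^ 2 ≤ r ^ 2 := by
        have := hz.2
        gcongr
      rw [e, Real.norm_eq_abs, abs_of_nonneg (by positivity)]
      gcongr)
  simpa [Real.volume_real_Ioc_of_le hr] using h

lemma dt_quartic (c y₀ t x : ℝ) (g : ℝ → ℝ) :
    dt (fun p => c * (p.2 - y₀) ^ 4 + g p.1) t x = deriv g t := by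
  simp [dt]

lemma dx_quartic (c y₀ t x : ℝ) (g : ℝ → ℝ) :
    dx (fun p => c * (p.2 - y₀) ^ 4 + g p.1) t x = 4 * c * (x - y₀) ^ 3 := by
  unfold dx
  have := ((((hasDerivAt_id x).sub_const y₀).pow 4).const_mul c).add_const (g t)
  refine (this.congr_deriv ?_).deriv
  push_cast
  simp
  ring

lemma contDiffOn_quartic (c y₀ : ℝ) {g : ℝ → ℝ} (hg : ContDiffOn ℝ 2 g (Ioi 0)) :
    ContDiffOn ℝ 2 (fun p : ℝ × ℝ => c * (p.2 - y₀) ^ 4 + g p.1) Q := by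
  refine ContDiffOn.add (by fun_prop) (hg.comp contDiffOn_fst fun p hp => hp.1)

/-- The quartic condition at a maximum in the zero slope case. -/
lemma IsSubsolution.deriv_nonpos {ρ t x c : ℝ} {U : ℝ × ℝ → ℝ} (hU : IsSubsolution ρ U)
    {g : ℝ → ℝ} (hg : ContDiffOn ℝ 2 g (Ioi 0)) (ht : 0 < t)
    (hmax : ∀ s > 0, ∀ y, U (s, y) - c * (y - x) ^ 4 - g s ≤ U (t, x) - g t) :
    deriv g t ≤ 0 := by
  have := (hU.2.2 _ (contDiffOn_quartic c x hg) t x (mem_Q.2 ht) (fun p hp => by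
    have := hmax p.1 hp.1 p.2
    simp only [mem_ofPred_eq, sub_self]
    norm_num
    linarith)).2 ⟨c, g, fun s _ y => by rw [(show Even 4 by decide).pow_abs]⟩
  rwa [dt_quartic] at this

/-- If x ≠ y₀ the slope is nonzero and the small radius ρ' may be used: the inner term is at most
14cρ', the slope at most 4c, and their product is the error. If x = y₀ the test function has
precisely the form admitted at vanishing slope. -/
lemma IsSubsolution.quarticSub {ρ ρ' c : ℝ} {U : ℝ × ℝ → ℝ} (hU : IsSubsolution ρ U)
    (hρ' : 0 < ρ') (hρρ : ρ' < ρ) (hρ1 : ρ' ≤ 1) (hc : 0 < c) :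
    QuarticSub c (56 * c ^ 2 * ρ') ρ' (Ioi 0) U := by
  intro t ht x y₀ g hxy hg hmax
  have hκ : 0 ≤ 56 * c ^ 2 * ρ' := by positivity
  by_cases h0 : x = y₀
  · subst h0
    have := hU.deriv_nonpos hg ht (c := c) (by
      intro s hs y
      have := hmax s hs y
      simp only [sub_self] at this
      norm_num at this
      linarith)
    simp only [sub_self]
    norm_num
    linarith
  · have hx : x - y₀ ≠ 0 := sub_ne_zero.2 h0
    have h1 := hU.le_hamiltonian hρ' hρρ (contDiffOn_quartic c y₀ hg) (mem_Q.2 ht)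
      (x := x) (fun p hp => by
        have := hmax p.1 hp.1 p.2
        simp only [mem_ofPred_eq]
        linarith) (by rw [dx_quartic]; positivity)
    rw [hamiltonian_eq (contDiffOn_quartic c y₀ hg) hρ' ht, dt_quartic, dx_quartic] at h1
    refine h1.trans ?_
    have h2 := (abs_le.1 (abs_inner_quartic_le (b := g t) (x := x) (y₀ := y₀) hc.le hρ'.le)).2
    have h3 : |4 * c * (x - y₀) ^ 3| ≤ 4 * c := by
      rw [abs_mul, abs_of_pos (by positivity), abs_pow]
      exact mul_le_of_le_one_right (by positivity) (pow_le_one₀ (abs_nonneg _) hxy)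
    have h4 : (x - y₀) ^ 2 ≤ 1 := by
      rw [← sq_abs]
      exact pow_le_one₀ (abs_nonneg _) hxy
    have h5 : c * (12 * (x - y₀) ^ 2 + 2 * ρ' ^ 2) * ρ' ≤ c * 14 * ρ' := by
      have : ρ' ^ 2 ≤ 1 := pow_le_one₀ hρ'.le hρ1
      gcongr
      linarith
    have h6 := mul_le_mul (h2.trans h5) h3 (abs_nonneg _) (by positivity)
    simp only at h6 ⊢
    rw [add_mul]
    nlinarith

/-! ### Barriers -/

/-- Subsolutions propagate upper bounds of the initial datum, up to an error which is small if the
bound holds on a long interval. -/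
lemma IsSubsolution.le_barrier {ρ C : ℝ} {V : ℝ × ℝ → ℝ} (hV : IsSubsolution ρ V) (hρ : 0 < ρ)
    (hC0 : 0 < C) (husc : UpperSemicontinuousOn V (Ici 0 ×ˢ univ))
    (hC : ∀ t ≥ 0, ∀ x, |V (t, x)| ≤ C) {R A x₀ : ℝ} (hR : 1 ≤ R) (hA : -C ≤ A)
    (hinit : ∀ y, |y - x₀| ≤ R → V (0, y) ≤ A) {t : ℝ} (ht : 0 ≤ t) :
    V (t, x₀) ≤ A + ((24 * C * ρ + 4 * C * ρ ^ 3 + 4 * C / ρ) * (8 * C) + 1) / R * t := by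
  -- The first factor bounds the nonlocal operator at a contact point and 8C / R bounds the slope of
  -- the barrier; the extra 1 makes the final inequality strict.
  set D := (24 * C * ρ + 4 * C * ρ ^ 3 + 4 * C / ρ) * (8 * C) + 1 with hD
  have hD0 : 0 < D := by positivity
  have hR0 : 0 < R := by linarith
  set K := D / R with hK
  have hK0 : 0 < K := by positivity
  -- The barrier has then grown by 2C at distance R, so contact occurs only where the initial bound
  -- is known.
  set c := 2 * C / R ^ 4 with hc
  have hc0 : 0 < c := by positivity
  have hcR : c * R ^ 4 = 2 * C := by
    rw [hc]
    field_simp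
  by_contra hcon
  push Not at hcon
  set Φ : ℝ × ℝ → ℝ := fun p => V p + (-(A + c * (p.2 - x₀) ^ 4 + K * p.1)) with hΦ
  set E : Set (ℝ × ℝ) := Icc 0 (2 * C / K) ×ˢ Icc (x₀ - R) (x₀ + R) with hE
  have hloc : ∀ s y, 0 ≤ s → 0 < Φ (s, y) → (s, y) ∈ E := by
    intro s y hs h
    simp only [hΦ] at h
    have h1 := (abs_le.1 (hC s hs y)).2
    have h2 : 0 ≤ c * (y - x₀) ^ 4 := by positivity
    have h3 : 0 ≤ K * s := by positivity
    have h4 : |y - x₀| ≤ R := by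
      by_contra hy
      have : R ^ 4 ≤ (y - x₀) ^ 4 := by
        rw [← (show Even 4 by decide).pow_abs (y - x₀)]
        have := (not_le.1 hy).le
        gcongr
      nlinarith
    rw [abs_le] at h4
    refine ⟨⟨hs, ?_⟩, by simp only; linarith, by simp only; linarith⟩
    rw [le_div_iff₀ hK0]
    simp only
    linarith
  have hEc : IsCompact E := isCompact_Icc.prod isCompact_Icc
  have hES : E ⊆ Ici 0 ×ˢ univ := fun p hp => ⟨hp.1.1, mem_univ _⟩
  have hΦu : UpperSemicontinuousOn Φ E := by
    refine (husc.mono hES).add (ContinuousOn.upperSemicontinuousOn ?_)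
    fun_prop
  have hpos : 0 < Φ (t, x₀) := by
    simp only [hΦ, sub_self]
    norm_num
    linarith
  obtain ⟨⟨s, y⟩, hsE, hmax⟩ := hΦu.exists_isMaxOn ⟨_, hloc t x₀ ht hpos⟩ hEc
  have hbig : 0 < Φ (s, y) := hpos.trans_le (hmax (hloc t x₀ ht hpos))
  have hglob : ∀ s' ≥ 0, ∀ y', Φ (s', y') ≤ Φ (s, y) := by
    intro s' hs' y'
    by_cases h : 0 < Φ (s', y')
    · exact hmax (hloc s' y' hs' h)
    · exact (not_lt.1 h).trans hbig.le
  have hyR : |y - x₀| ≤ R := by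
    have := hsE.2
    rw [abs_le]
    constructor <;> linarith [this.1, this.2]
  have hs0 : 0 < s := by
    refine lt_of_le_of_ne hsE.1.1 ?_
    rintro rfl
    have h1 := hinit y hyR
    simp only [hΦ] at hbig
    have h2 : 0 ≤ c * (y - x₀) ^ 4 := by positivity
    linarith
  have hg : ContDiffOn ℝ 2 (fun s : ℝ => K * s) (Ioi 0) := by fun_prop
  have hdg : deriv (fun s : ℝ => K * s) s = K := by
    simp
  by_cases h0 : y = x₀
  · subst h0
    have := hV.deriv_nonpos (c := c) hg hs0 (fun s' hs' y' => by
      have := hglob s' (le_of_lt hs') y'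
      simp only [hΦ, sub_self] at this
      norm_num at this
      linarith)
    linarith
  · have hx : y - x₀ ≠ 0 := sub_ne_zero.2 h0
    have h1 := (hV.2.2 _ (contDiffOn_quartic c x₀ hg) s y (mem_Q.2 hs0) (fun p hp => by
      have := hglob p.1 (le_of_lt hp.1) p.2
      simp only [hΦ] at this
      simp only [mem_ofPred_eq]
      linarith)).1 (by rw [dx_quartic]; positivity)
    rw [hamiltonian_eq (contDiffOn_quartic c x₀ hg) hρ hs0, dt_quartic, dx_quartic, hdg] at h1
    have h2 := (abs_le.1 (abs_inner_quartic_le (b := K * s) (x := y) (y₀ := x₀) hc0.le hρ.le)).2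
    have h3 : |4 * c * (y - x₀) ^ 3| ≤ 8 * C / R := by
      rw [abs_mul, abs_of_pos (by positivity), abs_pow]
      have : 8 * C / R = 4 * c * R ^ 3 := by
        rw [hc]
        field_simp
        norm_num
      rw [this]
      gcongr
    have h4 : (y - x₀) ^ 2 ≤ R ^ 2 := by
      rw [← sq_abs]
      gcongr
    have h5 := (abs_le.1 (abs_outer_le hρ (f := fun z => V (s, z)) (hC s hs0.le) y)).2
    have hc2 : c * R ^ 2 ≤ 2 * C := by
      rw [← hcR]
      have : R ^ 2 ≤ R ^ 4 := pow_le_pow_right₀ hR (by norm_num)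
      gcongr
    have hc3 : c ≤ 2 * C := by
      rw [← hcR]
      exact le_mul_of_one_le_right hc0.le (one_le_pow₀ hR)
    have h6 : c * (12 * (y - x₀) ^ 2 + 2 * ρ ^ 2) * ρ ≤ 24 * C * ρ + 4 * C * ρ ^ 3 := by
      have : c * (12 * (y - x₀) ^ 2 + 2 * ρ ^ 2) ≤ 24 * C + 4 * C * ρ ^ 2 := by
        nlinarith [sq_nonneg ρ]
      calc _ ≤ (24 * C + 4 * C * ρ ^ 2) * ρ := by gcongr
        _ = _ := by ring
    have h7 : K ≤ (24 * C * ρ + 4 * C * ρ ^ 3 + 4 * C / ρ) * (8 * C / R) := by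
      refine h1.trans ?_
      refine mul_le_mul ?_ h3 (abs_nonneg _) (by positivity)
      linarith
    have h8 : K = (24 * C * ρ + 4 * C * ρ ^ 3 + 4 * C / ρ) * (8 * C / R) + 1 / R := by
      rw [hK, hD]
      ring
    have : 0 < 1 / R := by positivity
    linarith

/-- The rate in `IsSubsolution.le_barrier` decays like 1 / R, so R proportional to T / e makes the
error at most e: a substitute for finite speed of propagation. -/
lemma IsSubsolution.exists_radius {ρ C : ℝ} {V : ℝ × ℝ → ℝ} (hV : IsSubsolution ρ V) (hρ : 0 < ρ)
    (hC0 : 0 < C) (husc : UpperSemicontinuousOn V (Ici 0 ×ˢ univ))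
    (hC : ∀ t ≥ 0, ∀ x, |V (t, x)| ≤ C) (T : ℝ) {e : ℝ} (he : 0 < e) :
    ∃ R, ∀ A x₀, -C ≤ A → (∀ y, |y - x₀| ≤ R → V (0, y) ≤ A) →
      ∀ t ∈ Icc 0 T, V (t, x₀) ≤ A + e := by
  set D := (24 * C * ρ + 4 * C * ρ ^ 3 + 4 * C / ρ) * (8 * C) + 1 with hD
  have hD0 : 0 < D := by positivity
  refine ⟨max 1 (D * T / e), fun A x₀ hA h t ht => ?_⟩
  set R := max 1 (D * T / e) with hR
  have h1 : 1 ≤ R := le_max_left _ _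
  have h2 : D * T / e ≤ R := le_max_right _ _
  refine (hV.le_barrier hρ hC0 husc hC h1 hA h ht.1).trans ?_
  rw [← hD]
  have : D / R * t ≤ e := by
    rw [div_mul_eq_mul_div, div_le_iff₀ (by linarith)]
    rw [div_le_iff₀ he] at h2
    have := ht.2
    calc D * t ≤ D * T := by gcongr
      _ ≤ _ := by linarith
  linarith

/-- Uniform control of subsolutions near infinity. -/
lemma IsSubsolution.le_at_infinity {ρ C a b : ℝ} {V : ℝ × ℝ → ℝ} {f : ℝ → ℝ}
    (hV : IsSubsolution ρ V) (hρ : 0 < ρ)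
    (hC0 : 0 < C) (husc : UpperSemicontinuousOn V (Ici 0 ×ˢ univ))
    (hC : ∀ t ≥ 0, ∀ x, |V (t, x)| ≤ C) (hf : ∀ x, V (0, x) ≤ f x) (hfC : ∀ x, |f x| ≤ C)
    (ha : Tendsto f atBot (𝓝 a)) (hb : Tendsto f atTop (𝓝 b)) (T : ℝ) {e : ℝ} (he : 0 < e) :
    ∃ R, ∀ t ∈ Icc 0 T, ∀ x, (R ≤ x → V (t, x) ≤ b + e) ∧ (x ≤ -R → V (t, x) ≤ a + e) := by
  obtain ⟨R, hR⟩ := hV.exists_radius hρ hC0 husc hC T (half_pos he)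
  have hac : -C ≤ a := ge_of_tendsto' ha fun x => (abs_le.1 (hfC x)).1
  have hbc : -C ≤ b := ge_of_tendsto' hb fun x => (abs_le.1 (hfC x)).1
  obtain ⟨N₁, hN₁⟩ := eventually_atBot.1 (ha.eventually_le_const (show a < a + e / 2 by linarith))
  obtain ⟨N₂, hN₂⟩ := eventually_atTop.1 (hb.eventually_le_const (show b < b + e / 2 by linarith))
  refine ⟨max (R + N₂) (R - N₁), fun t ht x => ⟨fun hx => ?_, fun hx => ?_⟩⟩
  · have h1 := (le_max_left _ _).trans hx
    have := hR (b + e / 2) x (by linarith) (fun y hy =>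
      (hf y).trans (hN₂ y (by linarith [(abs_le.1 hy).1]))) t ht
    linarith
  · have h1 := (le_max_right (R + N₂) (R - N₁)).trans (le_neg.1 hx)
    have := hR (a + e / 2) x (by linarith) (fun y hy =>
      (hf y).trans (hN₁ y (by linarith [(abs_le.1 hy).2]))) t ht
    linarith

/-! ### The comparison principle -/

/-- Uniform continuity in the form used below. -/
def HasModulus (W : ℝ × ℝ → ℝ) : Prop :=
  ∀ e > 0, ∃ δ > 0, ∀ p q : ℝ × ℝ, 0 ≤ p.1 → 0 ≤ q.1 → |p.1 - q.1| ≤ δ → |p.2 - q.2| ≤ δ →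
    |W p - W q| ≤ e

lemma HasModulus.continuousOn {W : ℝ × ℝ → ℝ} (hW : HasModulus W) :
    ContinuousOn W (Ici 0 ×ˢ univ) := by
  intro p hp
  rw [Metric.continuousWithinAt_iff]
  intro e he
  obtain ⟨δ, hδ, h⟩ := hW (e / 2) (half_pos he)
  refine ⟨δ, hδ, fun q hq hqp => ?_⟩
  rw [Prod.dist_eq, max_lt_iff, Real.dist_eq, Real.dist_eq] at hqp
  rw [Real.dist_eq]
  have := h q p hq.1 hp.1 hqp.1.le hqp.2.le
  linarith

lemma HasModulus.neg {W : ℝ × ℝ → ℝ} (hW : HasModulus W) : HasModulus (fun p => -W p) := by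
  intro e he
  obtain ⟨δ, hδ, h⟩ := hW e he
  refine ⟨δ, hδ, fun p q hp hq h1 h2 => ?_⟩
  have := h p q hp hq h1 h2
  rw [← abs_neg]
  convert this using 2
  ring

/-- Comparison of a semicontinuous subsolution with a uniformly continuous supersolution. -/
theorem IsSubsolution.le_of_initial {ρ C a b : ℝ} {V W : ℝ × ℝ → ℝ} {f : ℝ → ℝ}
    (hV : IsSubsolution ρ V) (hρ : 0 < ρ) (hC0 : 0 < C)
    (husc : UpperSemicontinuousOn V (Ici 0 ×ˢ univ)) (hVC : ∀ t ≥ 0, ∀ x, |V (t, x)| ≤ C)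
    (hVf : ∀ x, V (0, x) ≤ f x) (hfC : ∀ x, |f x| ≤ C)
    (ha : Tendsto f atBot (𝓝 a)) (hb : Tendsto f atTop (𝓝 b))
    (hW : HasModulus W) (hWC : ∀ t ≥ 0, ∀ x, |W (t, x)| ≤ C) (hWf : ∀ x, f x ≤ W (0, x))
    (hWs : ∀ ρ > 0, IsSubsolution ρ (fun p => -W p)) {t : ℝ} (ht : 0 ≤ t) (x : ℝ) :
    V (t, x) ≤ W (t, x) := by
  refine le_of_forall_pos_le_add fun ε hε => ?_
  set θ := ε / 4 with hθ
  have hθ0 : 0 < θ := by positivity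
  obtain ⟨δ, hδ, hmod⟩ := hW θ hθ0
  set η := ε / 4 / (t + 1) with hη
  have hη0 : 0 < η := by positivity
  have hηt : η * t ≤ ε / 4 := by
    rw [hη, div_mul_eq_mul_div, div_le_iff₀ (by linarith)]
    nlinarith
  -- Times with |r - s| ≤ r / 2 satisfy s ≤ 3r / 2 < δ, so the modulus of W applies to them.
  set r := δ / 2 with hr
  have hr0 : 0 < r := by positivity
  -- The three terms confine |x - y| to 1, the time mismatch to r / 2, and at the initial time make
  -- the penalty exceed 2C as soon as |x - y| > δ.
  set c := max (2 * C) (max (2 * C / (r / 2) ^ 2) (2 * C / δ ^ 4)) with hc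
  have hc1 : 2 * C ≤ c := le_max_left _ _
  have hc2 : 2 * C / (r / 2) ^ 2 ≤ c := (le_max_left _ _).trans (le_max_right _ _)
  have hc3 : 2 * C / δ ^ 4 ≤ c := (le_max_right _ _).trans (le_max_right _ _)
  have hc0 : 0 < c := by linarith
  -- Chosen after c and η, so that the sum 112c²ρ' of the two quartic errors is at most η / 2.
  set ρ' := min (min (ρ / 2) 1) (η / (224 * c ^ 2)) with hρ'
  have hρ0 : 0 < ρ' := by positivity
  have hρ1 : ρ' ≤ 1 := (min_le_left _ _).trans (min_le_right _ _)
  have hρρ : ρ' < ρ := ((min_le_left _ _).trans (min_le_left _ _)).trans_lt (by linarith)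
  have hρη : ρ' ≤ η / (224 * c ^ 2) := min_le_right _ _
  have hκ : 2 * (56 * c ^ 2 * ρ') < η := by
    rw [le_div_iff₀ (by positivity)] at hρη
    linarith
  -- Later than this the term ηt exceeds 2C on its own, which compactifies time.
  set T₁ := 2 * C / η with hT₁
  obtain ⟨R₁, hR₁⟩ := hV.le_at_infinity hρ hC0 husc hVC hVf hfC ha hb T₁ (half_pos hθ0)
  obtain ⟨R₂, hR₂⟩ := (hWs ρ hρ).le_at_infinity (f := fun x => -f x) hρ hC0
    hW.neg.continuousOn.upperSemicontinuousOn (fun t ht x => by simpa using hWC t ht x)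
    (fun x => neg_le_neg (hWf x)) (fun x => by simpa using hfC x) ha.neg hb.neg (T₁ + 2 * r)
    (half_pos hθ0)
  have hins : insert (0 : ℝ) (Ioi 0) = Ici 0 := Ioi_insert
  have key := doubling (U := V) (W := W) (C := C) (c := c) (η := η) (r := r) (ρ := ρ')
    (κ := 56 * c ^ 2 * ρ') (M := θ) (σ := 0) (I := Ioi 0) (K := Icc 0 T₁) (P := fun t => η * t)
    hr0 hρ0 le_rfl Subset.rfl isOpen_Ioi (by rwa [hins]) (by rwa [hins]) hW.continuousOn hWC
    (by rw [hins]; exact fun t ht => mul_nonneg hη0.le ht) (by fun_prop) (by fun_prop)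
    (fun t _ => by
      have := ((hasDerivAt_id t).const_mul η).deriv
      simp only [id_eq, mul_one] at this
      rw [this])
    isCompact_Icc (by rw [hins]; exact Icc_subset_Ici_self)
    (by
      rw [hins]
      intro t ht htK
      have : T₁ < t := by
        by_contra h
        exact htK ⟨ht, not_lt.1 h⟩
      rw [hT₁, div_lt_iff₀ hη0] at this
      linarith)
    hc0 (by rwa [div_le_iff₀ (by positivity)] at hc2) hc1
    (by
      refine ⟨max R₁ (R₂ + 1), fun t ht x s y hs hx hxy hts => ?_⟩
      have hx1 : R₁ ≤ |x| := (le_max_left _ _).trans hx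
      have hx2 : R₂ + 1 ≤ |x| := (le_max_right _ _).trans hx
      rw [abs_le] at hxy hts
      have hs' : s ∈ Icc 0 (T₁ + 2 * r) := ⟨hs, by linarith [ht.2]⟩
      rcases le_total 0 x with h | h
      · rw [abs_of_nonneg h] at hx1 hx2
        have h1 := (hR₁ t ht x).1 hx1
        have h2 := (hR₂ s hs' y).1 (by linarith)
        linarith
      · rw [abs_of_nonpos h] at hx1 hx2
        have h1 := (hR₁ t ht x).2 (by linarith)
        have h2 := (hR₂ s hs' y).2 (by linarith)
        linarith)
    (by
      intro x s y hs hxy hts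
      simp only [zero_add, mul_zero, sub_zero] at hts ⊢
      have hq2 : 0 ≤ c * (r - s) ^ 2 := by positivity
      have hW0 : |W (0, x) - W (s, y)| ≤ θ ∨ δ < |x - y| := by
        by_cases h : |x - y| ≤ δ
        · left
          refine hmod (0, x) (s, y) le_rfl hs ?_ h
          rw [abs_le] at hts
          simp only
          rw [abs_le]
          constructor <;> linarith
        · exact Or.inr (not_le.1 h)
      rcases hW0 with h | h
      · have h4 : 0 ≤ c * (x - y) ^ 4 := by positivity
        have := (abs_le.1 h).2
        linarith [hVf x, hWf x]
      · have h4 : δ ^ 4 ≤ (x - y) ^ 4 := by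
          rw [← (show Even 4 by decide).pow_abs (x - y)]
          gcongr
        rw [div_le_iff₀ (by positivity)] at hc3
        have h5 : 2 * C ≤ c * (x - y) ^ 4 := hc3.trans (by gcongr)
        have h6 := (abs_le.1 (hVC 0 le_rfl x)).2
        have h7 := (abs_le.1 (hWC s hs y)).1
        linarith)
    hθ0 (hV.quarticSub hρ0 hρρ hρ1 hc0)
    ((hWs (ρ + 1) (by linarith)).quarticSub hρ0 (by linarith) hρ1 hc0) hκ
  rw [hins] at key
  -- At y = x and s = t + r both penalties vanish; what remains is θ + ηt and the oscillation of W
  -- over the time shift r.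
  have h1 := key t ht x (t + r) x (by linarith)
  simp only [sub_self] at h1
  norm_num at h1
  have h2 := (abs_le.1 (hmod (t + r, x) (t, x) (by simp only; linarith) ht
    (by simp only; rw [abs_le]; constructor <;> linarith) (by simp [hδ.le]))).2
  linarith

/-! ### Envelopes -/

lemma nhdsWithin_Q_neBot {p : ℝ × ℝ} (hp : 0 ≤ p.1) : (𝓝[Q] p).NeBot := by
  rw [← mem_closure_iff_nhdsWithin_neBot, Q, closure_prod_eq, closure_Ioi, closure_univ]
  exact ⟨hp, mem_univ _⟩

section Envelope
variable {v : ℝ × ℝ → ℝ} {C : ℝ} (hv : ∀ p ∈ Q, |v p| ≤ C)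
include hv

lemma isBoundedUnder_le_Q (p : ℝ × ℝ) : IsBoundedUnder (· ≤ ·) (𝓝[Q] p) v :=
  isBoundedUnder_of_eventually_le (a := C)
    (eventually_nhdsWithin_of_forall fun q hq => (abs_le.1 (hv q hq)).2)

lemma isBoundedUnder_ge_Q (p : ℝ × ℝ) : IsBoundedUnder (· ≥ ·) (𝓝[Q] p) v :=
  isBoundedUnder_of_eventually_ge (a := -C)
    (eventually_nhdsWithin_of_forall fun q hq => (abs_le.1 (hv q hq)).1)

lemma lowerEnvelope_eq_neg {p : ℝ × ℝ} (hp : 0 ≤ p.1) :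
    lowerEnvelope v p = -upperEnvelope (fun q => -v q) p := by
  have := nhdsWithin_Q_neBot hp
  have hb : ∀ q ∈ Q, |-v q| ≤ C := fun q hq => by simpa using hv q hq
  have h := Antitone.map_limsup_of_continuousAt (F := 𝓝[Q] p) (f := fun y : ℝ => -y)
    (fun a b hab => neg_le_neg hab) (fun q => -v q) (by fun_prop)
    (isBoundedUnder_le_Q hb p) (isBoundedUnder_ge_Q hb p).isCoboundedUnder_le
  unfold lowerEnvelope upperEnvelope
  rw [h]
  congr 1
  ext q
  simp

lemma abs_upperEnvelope_le {p : ℝ × ℝ} (hp : 0 ≤ p.1) : |upperEnvelope v p| ≤ C := by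
  have := nhdsWithin_Q_neBot hp
  rw [abs_le]
  constructor
  · exact le_limsup_of_frequently_le (eventually_nhdsWithin_of_forall fun q hq =>
      (abs_le.1 (hv q hq)).1).frequently (isBoundedUnder_le_Q hv p)
  · exact limsup_le_of_le (isBoundedUnder_ge_Q hv p).isCoboundedUnder_le
      (eventually_nhdsWithin_of_forall fun q hq => (abs_le.1 (hv q hq)).2)

lemma upperSemicontinuousOn_upperEnvelope :
    UpperSemicontinuousOn (upperEnvelope v) (Ici 0 ×ˢ univ) := by
  intro p hp a ha
  obtain ⟨a', h1, h2⟩ := exists_between ha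
  have h3 : ∀ᶠ q in 𝓝[Q] p, v q < a' :=
    eventually_lt_of_limsup_lt h1 (isBoundedUnder_le_Q hv p)
  rw [eventually_nhdsWithin_iff, eventually_nhds_iff] at h3
  obtain ⟨O, hO, hOo, hpO⟩ := h3
  filter_upwards [mem_nhdsWithin_of_mem_nhds (hOo.mem_nhds hpO), self_mem_nhdsWithin] with q hq hq0
  have := nhdsWithin_Q_neBot (p := q) hq0.1
  refine lt_of_le_of_lt (limsup_le_of_le (isBoundedUnder_ge_Q hv q).isCoboundedUnder_le ?_) h2
  filter_upwards [mem_nhdsWithin_of_mem_nhds (hOo.mem_nhds hq), self_mem_nhdsWithin] with q' h4 h5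
  exact (hO q' h4 h5).le

lemma le_upperEnvelope {p : ℝ × ℝ} (hp : p ∈ Q) : v p ≤ upperEnvelope v p := by
  by_contra h
  exact lt_irrefl _ ((eventually_lt_of_limsup_lt (not_le.1 h)
    (isBoundedUnder_le_Q hv p)).self_of_nhdsWithin hp)

end Envelope

lemma envelope_eq_of_continuous {W : ℝ × ℝ → ℝ} (hW : Continuous W) {p : ℝ × ℝ} (hp : 0 ≤ p.1) :
    upperEnvelope W p = W p ∧ lowerEnvelope W p = W p := by
  have := nhdsWithin_Q_neBot hp
  have h : Tendsto W (𝓝[Q] p) (𝓝 (W p)) := (hW.tendsto p).mono_left nhdsWithin_le_nhds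
  exact ⟨h.limsup_eq, h.liminf_eq⟩

lemma upperSemicontinuousOn_congr {u v : ℝ × ℝ → ℝ} {s : Set (ℝ × ℝ)}
    (hu : UpperSemicontinuousOn u s) (h : EqOn u v s) : UpperSemicontinuousOn v s := by
  intro p hp a ha
  rw [← h hp] at ha
  filter_upwards [hu p hp a ha, self_mem_nhdsWithin] with q hq hqs
  rwa [← h hqs]

lemma IsSubsolution.congr {ρ : ℝ} {u v : ℝ × ℝ → ℝ} (hu : IsSubsolution ρ u) (h : EqOn u v Q) :
    IsSubsolution ρ v := by
  refine ⟨upperSemicontinuousOn_congr hu.1 h, ?_, fun φ hφ t x htx hmax => ?_⟩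
  · obtain ⟨C, hC⟩ := hu.2.1
    exact ⟨C, fun p hp => h hp ▸ hC p hp⟩
  · have h1 : hamiltonian ρ φ u t x = hamiltonian ρ φ v t x := by
      unfold hamiltonian
      have : ∀ y, u (t, y) = v (t, y) := fun y => h (mem_Q.2 (mem_Q.1 htx))
      simp only [this]
    rw [← h1]
    refine hu.2.2 φ hφ t x htx fun p hp => ?_
    have := hmax hp
    simp only [mem_ofPred_eq] at this ⊢
    rwa [h hp, h htx]

/-! ### Existence and uniqueness for the Hamilton-Jacobi equation -/

/-- For a uniformly continuous initial datum with limits at `±∞` there is exactly one viscosity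
solution, and it is uniformly continuous. -/
theorem exists_unique_solution {B a b : ℝ} (hB : 0 < B) {f : ℝ → ℝ} (hf : IsBUC B f)
    (ha : Tendsto f atBot (𝓝 a)) (hb : Tendsto f atTop (𝓝 b)) :
    ∃ W : ℝ × ℝ → ℝ, (∀ p, |W p| ≤ B) ∧ HasModulus W ∧ Continuous W ∧ (∀ x, W (0, x) = f x) ∧
      (∀ ρ > 0, IsSubsolution ρ W) ∧ (∀ ρ > 0, IsSubsolution ρ (fun p => -W p)) ∧
      (∀ ρ > 0, IsViscositySolution ρ W) ∧ HasInitialDatum W f ∧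
      ∀ ρ > 0, ∀ v, IsViscositySolution ρ v → HasInitialDatum v f → EqOn v W Q := by
  obtain ⟨ν, W, hW⟩ := exists_isSchemeLimit hB rfl hf
  have hbd := hW.bound hB rfl hf
  have hcont := hW.continuous hB rfl hf
  have hmod : HasModulus W := fun e he => by
    obtain ⟨δ, hδ, h⟩ := hW.modulus hB rfl hf he
    exact ⟨δ, hδ, fun p q _ _ => h p q⟩
  have hinit : ∀ x, W (0, x) = f x := hW.initial
  have hsub : ∀ ρ > 0, IsSubsolution ρ W := fun ρ hρ => hW.isSubsolution hB rfl hf hρ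
  have hsub' : ∀ ρ > 0, IsSubsolution ρ (fun p => -W p) := fun ρ hρ =>
    hW.neg.isSubsolution hB rfl hf.neg hρ
  have hsup : ∀ ρ > 0, IsSupersolution ρ W := fun ρ hρ => by
    simpa using isSupersolution_neg (hsub' ρ hρ)
  refine ⟨W, hbd, hmod, hcont, hinit, hsub, hsub', fun ρ hρ => ⟨⟨B, fun p _ => hbd p⟩, ?_, ?_⟩,
    fun x => ?_, ?_⟩
  · exact (hsub ρ hρ).congr fun p hp => ((envelope_eq_of_continuous hcont (le_of_lt hp.1)).1).symm
  · have h := isSupersolution_neg ((hsub' ρ hρ).congr (v := fun p => -lowerEnvelope W p)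
      fun p hp => by simp only [(envelope_eq_of_continuous hcont (le_of_lt hp.1)).2])
    simpa using h
  · rw [← hinit x]
    exact envelope_eq_of_continuous hcont (p := (0, x)) le_rfl
  · rintro ρ hρ v ⟨⟨C, hC⟩, hvs, hvS⟩ hv0
    set C' := max C B with hC'
    have hC'0 : 0 < C' := hB.trans_le (le_max_right _ _)
    have hCC : C ≤ C' := le_max_left _ _
    have hBC : B ≤ C' := le_max_right _ _
    have hC2 : ∀ p ∈ Q, |-v p| ≤ C := fun p hp => by simpa using hC p hp
    -- Both envelopes of v are compared with W and never with each other, so no comparison of two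
    -- merely semicontinuous functions is needed. Then v is squeezed between its envelopes.
    have hup : ∀ t ≥ 0, ∀ x, upperEnvelope v (t, x) ≤ W (t, x) := fun t ht x =>
      hvs.le_of_initial hρ hC'0 (upperSemicontinuousOn_upperEnvelope hC)
        (fun t ht x => (abs_upperEnvelope_le hC (p := (t, x)) ht).trans hCC)
        (fun x => (hv0 x).1.le) (fun x => (hf.bound x).trans hBC) ha hb hmod
        (fun t _ x => (hbd _).trans hBC) (fun x => (hinit x).ge) hsub' ht x
    have hlo : ∀ t ≥ 0, ∀ x, -lowerEnvelope v (t, x) ≤ -W (t, x) := fun t ht x => by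
      have heq : ∀ p ∈ Ici (0 : ℝ) ×ˢ (univ : Set ℝ),
          upperEnvelope (fun q => -v q) p = -lowerEnvelope v p := fun p hp => by
        rw [lowerEnvelope_eq_neg hC hp.1, neg_neg]
      exact (isSubsolution_neg hvS).le_of_initial (f := fun x => -f x)
        (V := fun p => -lowerEnvelope v p) (W := fun p => -W p) hρ hC'0
        (upperSemicontinuousOn_congr (upperSemicontinuousOn_upperEnvelope hC2) heq)
        (fun t ht x => by
          rw [← heq (t, x) ⟨ht, mem_univ _⟩]
          exact (abs_upperEnvelope_le hC2 (p := (t, x)) ht).trans hCC)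
        (fun x => by simp only [(hv0 x).2]; exact le_rfl)
        (fun x => by simpa using (hf.bound x).trans hBC) ha.neg hb.neg hmod.neg
        (fun t _ x => by simpa using (hbd _).trans hBC) (fun x => by simp [hinit])
        (fun ρ hρ => by simpa using hsub ρ hρ) ht x
    intro p hp
    have h0 : (0 : ℝ) ≤ p.1 := le_of_lt hp.1
    refine le_antisymm ((le_upperEnvelope hC hp).trans (hup p.1 h0 p.2)) ?_
    have h1 := hlo p.1 h0 p.2
    have h2 := le_upperEnvelope hC2 hp
    have h3 := lowerEnvelope_eq_neg hC (p := p) h0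
    simp only [Prod.mk.eta] at h1
    linarith

/-! ### Lattice valued functions near the singularity of the kernel -/

/-- A function with values in `ℤ / n` which is bounded by `2 K z² + 1 / n`, in the split form that
comes from touching a step function by a smooth function with slope of modulus `q`: the excess
`1 / n` only occurs near the points `k / (n q)`. -/
lemma setIntegral_div_sq_le {n : ℕ} (hn : 0 < n) {F : ℝ → ℝ} {q K ρ : ℝ} (hq : 0 < q) (hK : 0 < K)
    (hρ : 0 < ρ) (hF : IntegrableOn (fun z => F z / z ^ 2) (Ioc 0 ρ))
    (hm : ∀ z ∈ Ioc 0 ρ, ∃ m₁ m₂ : ℤ, n * F z = m₁ + m₂ + 1 ∧ (m₁ : ℝ) ≤ n * (q * z + K * z ^ 2) ∧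
      (m₂ : ℝ) ≤ n * (K * z ^ 2 - q * z)) :
    ∫ z in Ioc 0 ρ, F z / z ^ 2 ≤ 29 * K * ρ + 2 * K / (n * q) := by
  have hn' : (0 : ℝ) < n := by exact_mod_cast hn
  set M : ℤ := ⌊3 * n * q * ρ / 2⌋ with hM
  -- These intervals contain every z ≤ q / (2K) for which the integer k lies within nKz² of nqz; on
  -- them `A k` bounds 1 / (nz²), since there nqz ≥ 2k / 3.
  set J : ℤ → Set ℝ := fun k => Icc (k / (n * q) - 4 * K * k ^ 2 / (n ^ 2 * q ^ 3))
    (k / (n * q) + 4 * K * k ^ 2 / (n ^ 2 * q ^ 3)) with hJ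
  set A : ℤ → ℝ := fun k => 9 * n * q ^ 2 / (4 * k ^ 2) with hA
  have hA0 : ∀ k, 0 ≤ A k := fun k => by positivity
  set G₁ : ℝ → ℝ := fun z => ∑ k ∈ Finset.Icc 1 M, (J k).indicator (fun _ => A k) z with hG₁
  set G₃ : ℝ → ℝ := fun z => (Ioi (q / (2 * K))).indicator (fun z => 1 / z ^ 2) z with hG₃
  have hG₁0 : ∀ z, 0 ≤ G₁ z := fun z => Finset.sum_nonneg fun k _ =>
    indicator_nonneg (fun _ _ => hA0 k) z
  have hG₃0 : ∀ z, 0 ≤ G₃ z := fun z => indicator_nonneg (fun _ _ => by positivity) z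
  have hpt : ∀ z ∈ Ioc 0 ρ, F z / z ^ 2 ≤ G₁ z + 2 * K + 1 / n * G₃ z := by
    intro z hz
    have hz0 : 0 < z := hz.1
    obtain ⟨m₁, m₂, hF1, h1, h2⟩ := hm z hz
    -- The linear part dominates the quadratic one exactly in this range. Beyond it the crude bound
    -- 2Kz² + 1 / n is affordable, because 1 / z² is integrable there.
    by_cases hzq : z ≤ q / (2 * K)
    · suffices F z / z ^ 2 ≤ G₁ z by
        have := hG₃0 z
        have : 0 ≤ 1 / n * G₃ z := by positivity
        linarith
      rw [le_div_iff₀ (by positivity)] at hzq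
      set a := n * q * z with ha
      set c := n * K * z ^ 2 with hc
      have ha0 : 0 < a := by positivity
      have hca : c ≤ a / 2 := by
        have : n * z * (z * (2 * K)) ≤ n * z * q := by gcongr
        simp only [hc, ha]
        nlinarith
      have hmem : ∀ k ∈ Finset.Icc ⌈a - c⌉ ⌊a + c⌋,
          k ∈ Finset.Icc 1 M ∧ z ∈ J k ∧ 1 / (n * z ^ 2) ≤ A k := by
        intro k hk
        rw [Finset.mem_Icc, Int.ceil_le, Int.le_floor] at hk
        rw [Finset.mem_Icc]
        have k0 : (0 : ℝ) < k := by linarith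
        have k1 : a / 2 ≤ k := by linarith
        have k2 : (k : ℝ) ≤ 3 * a / 2 := by linarith
        refine ⟨⟨?_, ?_⟩, ?_, ?_⟩
        · have : (0 : ℤ) < k := by exact_mod_cast k0
          omega
        · rw [hM, Int.le_floor]
          have : a ≤ n * q * ρ := by
            simp only [ha]
            have := hz.2
            gcongr
          linarith
        · have hz1 : z ≤ 2 * k / (n * q) := by
            rw [le_div_iff₀ (by positivity)]
            simp only [ha] at k1
            linarith
          have hz2 : K * z ^ 2 / q ≤ 4 * K * k ^ 2 / (n ^ 2 * q ^ 3) := by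
            have : K * z ^ 2 / q ≤ K * (2 * k / (n * q)) ^ 2 / q := by gcongr
            refine this.trans (le_of_eq ?_)
            field_simp
            ring
          have hz3 : z = a / (n * q) := by
            simp only [ha]
            field_simp
          have hz4 : K * z ^ 2 / q = c / (n * q) := by
            simp only [hc]
            field_simp
          rw [hz4] at hz2
          have hz5 : (a - k) / (n * q) ≤ c / (n * q) := by gcongr; linarith
          have hz6 : (k - a) / (n * q) ≤ c / (n * q) := by gcongr; linarith
          rw [sub_div] at hz5 hz6
          rw [← hz3] at hz5 hz6
          constructor <;> linarith
        · simp only [hA]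
          rw [div_le_div_iff₀ (by positivity) (by positivity)]
          have : (k : ℝ) ^ 2 ≤ (3 * a / 2) ^ 2 := by gcongr
          simp only [ha] at this
          nlinarith
      -- Rounding the two bounds down to integers separately is the decisive gain: nF is at most the
      -- number of integers in [a - c, a + c], which is zero for most small z despite the summand
      -- +1.
      have hcount : (n : ℝ) * F z ≤ (Finset.Icc ⌈a - c⌉ ⌊a + c⌋).card := by
        have e1 : m₁ ≤ ⌊a + c⌋ := Int.le_floor.2 (by simp only [ha, hc]; linarith)
        have e2 : m₂ ≤ -⌈a - c⌉ := by
          rw [← Int.floor_neg]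
          exact Int.le_floor.2 (by simp only [ha, hc]; linarith)
        have e5 : m₁ + m₂ + 1 ≤ ((Finset.Icc ⌈a - c⌉ ⌊a + c⌋).card : ℤ) := by
          rw [Int.card_Icc]
          omega
        rw [hF1]
        exact_mod_cast e5
      calc F z / z ^ 2 = n * F z * (1 / (n * z ^ 2)) := by field_simp
        _ ≤ (Finset.Icc ⌈a - c⌉ ⌊a + c⌋).card * (1 / (n * z ^ 2)) := by gcongr
        _ = ∑ k ∈ Finset.Icc ⌈a - c⌉ ⌊a + c⌋, 1 / (n * z ^ 2) := by simp
        _ ≤ ∑ k ∈ Finset.Icc ⌈a - c⌉ ⌊a + c⌋, (J k).indicator (fun _ => A k) z :=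
            Finset.sum_le_sum fun k hk => by
              rw [indicator_of_mem (hmem k hk).2.1]
              exact (hmem k hk).2.2
        _ ≤ G₁ z := Finset.sum_le_sum_of_subset_of_nonneg (fun k hk => (hmem k hk).1)
            fun k _ _ => indicator_nonneg (fun _ _ => hA0 k) z
    · have h3 : G₃ z = 1 / z ^ 2 := by
        simp only [hG₃]
        exact indicator_of_mem (s := Ioi (q / (2 * K))) (not_le.1 hzq) _
      have h4 : F z ≤ 2 * K * z ^ 2 + 1 / n := by
        have : n * F z ≤ n * (2 * K * z ^ 2 + 1 / n) := by
          rw [mul_add, mul_one_div_cancel hn'.ne']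
          linarith
        exact le_of_mul_le_mul_left this hn'
      rw [h3]
      have : F z / z ^ 2 ≤ 2 * K + 1 / n * (1 / z ^ 2) := by
        rw [div_le_iff₀ (by positivity), add_mul, mul_assoc (1 / (n : ℝ)),
          one_div_mul_cancel (by positivity)]
        linarith
      linarith [hG₁0 z]
  have hJm : ∀ k, MeasurableSet (J k) := fun k => measurableSet_Icc
  have hI₁ : ∀ k, IntegrableOn ((J k).indicator fun _ => A k) (Ioc 0 ρ) := fun k =>
    (integrableOn_const (by simp)).indicator (hJm k)
  have hI₁' : IntegrableOn G₁ (Ioc 0 ρ) := integrable_finsetSum _ fun k _ => hI₁ k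
  have hI₃ : Integrable G₃ :=
    (integrableOn_inv_sq_Ioi (by positivity)).integrable_indicator measurableSet_Ioi
  have hI₂ : IntegrableOn (fun _ : ℝ => 2 * K) (Ioc 0 ρ) := integrableOn_const (by simp)
  have hI₁₂ : IntegrableOn (fun z => G₁ z + 2 * K) (Ioc 0 ρ) := hI₁'.add hI₂
  have b₂ : ∫ _ in Ioc 0 ρ, 2 * K = 2 * K * ρ := by
    rw [setIntegral_const, Real.volume_real_Ioc_of_le hρ.le, smul_eq_mul]
    ring
  refine (setIntegral_mono_on hF (hI₁₂.add (hI₃.integrableOn.const_mul (1 / n)))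
    measurableSet_Ioc hpt).trans ?_
  simp only [Pi.add_apply]
  rw [integral_add hI₁₂ (hI₃.integrableOn.const_mul (1 / n)),
    integral_add hI₁' hI₂, b₂]
  -- The factors k² in length and height cancel, so each interval contributes 18K / (nq). There are
  -- at most 3nqρ / 2 of them, so n and q cancel as well.
  have b₁ : ∫ z in Ioc 0 ρ, G₁ z ≤ 27 * K * ρ := by
    simp only [hG₁]
    rw [integral_finsetSum _ fun k _ => hI₁ k]
    have hk : ∀ k ∈ Finset.Icc 1 M, ∫ z in Ioc 0 ρ, (J k).indicator (fun _ => A k) z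
        ≤ 18 * K / (n * q) := by
      intro k hk
      have k0 : (0 : ℝ) < k := by
        have := (Finset.mem_Icc.1 hk).1
        exact_mod_cast (by omega : (0 : ℤ) < k)
      rw [setIntegral_indicator (hJm k), setIntegral_const, smul_eq_mul]
      have h1 : volume.real (Ioc 0 ρ ∩ J k) ≤ 8 * K * k ^ 2 / (n ^ 2 * q ^ 3) := by
        refine (measureReal_mono inter_subset_right (by simp [hJ])).trans ?_
        simp only [hJ]
        rw [Real.volume_real_Icc_of_le]
        · refine le_of_eq ?_
          ring
        · have : 0 ≤ 4 * K * k ^ 2 / (n ^ 2 * q ^ 3) := by positivity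
          linarith
      refine (mul_le_mul_of_nonneg_right h1 (hA0 k)).trans (le_of_eq ?_)
      simp only [hA]
      field_simp
      ring
    refine (Finset.sum_le_card_nsmul _ _ _ hk).trans ?_
    rw [nsmul_eq_mul]
    have hcard : ((Finset.Icc 1 M).card : ℝ) ≤ 3 * n * q * ρ / 2 := by
      rw [Int.card_Icc]
      have h0 : 0 ≤ M := Int.floor_nonneg.2 (by positivity)
      have : (((M + 1 - 1).toNat : ℤ) : ℝ) = M := by
        rw [add_sub_cancel_right, Int.toNat_of_nonneg h0]
      rw [← Int.cast_natCast, this]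
      exact Int.floor_le _
    refine (mul_le_mul_of_nonneg_right hcard (by positivity)).trans (le_of_eq ?_)
    field_simp
    ring
  have b₃ : ∫ z in Ioc 0 ρ, G₃ z ≤ 2 * K / q := by
    refine (setIntegral_le_integral hI₃ (Eventually.of_forall hG₃0)).trans (le_of_eq ?_)
    simp only [hG₃]
    rw [integral_indicator measurableSet_Ioi, integral_inv_sq_Ioi (by positivity)]
    field_simp
  have b₄ : ∫ z in Ioc 0 ρ, 1 / (n : ℝ) * G₃ z ≤ 2 * K / (n * q) := by
    rw [integral_const_mul]
    refine (mul_le_mul_of_nonneg_left b₃ (by positivity)).trans (le_of_eq ?_)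
    field_simp
  linarith

/-! ### Counting functions of a charged configuration -/

section Static
variable {n : ℕ} {x : Fin n → ℝ} {b : Fin n → ℤ}

/-- The total charge on `(-∞, y]`. -/
def cnt (x : Fin n → ℝ) (b : Fin n → ℤ) (y : ℝ) : ℤ := ∑ i, if x i ≤ y then b i else 0

/-- The total charge on `(-∞, y)`. -/
def cntLeft (x : Fin n → ℝ) (b : Fin n → ℤ) (y : ℝ) : ℤ := ∑ i, if x i < y then b i else 0

/-- The upper envelope of the total charge on `(-∞, y]`. -/
def cntTop (x : Fin n → ℝ) (b : Fin n → ℤ) (y : ℝ) : ℤ := max (cnt x b y) (cntLeft x b y)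

lemma IsState.ne (h : IsState x b) {i j : Fin n} (hij : i ≠ j) (hi : b i ≠ 0) (hj : b j ≠ 0) :
    x i ≠ x j := by
  rcases lt_or_gt_of_ne hij with h1 | h1
  · exact (h.2 j i h1 (mul_ne_zero hj hi)).ne
  · exact (h.2 i j h1 (mul_ne_zero hi hj)).ne'

lemma IsState.abs_le (h : IsState x b) (i : Fin n) : |b i| ≤ 1 := by
  rcases h.1 i with h | h | h <;> simp [h]

lemma abs_cnt_le (hb : ∀ i, |b i| ≤ 1) (y : ℝ) : |cnt x b y| ≤ n := by
  refine (Finset.abs_sum_le_sum_abs _ _).trans ?_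
  refine (Finset.sum_le_card_nsmul _ _ 1 fun i _ => ?_).trans (by simp)
  split_ifs <;> simp [hb]

lemma abs_cntLeft_le (hb : ∀ i, |b i| ≤ 1) (y : ℝ) : |cntLeft x b y| ≤ n := by
  refine (Finset.abs_sum_le_sum_abs _ _).trans ?_
  refine (Finset.sum_le_card_nsmul _ _ 1 fun i _ => ?_).trans (by simp)
  split_ifs <;> simp [hb]

lemma abs_cntTop_le (hb : ∀ i, |b i| ≤ 1) (y : ℝ) : |cntTop x b y| ≤ n :=
  abs_max_le_max_abs_abs.trans (max_le (abs_cnt_le hb y) (abs_cntLeft_le hb y))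

lemma measurable_cnt : Measurable (cnt x b) := by
  unfold cnt
  exact Finset.measurable_fun_sum _ fun i _ =>
    Measurable.ite measurableSet_Ici measurable_const measurable_const

lemma measurable_cntLeft : Measurable (cntLeft x b) := by
  unfold cntLeft
  exact Finset.measurable_fun_sum _ fun i _ =>
    Measurable.ite measurableSet_Ioi measurable_const measurable_const

lemma measurable_cntTop : Measurable (cntTop x b) := measurable_cnt.max measurable_cntLeft

lemma cnt_le_cntTop (y : ℝ) : cnt x b y ≤ cntTop x b y := le_max_left _ _

lemma cntLeft_le_cntTop (y : ℝ) : cntLeft x b y ≤ cntTop x b y := le_max_right _ _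

/-- Away from charged particles the counting functions are locally constant. -/
lemma eventually_cnt_eq {y : ℝ} (h : ∀ j, b j ≠ 0 → x j ≠ y) :
    ∀ᶠ p : (Fin n → ℝ) × ℝ in 𝓝 (x, y),
      cnt p.1 b p.2 = cntLeft x b y ∧ cntLeft p.1 b p.2 = cntLeft x b y := by
  have h1 : ∀ j, ∀ᶠ p : (Fin n → ℝ) × ℝ in 𝓝 (x, y), b j ≠ 0 →
      ((p.1 j ≤ p.2 ↔ x j < y) ∧ (p.1 j < p.2 ↔ x j < y)) := by
    intro j
    have hc1 : Tendsto (fun p : (Fin n → ℝ) × ℝ => p.1 j) (𝓝 (x, y)) (𝓝 (x j)) :=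
      Continuous.tendsto' (by fun_prop) _ _ rfl
    have hc2 : Tendsto (fun p : (Fin n → ℝ) × ℝ => p.2) (𝓝 (x, y)) (𝓝 y) :=
      Continuous.tendsto' (by fun_prop) _ _ rfl
    by_cases hj : b j = 0
    · simp [hj]
    rcases lt_or_gt_of_ne (h j hj) with h2 | h2
    · filter_upwards [hc1.eventually_lt hc2 h2] with p hp _
      exact ⟨iff_of_true hp.le h2, iff_of_true hp h2⟩
    · filter_upwards [hc2.eventually_lt hc1 h2] with p hp _
      exact ⟨iff_of_false (not_le.2 hp) (not_lt.2 h2.le),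
        iff_of_false (not_lt.2 hp.le) (not_lt.2 h2.le)⟩
  filter_upwards [eventually_all.2 h1] with p hp
  unfold cnt cntLeft
  constructor <;> refine Finset.sum_congr rfl fun j _ => ?_ <;> by_cases hj : b j = 0
  · simp [hj]
  · simp only [(hp j hj).1]
  · simp [hj]
  · simp only [(hp j hj).2]

lemma cnt_eq_add (i : Fin n) (y : ℝ) : cnt x b y =
    cnt x (Function.update b i 0) y + if x i ≤ y then b i else 0 := by
  unfold cnt
  rw [← Finset.add_sum_erase _ _ (Finset.mem_univ i),
    ← Finset.add_sum_erase _ (fun j => if x j ≤ y then Function.update b i 0 j else 0)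
      (Finset.mem_univ i)]
  simp only [Function.update_self, ite_self, zero_add]
  rw [add_comm]
  congr 1
  refine Finset.sum_congr rfl fun j hj => ?_
  rw [Function.update_of_ne (Finset.ne_of_mem_erase hj)]

lemma cntLeft_eq_add (i : Fin n) (y : ℝ) : cntLeft x b y =
    cntLeft x (Function.update b i 0) y + if x i < y then b i else 0 := by
  unfold cntLeft
  rw [← Finset.add_sum_erase _ _ (Finset.mem_univ i),
    ← Finset.add_sum_erase _ (fun j => if x j < y then Function.update b i 0 j else 0)
      (Finset.mem_univ i)]
  simp only [Function.update_self, ite_self, zero_add]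
  rw [add_comm]
  congr 1
  refine Finset.sum_congr rfl fun j hj => ?_
  rw [Function.update_of_ne (Finset.ne_of_mem_erase hj)]

/-- The counting functions near a charged particle. -/
lemma eventually_cnt_eq_add {i : Fin n} (h : ∀ j, j ≠ i → b j ≠ 0 → x j ≠ x i) :
    ∀ᶠ p : (Fin n → ℝ) × ℝ in 𝓝 (x, x i),
      cnt p.1 b p.2 = cntLeft x b (x i) + (if p.1 i ≤ p.2 then b i else 0) ∧
      cntLeft p.1 b p.2 = cntLeft x b (x i) + if p.1 i < p.2 then b i else 0 := by
  have h1 := eventually_cnt_eq (x := x) (b := Function.update b i 0) (y := x i) (by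
    intro j hj
    by_cases hji : j = i
    · subst hji
      simp at hj
    · rw [Function.update_of_ne hji] at hj
      exact h j hji hj)
  filter_upwards [h1] with p hp
  rw [cnt_eq_add i, cntLeft_eq_add i p.2, cntLeft_eq_add i (x i), hp.1, hp.2]
  simp

lemma cnt_particle {i : Fin n} (h : ∀ j, j ≠ i → b j ≠ 0 → x j ≠ x i) :
    cnt x b (x i) = cntLeft x b (x i) + b i := by
  simpa using (eventually_cnt_eq_add h).self_of_nhds.1

lemma cntTop_particle {i : Fin n} (h : ∀ j, j ≠ i → b j ≠ 0 → x j ≠ x i) :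
    cntTop x b (x i) = cntLeft x b (x i) + max (b i) 0 := by
  unfold cntTop
  rw [cnt_particle h]
  omega

/-- Joint upper semicontinuity in the configuration and the point. At most one charged particle sits
at y, so nearby only the two values on its sides occur, and `cntTop` is the larger one. -/
lemma eventually_cntTop_le (hs : IsState x b) (y : ℝ) :
    ∀ᶠ p : (Fin n → ℝ) × ℝ in 𝓝 (x, y), cntTop p.1 b p.2 ≤ cntTop x b y := by
  by_cases h : ∃ i, b i ≠ 0 ∧ x i = y
  · obtain ⟨i, hi, rfl⟩ := h
    have h1 : ∀ j, j ≠ i → b j ≠ 0 → x j ≠ x i := fun j hj hb => hs.ne hj hb hi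
    filter_upwards [eventually_cnt_eq_add h1] with p hp
    rw [cntTop_particle h1, cntTop, hp.1, hp.2]
    split_ifs <;> omega
  · push Not at h
    filter_upwards [eventually_cnt_eq h] with p hp
    rw [cntTop, hp.1, hp.2, max_self]
    exact cntLeft_le_cntTop y

/-! ### The interaction force as a singular integral -/

/-- The interaction kernel as a superposition of signed step functions. For d = 0 both sides are 0,
with the convention 1 / 0 = 0. -/
lemma integral_sign_div_sq {d : ℝ} :
    IntegrableOn (fun z => (if 0 < d ∧ d ≤ z then 1 else if d < 0 ∧ -d ≤ z then -1 else 0 : ℝ)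
      / z ^ 2) (Ioi 0) ∧
    ∫ z in Ioi 0, (if 0 < d ∧ d ≤ z then 1 else if d < 0 ∧ -d ≤ z then -1 else 0 : ℝ) / z ^ 2
      = 1 / d := by
  have key : ∀ e : ℝ, 0 < e → IntegrableOn ((Ici e).indicator fun z : ℝ => 1 / z ^ 2) (Ioi 0) ∧
      ∫ z in Ioi 0, (Ici e).indicator (fun z : ℝ => 1 / z ^ 2) z = 1 / e := by
    intro e he
    have h1 : IntegrableOn (fun z : ℝ => 1 / z ^ 2) (Ici e) :=
      (integrableOn_Ici_iff_integrableOn_Ioi).2 (integrableOn_inv_sq_Ioi he)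
    refine ⟨(h1.integrable_indicator measurableSet_Ici).integrableOn, ?_⟩
    rw [setIntegral_indicator measurableSet_Ici,
      show Ioi 0 ∩ Ici e = Ici e from inter_eq_right.2 fun z hz => he.trans_le hz,
      integral_Ici_eq_integral_Ioi, integral_inv_sq_Ioi he]
  rcases lt_trichotomy d 0 with hd | rfl | hd
  · obtain ⟨h1, h2⟩ := key (-d) (by linarith)
    have e : (fun z => (if 0 < d ∧ d ≤ z then 1 else if d < 0 ∧ -d ≤ z then -1 else 0 : ℝ)
        / z ^ 2) = fun z => -(Ici (-d)).indicator (fun z : ℝ => 1 / z ^ 2) z := by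
      ext z
      by_cases hz : -d ≤ z
      · rw [indicator_of_mem (s := Ici (-d)) hz]
        simp [hd, not_lt.2 hd.le, hz, neg_div]
      · rw [indicator_of_notMem (s := Ici (-d)) hz]
        simp [hd, not_lt.2 hd.le, hz]
    rw [e]
    refine ⟨h1.neg, ?_⟩
    rw [integral_neg, h2]
    simp
  · simp
  · obtain ⟨h1, h2⟩ := key d hd
    have e : (fun z => (if 0 < d ∧ d ≤ z then 1 else if d < 0 ∧ -d ≤ z then -1 else 0 : ℝ)
        / z ^ 2) = (Ici d).indicator (fun z : ℝ => 1 / z ^ 2) := by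
      ext z
      by_cases hz : d ≤ z
      · rw [indicator_of_mem (s := Ici d) hz]
        simp [hd, hz]
      · rw [indicator_of_notMem (s := Ici d) hz]
        simp [hd, hz, not_lt.2 hd.le]
    rw [e]
    exact ⟨h1, h2⟩

/-- Summation of `integral_sign_div_sq` over the particles. Counting on the closed half line to the
right and on the open one to the left makes the contribution of particles located at x i, in
particular of i itself, vanish identically. -/
lemma integral_cnt_div_sq (i : Fin n) :
    IntegrableOn (fun z => ((cnt x b (x i + z) + cntLeft x b (x i - z) - cnt x b (x i)
      - cntLeft x b (x i) : ℤ) : ℝ) / z ^ 2) (Ioi 0) ∧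
    ∫ z in Ioi 0, ((cnt x b (x i + z) + cntLeft x b (x i - z) - cnt x b (x i)
      - cntLeft x b (x i) : ℤ) : ℝ) / z ^ 2 = ∑ j with j ≠ i, (b j : ℝ) / (x j - x i) := by
  set s : ℝ → ℝ → ℝ := fun d z =>
    (if 0 < d ∧ d ≤ z then 1 else if d < 0 ∧ -d ≤ z then -1 else 0 : ℝ) / z ^ 2 with hs
  have hsum : EqOn (fun z => ∑ j, (b j : ℝ) * s (x j - x i) z) (fun z =>
      ((cnt x b (x i + z) + cntLeft x b (x i - z) - cnt x b (x i)
      - cntLeft x b (x i) : ℤ) : ℝ) / z ^ 2) (Ioi 0) := by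
    intro z hz
    have hz0 : 0 < z := hz
    simp only [cnt, cntLeft, hs]
    rw [← Finset.sum_add_distrib, ← Finset.sum_sub_distrib, ← Finset.sum_sub_distrib]
    push_cast
    rw [Finset.sum_div]
    refine Finset.sum_congr rfl fun j _ => ?_
    rw [mul_div_assoc']
    congr 1
    by_cases hji : x j = x i
    · simp [hji, hz0.le]
    · rcases lt_or_gt_of_ne hji with h1 | h1
      · have a1 : x j ≤ x i + z := by linarith
        have a2 : ¬ 0 < x j - x i := by linarith
        have a3 : x j - x i < 0 := by linarith
        by_cases a4 : -(x j - x i) ≤ z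
        · have a5 : ¬ x j < x i - z := by linarith
          simp only [a1, a2, a3, a4, a5, h1, h1.le, if_true, if_false, false_and, and_self]
          ring
        · have a5 : x j < x i - z := by linarith
          simp only [a1, a2, a3, a4, a5, h1, h1.le, if_true, if_false, false_and, and_false]
          ring
      · have a1 : ¬ x j < x i - z := by linarith
        have a2 : 0 < x j - x i := by linarith
        have a3 : ¬ x j - x i < 0 := by linarith
        have a6 : ¬ x j ≤ x i := by linarith
        have a7 : ¬ x j < x i := by linarith
        by_cases a4 : x j - x i ≤ z
        · have a5 : x j ≤ x i + z := by linarith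
          simp [a1, a2, a4, a5, a6, a7]
        · have a5 : ¬ x j ≤ x i + z := by linarith
          simp [a1, a3, a4, a5, a6, a7]
  have hint : ∀ j, IntegrableOn (fun z => (b j : ℝ) * s (x j - x i) z) (Ioi 0) := fun j =>
    integral_sign_div_sq.1.const_mul _
  have hint' : IntegrableOn (fun z => ∑ j, (b j : ℝ) * s (x j - x i) z) (Ioi 0) :=
    integrable_finsetSum _ fun j _ => hint j
  refine ⟨hint'.congr_fun hsum measurableSet_Ioi, ?_⟩
  rw [← setIntegral_congr_fun measurableSet_Ioi hsum, integral_finsetSum _ fun j _ => hint j,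
    Finset.sum_filter]
  refine Finset.sum_congr rfl fun j _ => ?_
  rw [integral_const_mul, integral_sign_div_sq.2]
  by_cases hji : j = i
  · simp [hji]
  · simp [hji, div_eq_mul_inv]

/-- The force on a charged particle at which the upper counting function is touched from above
by a smooth function with slope `p`. -/
lemma force_le (hn : 0 < n) (hs : IsState x b) {i : Fin n} {p K ρ : ℝ}
    (hp : 0 < p ∧ b i = 1 ∨ p < 0 ∧ b i = -1) (hK : 0 < K) (hρ : 0 < ρ)
    (htouch : ∀ z, |z| ≤ ρ → (cntTop x b (x i + z) : ℝ) / n - cntTop x b (x i) / n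
      ≤ p * z + K * z ^ 2) :
    |p| * (1 / n * ∑ j with j ≠ i, (b j : ℝ) / (x j - x i)) ≤
      |p| * outer ρ (fun y => (cntTop x b y : ℝ) / n) (x i) +
        (|p| / (n * ρ) + 29 * K * ρ * |p| + 2 * K / n) := by
  have hn' : (0 : ℝ) < n := by exact_mod_cast hn
  have hbi : b i ≠ 0 := by rcases hp with h | h <;> simp [h.2]
  have hq : 0 < |p| := abs_pos.2 (by rcases hp with h | h <;> [exact h.1.ne'; exact h.1.ne])
  have hinj : ∀ j, j ≠ i → b j ≠ 0 → x j ≠ x i := fun j hj hb => hs.ne hj hb hbi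
  obtain ⟨hI, hint⟩ := integral_cnt_div_sq (x := x) (b := b) i
  set N : ℝ → ℤ := fun z => cnt x b (x i + z) + cntLeft x b (x i - z) - cnt x b (x i)
      - cntLeft x b (x i) with hN
  -- At a particle of either sign the two one-sided counts add up to twice the upper envelope minus
  -- 1; this is the excess treated in `setIntegral_div_sq_le`.
  have hNtop : ∀ z, N z = (cnt x b (x i + z) - cntTop x b (x i)) +
      (cntLeft x b (x i - z) - cntTop x b (x i)) + 1 := by
    intro z
    simp only [hN]
    rw [cntTop_particle hinj, cnt_particle hinj]
    rcases hp with h | h <;> rw [h.2] <;> norm_num <;> ring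
  set U : ℝ → ℝ := fun y => (cntTop x b y : ℝ) / n with hU
  have hUm : Measurable U := (measurable_from_top.comp measurable_cntTop).div_const _
  have hUb : ∀ y, |U y| ≤ 1 := fun y => by
    simp only [hU]
    rw [abs_div, abs_of_pos hn', div_le_one hn']
    exact_mod_cast abs_cntTop_le hs.abs_le y
  have hIF : IntegrableOn (fun z => (N z / n : ℝ) / z ^ 2) (Ioi 0) := by
    have h1 : IntegrableOn (fun z => (N z : ℝ) / z ^ 2 / n) (Ioi 0) := hI.div_const _
    refine h1.congr_fun (fun z _ => ?_) measurableSet_Ioi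
    simp only
    ring
  have heq : 1 / n * ∑ j with j ≠ i, (b j : ℝ) / (x j - x i)
      = ∫ z in Ioi 0, (N z / n : ℝ) / z ^ 2 := by
    rw [← hint, ← integral_const_mul]
    refine setIntegral_congr_fun measurableSet_Ioi fun z _ => ?_
    simp only [hN]
    ring
  have hinner : ∫ z in Ioc 0 ρ, (N z / n : ℝ) / z ^ 2 ≤ 29 * K * ρ + 2 * K / (n * |p|) := by
    refine setIntegral_div_sq_le hn hq hK hρ (hIF.mono_set Ioc_subset_Ioi_self) fun z hz => ?_
    have h1 : (cnt x b (x i + z) - cntTop x b (x i) : ℝ) ≤ n * (p * z + K * z ^ 2) := by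
      have h2 := htouch z (by rw [abs_of_pos hz.1]; exact hz.2)
      rw [← sub_div, div_le_iff₀ hn'] at h2
      have h3 : (cnt x b (x i + z) : ℝ) ≤ cntTop x b (x i + z) := by
        exact_mod_cast cnt_le_cntTop _
      linarith
    have h2 : (cntLeft x b (x i - z) - cntTop x b (x i) : ℝ) ≤ n * (K * z ^ 2 - p * z) := by
      have h2 := htouch (-z) (by rw [abs_neg, abs_of_pos hz.1]; exact hz.2)
      rw [← sub_div, div_le_iff₀ hn', ← sub_eq_add_neg] at h2
      have h3 : (cntLeft x b (x i - z) : ℝ) ≤ cntTop x b (x i - z) := by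
        exact_mod_cast cntLeft_le_cntTop _
      linarith
    have h0 : (n : ℝ) * (N z / n) = N z := by field_simp
    -- For a negative slope the increments to the right and to the left exchange their roles, so the
    -- lemma is always used with slope |p|.
    rcases hp with h | h
    · refine ⟨cnt x b (x i + z) - cntTop x b (x i), cntLeft x b (x i - z) - cntTop x b (x i),
        ?_, ?_, ?_⟩
      · rw [h0, hNtop]
        push_cast
        ring
      · rw [abs_of_pos h.1]
        exact_mod_cast h1
      · rw [abs_of_pos h.1]
        exact_mod_cast h2
    · refine ⟨cntLeft x b (x i - z) - cntTop x b (x i), cnt x b (x i + z) - cntTop x b (x i),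
        ?_, ?_, ?_⟩
      · rw [h0, hNtop]
        push_cast
        ring
      · rw [abs_of_neg h.1]
        push_cast
        linarith
      · rw [abs_of_neg h.1]
        push_cast
        linarith
  have houter : ∫ z in Ioi ρ, (N z / n : ℝ) / z ^ 2 ≤ outer ρ U (x i) + 1 / (n * ρ) := by
    have hsd := integrableOn_secondDiff hρ hUm hUb (x i)
    have hq := (integrableOn_inv_sq_Ioi hρ).const_mul (1 / (n : ℝ))
    have h1 : ∫ z in Ioi ρ, (N z / n : ℝ) / z ^ 2 ≤
        ∫ z in Ioi ρ, (secondDiff U (x i) z / z ^ 2 + 1 / n * (1 / z ^ 2)) := by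
      refine setIntegral_mono_on (hIF.mono_set (Ioi_subset_Ioi hρ.le)) (hsd.add hq)
        measurableSet_Ioi fun z hz => ?_
      rw [mul_one_div, ← add_div]
      refine div_le_div_of_nonneg_right ?_ (sq_nonneg z)
      have h3 : (cnt x b (x i + z) : ℝ) ≤ cntTop x b (x i + z) := by
        exact_mod_cast cnt_le_cntTop _
      have h4 : (cntLeft x b (x i - z) : ℝ) ≤ cntTop x b (x i - z) := by
        exact_mod_cast cntLeft_le_cntTop _
      rw [hNtop]
      simp only [secondDiff, hU]
      push_cast
      have e : (cntTop x b (x i + z) : ℝ) / n + cntTop x b (x i - z) / n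
          - 2 * (cntTop x b (x i) / n) + 1 / n
          = (cntTop x b (x i + z) + cntTop x b (x i - z) - 2 * cntTop x b (x i) + 1) / n := by
        ring
      rw [e]
      gcongr
      linarith
    refine h1.trans (le_of_eq ?_)
    rw [integral_add hsd hq, integral_const_mul, integral_inv_sq_Ioi hρ, outer_eq hρ hUm hUb]
    field_simp
  have hsplit : ∫ z in Ioi 0, (N z / n : ℝ) / z ^ 2 = (∫ z in Ioc 0 ρ, (N z / n : ℝ) / z ^ 2) +
      ∫ z in Ioi ρ, (N z / n : ℝ) / z ^ 2 := by
    rw [← Ioc_union_Ioi_eq_Ioi hρ.le, setIntegral_union (Ioc_disjoint_Ioi le_rfl)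
      measurableSet_Ioi (hIF.mono_set Ioc_subset_Ioi_self) (hIF.mono_set (Ioi_subset_Ioi hρ.le))]
  rw [heq, hsplit]
  -- The factor |p| of the Hamiltonian cancels the singular dependence on small slopes, so the error
  -- is uniform in p.
  have h5 : |p| * (29 * K * ρ + 2 * K / (n * |p|)) = 29 * K * ρ * |p| + 2 * K / n := by
    field_simp
  have h6 : |p| * (1 / (n * ρ)) = |p| / (n * ρ) := by ring
  have h7 := mul_le_mul_of_nonneg_left (add_le_add hinner houter) hq.le
  simp only [mul_add] at h7 h5 ⊢
  linarith

end Static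

/-! ### The particle system between two exceptional times -/

/-- On `[σ, τ]` the particles move according to the differential equation with charges `B`. -/
structure IsSlab {n : ℕ} (x : ℝ → Fin n → ℝ) (B : Fin n → ℤ) (σ τ : ℝ) : Prop where
  nonneg : 0 ≤ σ
  lt : σ < τ
  state : ∀ s ∈ Ico σ τ, IsState (x s) B
  continuousOn : ∀ i, ContinuousOn (fun s => x s i) (Icc σ τ)
  ode : ∀ s ∈ Ioo σ τ, ∀ i, HasDerivAt (fun s => x s i)
    ((1 / n) * ∑ j with j ≠ i, (B i * B j : ℝ) / (x s i - x s j)) s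

section Solution
variable {n : ℕ} {T : ℝ} {x₀ : Fin n → ℝ} {b₀ : Fin n → ℤ} {x : ℝ → Fin n → ℝ}
  {b : ℝ → Fin n → ℤ} {S : Finset ℝ} (h : IsSolutionWith T x₀ b₀ x b S)
include h

lemma IsSolutionWith.tendsto_left {t : ℝ} (ht : t ∈ Ioc 0 T) (i : Fin n) :
    Tendsto (fun s => b s i) (𝓝[<] t) (𝓝 (leftCharge b t i)) := by
  obtain ⟨l, hl⟩ := h.hasLeftLimits i t ht
  rwa [leftCharge, leftLim_eq_of_tendsto hl]

/-- Without a jump an integer valued function is continuous, hence constant on an interval. -/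
lemma IsSolutionWith.charge_eq {σ τ : ℝ} (hσ : 0 ≤ σ) (hτ : τ ≤ T)
    (hS : ∀ s ∈ S, ¬ (σ < s ∧ s < τ)) {s : ℝ} (hs : s ∈ Ico σ τ) : b s = b σ := by
  ext i
  have hc : ContinuousOn (fun s => b s i) (Ico σ τ) := by
    intro s hs
    have h0 : 0 ≤ s := hσ.trans hs.1
    have hr : ContinuousWithinAt (fun s => b s i) (Icc s T) s :=
      h.rightContinuous i s ⟨h0, hs.2.le.trans hτ⟩
    rcases hs.1.eq_or_lt with rfl | hlt
    · exact hr.mono fun u hu => ⟨hu.1, hu.2.le.trans hτ⟩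
    · have ht : s ∈ Ioc 0 T := ⟨hσ.trans_lt hlt, hs.2.le.trans hτ⟩
      have heq : leftCharge b s i = b s i := by
        by_contra hne
        exact hS s (h.jump i s ht hne).1 ⟨hlt, hs.2⟩
      have hl : ContinuousWithinAt (fun s => b s i) (Iio s) s := by
        have := h.tendsto_left ht i
        rwa [heq] at this
      refine (hl.union hr).mono fun u hu => ?_
      rcases lt_or_ge u s with h1 | h1
      · exact Or.inl h1
      · exact Or.inr ⟨h1, hu.2.le.trans hτ⟩
  exact isPreconnected_Ico.constant hc hs ⟨le_rfl, hs.1.trans_lt hs.2⟩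

lemma IsSolutionWith.isSlab {σ τ : ℝ} (hσ : 0 ≤ σ) (hστ : σ < τ) (hτ : τ ≤ T)
    (hS : ∀ s ∈ S, ¬ (σ < s ∧ s < τ)) : IsSlab x (b σ) σ τ where
  nonneg := hσ
  lt := hστ
  state s hs := by
    rw [← h.charge_eq hσ hτ hS hs]
    exact h.state s ⟨hσ.trans hs.1, hs.2.le.trans hτ⟩
  continuousOn i := (h.continuousOn i).mono (Icc_subset_Icc hσ hτ)
  ode s hs i := by
    rw [← h.charge_eq hσ hτ hS ⟨hs.1.le, hs.2⟩]
    exact h.ode s ⟨⟨hσ.trans_lt hs.1, hs.2.trans_le hτ⟩, fun hmem => hS s hmem hs⟩ i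

lemma IsSolutionWith.leftCharge_eq {σ τ : ℝ} (hσ : 0 ≤ σ) (hστ : σ < τ) (hτ : τ ≤ T)
    (hS : ∀ s ∈ S, ¬ (σ < s ∧ s < τ)) (i : Fin n) : leftCharge b τ i = b σ i := by
  refine tendsto_nhds_unique (h.tendsto_left ⟨hσ.trans_lt hστ, hτ⟩ i) ?_
  refine tendsto_const_nhds.congr' ?_
  filter_upwards [Ioo_mem_nhdsLT hστ] with s hs
  rw [h.charge_eq hσ hτ hS ⟨hs.1.le, hs.2⟩]

lemma IsSolutionWith.abs_charge_le {σ τ : ℝ} (hσ : 0 ≤ σ) (hστ : σ < τ) (hτ : τ ≤ T)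
    (hS : ∀ s ∈ S, ¬ (σ < s ∧ s < τ)) (i : Fin n) : |b τ i| ≤ |b σ i| := by
  rw [← h.leftCharge_eq hσ hστ hτ hS i]
  by_cases hj : leftCharge b τ i = b τ i
  · rw [hj]
  · rw [(h.jump i τ ⟨hσ.trans_lt hστ, hτ⟩ hj).2.2]
    simp

/-- Annihilations do not change sums of functions of the positions weighted by the charges. -/
lemma IsSolutionWith.sum_charge_mul {σ τ : ℝ} (hσ : 0 ≤ σ) (hστ : σ < τ) (hτ : τ ≤ T)
    (hS : ∀ s ∈ S, ¬ (σ < s ∧ s < τ)) (F : ℝ → ℤ) :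
    ∑ i, b τ i * F (x τ i) = ∑ i, b σ i * F (x τ i) := by
  have hmem : τ ∈ Ioc 0 T := ⟨hσ.trans_lt hστ, hτ⟩
  rw [← sub_eq_zero, ← Finset.sum_sub_distrib]
  by_cases hτS : τ ∈ S
  · rw [← Finset.sum_fiberwise_of_maps_to (g := fun i => x τ i)
      (t := Finset.univ.image fun i => x τ i) (by simp)]
    refine Finset.sum_eq_zero fun y _ => ?_
    have h1 := h.annihilation τ hτS y
    have h2 : ∑ i with x τ i = y, (b τ i * F (x τ i) - b σ i * F (x τ i))
        = (∑ i with x τ i = y, (b τ i - leftCharge b τ i)) * F y := by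
      rw [Finset.sum_mul]
      refine Finset.sum_congr rfl fun i hi => ?_
      rw [(Finset.mem_filter.1 hi).2, h.leftCharge_eq hσ hστ hτ hS]
      ring
    rw [h2, h1, zero_mul]
  · refine Finset.sum_eq_zero fun i _ => ?_
    have : leftCharge b τ i = b τ i := by
      by_contra hne
      exact hτS (h.jump i τ hmem hne).1
    rw [← this, h.leftCharge_eq hσ hστ hτ hS, sub_self]

lemma IsSolutionWith.cnt_eq {σ τ : ℝ} (hσ : 0 ≤ σ) (hστ : σ < τ) (hτ : τ ≤ T)
    (hS : ∀ s ∈ S, ¬ (σ < s ∧ s < τ)) (y : ℝ) : cnt (x τ) (b τ) y = cnt (x τ) (b σ) y := by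
  simpa [cnt] using h.sum_charge_mul hσ hστ hτ hS fun z => if z ≤ y then 1 else 0

lemma IsSolutionWith.cntLeft_eq {σ τ : ℝ} (hσ : 0 ≤ σ) (hστ : σ < τ) (hτ : τ ≤ T)
    (hS : ∀ s ∈ S, ¬ (σ < s ∧ s < τ)) (y : ℝ) :
    cntLeft (x τ) (b τ) y = cntLeft (x τ) (b σ) y := by
  simpa [cntLeft] using h.sum_charge_mul hσ hστ hτ hS fun z => if z < y then 1 else 0

lemma IsSolutionWith.sum_charge_eq {σ τ : ℝ} (hσ : 0 ≤ σ) (hστ : σ < τ) (hτ : τ ≤ T)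
    (hS : ∀ s ∈ S, ¬ (σ < s ∧ s < τ)) : ∑ i, b τ i = ∑ i, b σ i := by
  simpa using h.sum_charge_mul hσ hστ hτ hS fun _ => 1

omit h in
/-- Induction over the finitely many exceptional times. -/
lemma slab_induction {P : ℝ → Prop} (S : Finset ℝ) (hpos : ∀ s ∈ S, 0 < s) (h0 : P 0)
    (hstep : ∀ σ τ, 0 ≤ σ → σ < τ → τ ≤ T → (∀ s ∈ S, ¬ (σ < s ∧ s < τ)) → P σ → P τ) :
    ∀ t ∈ Icc 0 T, P t := by
  have key : ∀ k, ∀ t ∈ Icc 0 T, (S.filter (· < t)).card = k → P t := by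
    intro k
    induction k using Nat.strong_induction_on with
    | _ k ih =>
      intro t ht hk
      rcases ht.1.eq_or_lt with rfl | ht0
      · exact h0
      by_cases hne : (S.filter (· < t)).Nonempty
      · set σ := (S.filter (· < t)).max' hne with hσ
        have hσm : σ ∈ S.filter (· < t) := Finset.max'_mem _ hne
        obtain ⟨h1, h2⟩ := Finset.mem_filter.1 hσm
        have hσ0 := hpos σ h1
        refine hstep σ t hσ0.le h2 ht.2 (fun s hs hst => ?_) (ih _ ?_ σ
          ⟨hσ0.le, h2.le.trans ht.2⟩ rfl)
        · exact absurd ((S.filter (· < t)).le_max' s (Finset.mem_filter.2 ⟨hs, hst.2⟩))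
            (not_le.2 hst.1)
        · rw [← hk]
          refine Finset.card_lt_card (Finset.ssubset_iff_of_subset (fun s hs => ?_) |>.2
            ⟨σ, hσm, by simp⟩)
          rw [Finset.mem_filter] at hs ⊢
          exact ⟨hs.1, hs.2.trans h2⟩
      · refine hstep 0 t le_rfl ht0 ht.2 (fun s hs hst => hne ⟨s, ?_⟩) h0
        exact Finset.mem_filter.2 ⟨hs, hst.2⟩
  exact fun t ht => key _ t ht rfl

end Solution

/-! ### One sided minima -/

lemma nonpos_of_hasDerivAt_of_left {q : ℝ → ℝ} {p a : ℝ} (hq : HasDerivAt q p a)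
    (h : ∀ᶠ y in 𝓝[<] a, q a ≤ q y) : p ≤ 0 := by
  have h1 := (hasDerivAt_iff_tendsto_slope.1 hq).mono_left (nhdsLT_le_nhdsNE a)
  refine le_of_tendsto h1 ?_
  filter_upwards [h, self_mem_nhdsWithin] with y hy hya
  rw [slope_def_field]
  exact div_nonpos_of_nonneg_of_nonpos (by linarith) (by linarith [mem_Iio.1 hya])

lemma nonneg_of_hasDerivAt_of_right {q : ℝ → ℝ} {p a : ℝ} (hq : HasDerivAt q p a)
    (h : ∀ᶠ y in 𝓝[>] a, q a ≤ q y) : 0 ≤ p := by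
  have h1 := (hasDerivAt_iff_tendsto_slope.1 hq).mono_left (nhdsGT_le_nhdsNE a)
  refine ge_of_tendsto h1 ?_
  filter_upwards [h, self_mem_nhdsWithin] with y hy hya
  rw [slope_def_field]
  exact div_nonneg (by linarith) (by linarith [mem_Ioi.1 hya])

section Slab
variable {n : ℕ} {x : ℝ → Fin n → ℝ} {B : Fin n → ℤ} {σ τ : ℝ} (h : IsSlab x B σ τ)
include h

lemma IsSlab.continuousAt {s : ℝ} (hs : s ∈ Ioo σ τ) : ContinuousAt x s :=
  continuousAt_pi.2 fun i => (h.ode s hs i).continuousAt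

lemma IsSlab.upperSemicontinuousOn :
    UpperSemicontinuousOn (fun p : ℝ × ℝ => (cntTop (x p.1) B p.2 : ℝ) / n)
      (Ico σ τ ×ˢ univ) := by
  rintro ⟨s, y⟩ hp a ha
  have hc : Tendsto (fun p : ℝ × ℝ => (x p.1, p.2)) (𝓝[Ico σ τ ×ˢ univ] (s, y))
      (𝓝 (x s, y)) := by
    refine Tendsto.prodMk_nhds (tendsto_pi_nhds.2 fun i => ?_)
      (continuous_snd.continuousAt.tendsto.mono_left nhdsWithin_le_nhds)
    have h1 : ContinuousWithinAt (fun s => x s i) (Ico σ τ) s :=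
      ((h.continuousOn i).mono Ico_subset_Icc_self) s hp.1
    refine h1.tendsto.comp (tendsto_nhdsWithin_iff.2
      ⟨continuous_fst.continuousAt.tendsto.mono_left nhdsWithin_le_nhds, ?_⟩)
    exact eventually_nhdsWithin_of_forall fun q hq => hq.1
  filter_upwards [hc.eventually (eventually_cntTop_le (h.state s hp.1) y)] with p hp
  refine lt_of_le_of_lt ?_ ha
  exact div_le_div_of_nonneg_right (by exact_mod_cast hp) (Nat.cast_nonneg n)

/-- Away from charged particles the envelope is locally constant, so the slope and the time
derivative of the test function vanish at contact. At a charged particle the derivative of the test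
function along its trajectory vanishes, which expresses the time derivative through the velocity,
and `force_le` applies. -/
lemma IsSlab.quarticSub {c κ ρ : ℝ} (hn : 0 < n) (hc : 0 < c) (hρ : 0 < ρ) (hρ1 : ρ ≤ 1)
    (hκ : 4 * c / (n * ρ) + 1276 * c ^ 2 * ρ + 22 * c / n ≤ κ) :
    QuarticSub c κ ρ (Ioo σ τ) (fun p : ℝ × ℝ => (cntTop (x p.1) B p.2 : ℝ) / n) := by
  intro t ht y y₀ g hyy₀ hg hmax
  have hn' : (0 : ℝ) < n := by exact_mod_cast hn
  have hκ0 : 0 ≤ κ := le_trans (by positivity) hκ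
  have hnear : ∀ᶠ s in 𝓝 t, s ∈ Ioo σ τ := Ioo_mem_nhds ht.1 ht.2
  set q : ℝ → ℝ := fun y => c * (y - y₀) ^ 4 with hq
  have hqd : ∀ y, HasDerivAt q (4 * c * (y - y₀) ^ 3) y := fun y => by
    have := (((hasDerivAt_id y).sub_const y₀).pow 4).const_mul c
    refine this.congr_deriv ?_
    push_cast
    simp
    ring
  by_cases hex : ∃ i, B i ≠ 0 ∧ x t i = y
  · obtain ⟨i, hi, rfl⟩ := hex
    have hst := h.state t ⟨ht.1.le, ht.2⟩
    have hinj : ∀ j, j ≠ i → B j ≠ 0 → x t j ≠ x t i := fun j hj hb => hst.ne hj hb hi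
    have hloc := eventually_cnt_eq_add hinj
    have htop := cntTop_particle hinj
    set p := 4 * c * (x t i - y₀) ^ 3 with hp
    set v := (1 / n : ℝ) * ∑ j with j ≠ i, (B i * B j : ℝ) / (x t i - x t j) with hv
    have hgd : HasDerivAt g (deriv g t) t :=
      ((hg.differentiableOn (by norm_num)).differentiableAt (isOpen_Ioo.mem_nhds ht)).hasDerivAt
    have hcurve : HasDerivAt (fun s => q (x s i) + g s) (p * v + deriv g t) t :=
      ((hqd _).comp t (h.ode t ht i)).add hgd
    -- The envelope keeps its value along the trajectory, so touching from above is a local minimum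
    -- of the test function along it.
    have hmin : IsLocalMin (fun s => q (x s i) + g s) t := by
      have hcx : Tendsto (fun s => (x s, x s i)) (𝓝 t) (𝓝 (x t, x t i)) :=
        (h.continuousAt ht).prodMk (h.ode t ht i).continuousAt
      filter_upwards [hcx.eventually hloc, hnear] with s hs hsI
      have h1 := hmax s hsI (x s i)
      have h2 : cntTop (x s) B (x s i) = cntTop (x t) B (x t i) := by
        rw [htop, cntTop, hs.1, hs.2]
        simp only [le_refl, lt_irrefl, if_true, if_false]
        omega
      simp only [h2] at h1
      simp only [hq]
      linarith
    have hder := hmin.hasDerivAt_eq_zero hcurve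
    by_cases hp0 : p = 0
    · rw [hp0] at hder ⊢
      simp only [abs_zero, zero_mul] at hder ⊢
      linarith
    have hmaxy : ∀ y, cntTop (x t) B y = cntTop (x t) B (x t i) → q (x t i) ≤ q y := by
      intro y hy
      have := hmax t ht y
      simp only [hy] at this
      simp only [hq]
      linarith
    have hlocy : Tendsto (fun y => (x t, y)) (𝓝 (x t i)) (𝓝 (x t, x t i)) :=
      Continuous.tendsto (by fun_prop) _
    -- Next to the particle the envelope keeps its top value on one side, the right for a positive
    -- charge and the left for a negative one. The resulting one-sided minimum of the quartic fixes
    -- the sign of its slope.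
    have hsign : 0 < p ∧ B i = 1 ∨ p < 0 ∧ B i = -1 := by
      rcases hst.1 i with hb | hb | hb
      · rcases lt_or_gt_of_ne hp0 with h1 | h1
        · exact Or.inr ⟨h1, hb⟩
        · exfalso
          refine absurd (nonpos_of_hasDerivAt_of_left (hqd (x t i)) ?_) (not_le.2 h1)
          filter_upwards [(hlocy.mono_left nhdsWithin_le_nhds).eventually hloc,
            self_mem_nhdsWithin] with y hy hya
          refine hmaxy y ?_
          have e1 : ¬ x t i ≤ y := not_le.2 hya
          have e2 : ¬ x t i < y := fun h => e1 h.le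
          rw [htop, cntTop, hy.1, hy.2, if_neg e1, if_neg e2, hb]
          simp
      · exact absurd hb hi
      · rcases lt_or_gt_of_ne hp0 with h1 | h1
        · exfalso
          refine absurd (nonneg_of_hasDerivAt_of_right (hqd (x t i)) ?_) (not_le.2 h1)
          filter_upwards [(hlocy.mono_left nhdsWithin_le_nhds).eventually hloc,
            self_mem_nhdsWithin] with y hy hya
          refine hmaxy y ?_
          have e2 : x t i < y := hya
          rw [htop, cntTop, hy.1, hy.2, if_pos e2.le, if_pos e2, hb]
          simp
        · exact Or.inl ⟨h1, hb⟩
    -- The constant is 6 + 4 + 1, from the expansion of the quartic with |x - y₀| ≤ 1 and |z| ≤ 1.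
    have hforce := force_le hn hst (K := 11 * c) hsign (by positivity) hρ (fun z hz => by
      have h1 := hmax t ht (x t i + z)
      have hz1 := abs_le.1 (hz.trans hρ1)
      have hX := abs_le.1 hyy₀
      have h2 : c * (x t i + z - y₀) ^ 4 - c * (x t i - y₀) ^ 4 ≤ p * z + 11 * c * z ^ 2 := by
        set X := x t i - y₀ with hXd
        have e : x t i + z - y₀ = X + z := by rw [hXd]; ring
        rw [e, hp]
        have h3 : 6 * X ^ 2 + 4 * X * z + z ^ 2 ≤ 11 := by nlinarith
        have h4 : c * z ^ 2 * (6 * X ^ 2 + 4 * X * z + z ^ 2) ≤ c * z ^ 2 * 11 := by gcongr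
        nlinarith
      simp only at h1
      linarith)
    have hpc : |p| ≤ 4 * c := by
      rw [hp, abs_mul, abs_of_pos (by positivity), abs_pow]
      exact mul_le_of_le_one_right (by positivity) (pow_le_one₀ (abs_nonneg _) hyy₀)
    have hvel : deriv g t = |p| * (1 / n * ∑ j with j ≠ i, (B j : ℝ) / (x t j - x t i)) := by
      have e1 : v = -(B i : ℝ) * (1 / n * ∑ j with j ≠ i, (B j : ℝ) / (x t j - x t i)) := by
        rw [hv, mul_left_comm, Finset.mul_sum _ _ (-(B i : ℝ))]
        congr 1
        refine Finset.sum_congr rfl fun j _ => ?_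
        rw [← neg_sub (x t j) (x t i), div_neg]
        ring
      have e2 : p * (B i : ℝ) = |p| := by
        rcases hsign with h1 | h1
        · rw [h1.2, abs_of_pos h1.1]; simp
        · rw [h1.2, abs_of_neg h1.1]; simp
      rw [e1] at hder
      rw [← e2]
      linarith
    rw [hvel]
    refine hforce.trans ?_
    have e1 : |p| / (n * ρ) ≤ 4 * c / (n * ρ) := by gcongr
    have e2 : 29 * (11 * c) * ρ * |p| ≤ 29 * (11 * c) * ρ * (4 * c) := by gcongr
    have e3 : 2 * (11 * c) / n = 22 * c / n := by ring
    nlinarith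
  · push Not at hex
    have hloc := eventually_cnt_eq hex
    have htop : ∀ᶠ p : (Fin n → ℝ) × ℝ in 𝓝 (x t, y),
        cntTop p.1 B p.2 = cntTop (x t) B y := by
      filter_upwards [hloc] with p hp
      rw [cntTop, cntTop, hp.1, hp.2, hloc.self_of_nhds.1]
    have h1 : IsLocalMin q y := by
      have hlocy : Tendsto (fun y => (x t, y)) (𝓝 y) (𝓝 (x t, y)) :=
        Continuous.tendsto (by fun_prop) _
      filter_upwards [hlocy.eventually htop] with y' hy'
      have := hmax t ht y'
      simp only [hy'] at this
      simp only [hq]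
      linarith
    have h2 : IsLocalMin g t := by
      have hcx : Tendsto (fun s => (x s, y)) (𝓝 t) (𝓝 (x t, y)) :=
        (h.continuousAt ht).prodMk continuousAt_const
      filter_upwards [hcx.eventually htop, hnear] with s hs hsI
      have := hmax s hsI y
      simp only [hs] at this
      linarith
    rw [h1.hasDerivAt_eq_zero (hqd y), h2.deriv_eq_zero]
    simpa using hκ0

end Slab

/-! ### Tightness of the particle system -/

lemma hasDerivAt_bump (x : ℝ) : HasDerivAt bump (2 * x / (1 + x ^ 2) ^ 2) x := by
  have h1 : HasDerivAt (fun x : ℝ => 1 + x ^ 2) (2 * x) x := by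
    simpa using ((hasDerivAt_id x).pow 2).const_add 1
  have h2 := (h1.inv (by positivity)).const_sub 1
  have h3 : bump = fun x => 1 - (1 + x ^ 2)⁻¹ := by
    ext y
    simp [bump]
  rw [h3]
  refine h2.congr_deriv ?_
  ring

lemma abs_deriv_bump_sub_le (x y : ℝ) :
    |2 * x / (1 + x ^ 2) ^ 2 - 2 * y / (1 + y ^ 2) ^ 2| ≤ 6 * |x - y| := by
  have h := convex_univ.norm_image_sub_le_of_norm_hasDerivWithin_le (𝕜 := ℝ) (s := univ)
    (f := fun x : ℝ => 2 * x / (1 + x ^ 2) ^ 2) (f' := fun x => (2 - 6 * x ^ 2) / (1 + x ^ 2) ^ 3)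
    (C := 6) (x := y) (y := x) (fun z _ => by
      have h1 : HasDerivAt (fun x : ℝ => 1 + x ^ 2) (2 * z) z := by
        simpa using ((hasDerivAt_id z).pow 2).const_add 1
      have h2 : HasDerivAt (fun x : ℝ => 2 * x) 2 z := by
        simpa using (hasDerivAt_id z).const_mul 2
      refine ((h2.fun_div (h1.fun_pow 2) (by positivity)).congr_deriv ?_).hasDerivWithinAt
      field_simp
      ring) (fun z _ => by
      rw [Real.norm_eq_abs, abs_div, abs_of_pos (show 0 < (1 + z ^ 2) ^ 3 by positivity),
        div_le_iff₀ (by positivity)]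
      have h1 : (1 + z ^ 2) ≤ (1 + z ^ 2) ^ 3 :=
        le_self_pow₀ (by nlinarith [sq_nonneg z]) (by norm_num)
      rw [abs_le]
      constructor <;> nlinarith [sq_nonneg z]) (mem_univ _) (mem_univ _)
  simpa [Real.norm_eq_abs] using h

/-- Symmetrization of the interaction. -/
lemma sum_interaction_le {n : ℕ} {x : Fin n → ℝ} {B : Fin n → ℤ} (hs : IsState x B) {f : ℝ → ℝ}
    {L : ℝ} (hL : 0 ≤ L) (hf : ∀ x y, |f x - f y| ≤ L * |x - y|) :
    ∑ i, |(B i : ℝ)| * (f (x i) * ∑ j with j ≠ i, (B i * B j : ℝ) / (x i - x j))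
      ≤ L * n ^ 2 / 2 := by
  set c : Fin n → Fin n → ℝ := fun i j => (B i * B j : ℝ) / (x i - x j) with hc
  have h0 : ∀ i, |(B i : ℝ)| * (f (x i) * ∑ j with j ≠ i, c i j) = ∑ j, f (x i) * c i j := by
    intro i
    have h1 : ∑ j with j ≠ i, c i j = ∑ j, c i j := by
      refine Finset.sum_filter_of_ne fun j _ hj hji => hj ?_
      simp [hc, hji]
    rw [h1, Finset.mul_sum, Finset.mul_sum]
    refine Finset.sum_congr rfl fun j _ => ?_
    have h2 : |(B i : ℝ)| * B i = B i := by
      rcases hs.1 i with h | h | h <;> rw [h] <;> norm_num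
    calc |(B i : ℝ)| * (f (x i) * c i j)
        = f (x i) * ((|(B i : ℝ)| * B i) * B j / (x i - x j)) := by simp only [hc]; ring
      _ = _ := by rw [h2]
  change ∑ i, |(B i : ℝ)| * (f (x i) * ∑ j with j ≠ i, c i j) ≤ _
  simp only [h0]
  -- The interaction is antisymmetric, so only differences of f appear, and its Lipschitz bound
  -- cancels the singularity. The weights |B i| are absorbed by the charges.
  have hsym : ∑ i, ∑ j, f (x i) * c i j = ∑ i, ∑ j, -(f (x j) * c i j) := by
    rw [Finset.sum_comm]
    refine Finset.sum_congr rfl fun i _ => Finset.sum_congr rfl fun j _ => ?_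
    have : c j i = -c i j := by
      simp only [hc]
      rw [← neg_sub (x i) (x j), div_neg, mul_comm]
    rw [this]
    ring
  have h2 : 2 * ∑ i, ∑ j, f (x i) * c i j = ∑ i, ∑ j, (f (x i) - f (x j)) * c i j := by
    rw [two_mul]
    nth_rewrite 2 [hsym]
    rw [← Finset.sum_add_distrib]
    refine Finset.sum_congr rfl fun i _ => ?_
    rw [← Finset.sum_add_distrib]
    refine Finset.sum_congr rfl fun j _ => ?_
    ring
  have h3 : ∑ i, ∑ j, (f (x i) - f (x j)) * c i j ≤ ∑ _i : Fin n, ∑ _j : Fin n, L := by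
    refine Finset.sum_le_sum fun i _ => Finset.sum_le_sum fun j _ => ?_
    by_cases hij : x i = x j
    · simp [hc, hij, hL]
    · have hpos : 0 < |x i - x j| := abs_pos.2 (sub_ne_zero.2 hij)
      have hb : |(B i * B j : ℝ)| ≤ 1 := by
        rw [abs_mul]
        have h1 : |(B i : ℝ)| ≤ 1 := by exact_mod_cast hs.abs_le i
        have h2 : |(B j : ℝ)| ≤ 1 := by exact_mod_cast hs.abs_le j
        exact mul_le_one₀ h1 (abs_nonneg _) h2
      refine (le_abs_self _).trans ?_
      simp only [hc]
      rw [abs_mul, abs_div, mul_div_assoc', div_le_iff₀ hpos]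
      calc _ ≤ L * |x i - x j| * 1 := mul_le_mul (hf _ _) hb (abs_nonneg _) (by positivity)
        _ = _ := mul_one _
  simp only [Finset.sum_const, Finset.card_univ, Fintype.card_fin, nsmul_eq_mul] at h3
  nlinarith

/-- The time derivative is the symmetrized interaction for a function of Lipschitz constant 6 / R,
with prefactor 1 / (nR). No bound on single velocities enters, and after division by n the growth is
uniform in n. -/
lemma IsSlab.moment_le {n : ℕ} {x : ℝ → Fin n → ℝ} {B : Fin n → ℤ} {σ τ R : ℝ}
    (h : IsSlab x B σ τ) (hn : 0 < n) (hR : 0 < R) :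
    ∑ i, |(B i : ℝ)| * bump (x τ i / R) ≤
      ∑ i, |(B i : ℝ)| * bump (x σ i / R) + 3 * n / R ^ 2 * (τ - σ) := by
  have hn' : (0 : ℝ) < n := by exact_mod_cast hn
  set G : ℝ → ℝ := fun s => ∑ i, |(B i : ℝ)| * bump (x s i / R) with hG
  have hcb : Continuous bump := continuous_iff_continuousAt.2 fun x =>
    (hasDerivAt_bump x).continuousAt
  have hcont : ContinuousOn G (Icc σ τ) := by
    refine continuousOn_finsetSum _ fun i _ => continuousOn_const.mul ?_
    exact hcb.comp_continuousOn ((h.continuousOn i).div_const R)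
  set f : ℝ → ℝ := fun y => 2 * (y / R) / (1 + (y / R) ^ 2) ^ 2 with hf
  have hder : ∀ s ∈ Ioo σ τ, HasDerivAt G (1 / (n * R) * ∑ i, |(B i : ℝ)| * (f (x s i) *
      ∑ j with j ≠ i, (B i * B j : ℝ) / (x s i - x s j))) s := by
    intro s hs
    have : HasDerivAt G (∑ i, |(B i : ℝ)| * (f (x s i) * ((1 / n * ∑ j with j ≠ i,
        (B i * B j : ℝ) / (x s i - x s j)) / R))) s := by
      refine HasDerivAt.fun_sum fun i _ => HasDerivAt.const_mul _ ?_
      exact (hasDerivAt_bump _).comp s ((h.ode s hs i).div_const R)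
    refine this.congr_deriv ?_
    rw [Finset.mul_sum]
    refine Finset.sum_congr rfl fun i _ => ?_
    field_simp
  have hbound : ∀ s ∈ interior (Icc σ τ), deriv G s ≤ 3 * n / R ^ 2 := by
    rw [interior_Icc]
    intro s hs
    rw [(hder s hs).deriv]
    have h1 := sum_interaction_le (h.state s ⟨hs.1.le, hs.2⟩) (f := f) (L := 6 / R)
      (by positivity) (fun u v => by
        refine (abs_deriv_bump_sub_le (u / R) (v / R)).trans (le_of_eq ?_)
        rw [← sub_div, abs_div, abs_of_pos hR]
        ring)
    refine (mul_le_mul_of_nonneg_left h1 (by positivity)).trans (le_of_eq ?_)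
    field_simp
    ring
  have := (convex_Icc σ τ).image_sub_le_mul_sub_of_deriv_le hcont
    (by
      rw [interior_Icc]
      exact fun s hs => (hder s hs).differentiableAt.differentiableWithinAt) hbound
    σ (left_mem_Icc.2 h.lt.le) τ (right_mem_Icc.2 h.lt.le) h.lt.le
  simp only [hG] at this
  linarith

/-- Annihilations only lower the weights |b i|, so the estimates on the slabs add up. -/
lemma IsSolutionWith.moment_le {n : ℕ} {T : ℝ} {x₀ : Fin n → ℝ} {b₀ : Fin n → ℤ}
    {x : ℝ → Fin n → ℝ} {b : ℝ → Fin n → ℤ} {S : Finset ℝ} (h : IsSolutionWith T x₀ b₀ x b S)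
    (hn : 0 < n) {R : ℝ} (hR : 0 < R) : ∀ t ∈ Icc 0 T,
    ∑ i, |(b t i : ℝ)| * bump (x t i / R) ≤
      ∑ i, |(b₀ i : ℝ)| * bump (x₀ i / R) + 3 * n / R ^ 2 * t := by
  refine slab_induction S (fun s hs => (h.exceptional s hs).1) ?_ ?_
  · simp [h.initial_pos, h.initial_charge]
  · intro σ τ hσ hστ hτ hS ih
    have h1 := (h.isSlab hσ hστ hτ hS).moment_le hn hR
    have h2 : ∑ i, |(b τ i : ℝ)| * bump (x τ i / R) ≤ ∑ i, |(b σ i : ℝ)| * bump (x τ i / R) := by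
      refine Finset.sum_le_sum fun i _ => mul_le_mul_of_nonneg_right ?_ (bump_nonneg _)
      exact_mod_cast h.abs_charge_le hσ hστ hτ hS i
    linarith

/-! ### Comparison of the particle system with a supersolution -/

section Closing
variable {n : ℕ} {x : Fin n → ℝ} {b : Fin n → ℤ}

lemma eventually_cntLeft_right (x : Fin n → ℝ) (b : Fin n → ℤ) (y : ℝ) :
    ∀ᶠ z in 𝓝[>] y, cntLeft x b z = cnt x b y ∧ ∀ j, x j ≠ z := by
  have h : ∀ j, ∀ᶠ z in 𝓝[>] y, (x j < z ↔ x j ≤ y) ∧ x j ≠ z := by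
    intro j
    rcases le_or_gt (x j) y with hj | hj
    · filter_upwards [self_mem_nhdsWithin] with z hz
      have : x j < z := hj.trans_lt hz
      exact ⟨iff_of_true this hj, this.ne⟩
    · filter_upwards [Ioo_mem_nhdsGT hj] with z hz
      exact ⟨iff_of_false (not_lt.2 hz.2.le) (not_le.2 hj), hz.2.ne'⟩
  filter_upwards [eventually_all.2 h] with z hz
  refine ⟨?_, fun j => (hz j).2⟩
  unfold cnt cntLeft
  simp only [(hz _).1]

lemma eventually_cntLeft_left (x : Fin n → ℝ) (b : Fin n → ℤ) (y : ℝ) :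
    ∀ᶠ z in 𝓝[<] y, cntLeft x b z = cntLeft x b y ∧ ∀ j, x j ≠ z := by
  have h : ∀ j, ∀ᶠ z in 𝓝[<] y, (x j < z ↔ x j < y) ∧ x j ≠ z := by
    intro j
    rcases lt_or_ge (x j) y with hj | hj
    · filter_upwards [Ioo_mem_nhdsLT hj] with z hz
      exact ⟨iff_of_true hz.1 hj, hz.1.ne⟩
    · filter_upwards [self_mem_nhdsWithin] with z hz
      have : z < x j := lt_of_lt_of_le hz hj
      exact ⟨iff_of_false (not_lt.2 this.le) (not_lt.2 hj), this.ne'⟩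
  filter_upwards [eventually_all.2 h] with z hz
  refine ⟨?_, fun j => (hz j).2⟩
  unfold cntLeft
  simp only [(hz _).1]

end Closing

/-- Bounds of the counting functions pass to the end of a slab. -/
lemma IsSlab.le_at_end {n : ℕ} {x : ℝ → Fin n → ℝ} {B : Fin n → ℤ} {σ τ : ℝ}
    (h : IsSlab x B σ τ) {F : ℝ → ℝ → ℝ} (hF : Continuous (Function.uncurry F))
    (hle : ∀ s ∈ Ico σ τ, ∀ y, (cntTop (x s) B y : ℝ) ≤ F s y) (y : ℝ) :
    (cntTop (x τ) B y : ℝ) ≤ F τ y := by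
  have hx : Tendsto x (𝓝[<] τ) (𝓝 (x τ)) := by
    refine tendsto_pi_nhds.2 fun i => ?_
    have h1 := h.continuousOn i τ (right_mem_Icc.2 h.lt.le)
    rw [ContinuousWithinAt, ← nhdsWithin_Ico_eq_nhdsLT h.lt] at *
    exact h1.mono_left (nhdsWithin_mono _ Ico_subset_Icc_self)
  -- At the final time charges may collide, so `IsState` is not available. At unoccupied points the
  -- counts are locally constant and the bound passes to the limit; occupied points are then reached
  -- from either side.
  have key : ∀ z, (∀ j, x τ j ≠ z) → (cntLeft (x τ) B z : ℝ) ≤ F τ z := by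
    intro z hz
    have h1 : Tendsto (fun s => F s z) (𝓝[<] τ) (𝓝 (F τ z)) :=
      (Continuous.tendsto (by fun_prop : Continuous fun s => F s z) τ).mono_left
        nhdsWithin_le_nhds
    refine ge_of_tendsto h1 ?_
    have h2 : Tendsto (fun s => (x s, z)) (𝓝[<] τ) (𝓝 (x τ, z)) :=
      hx.prodMk_nhds tendsto_const_nhds
    filter_upwards [h2.eventually (eventually_cnt_eq (b := B) fun j _ => hz j),
      Ioo_mem_nhdsLT h.lt] with s hs hsI
    refine le_trans ?_ (hle s ⟨hsI.1.le, hsI.2⟩ z)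
    rw [← hs.1]
    exact_mod_cast cnt_le_cntTop z
  have hFy : Tendsto (fun z => F τ z) (𝓝 y) (𝓝 (F τ y)) :=
    Continuous.tendsto (by fun_prop : Continuous fun z => F τ z) y
  have h1 : (cnt (x τ) B y : ℝ) ≤ F τ y := by
    refine ge_of_tendsto (hFy.mono_left nhdsWithin_le_nhds : Tendsto _ (𝓝[>] y) _) ?_
    filter_upwards [eventually_cntLeft_right (x τ) B y] with z hz
    rw [← hz.1]
    exact key z hz.2
  have h2 : (cntLeft (x τ) B y : ℝ) ≤ F τ y := by
    refine ge_of_tendsto (hFy.mono_left nhdsWithin_le_nhds : Tendsto _ (𝓝[<] y) _) ?_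
    filter_upwards [eventually_cntLeft_left (x τ) B y] with z hz
    rw [← hz.1]
    exact key z hz.2
  unfold cntTop
  push_cast
  exact max_le h1 h2

/-- The doubled bound is propagated from slab to slab by `doubling`. Since ηt counts time from 0 and
M is never enlarged, the number of exceptional times does not enter. -/
theorem IsSolutionWith.doubled_le {n : ℕ} {T : ℝ} {x₀ : Fin n → ℝ} {b₀ : Fin n → ℤ}
    {x : ℝ → Fin n → ℝ} {b : ℝ → Fin n → ℤ} {S : Finset ℝ} (h : IsSolutionWith T x₀ b₀ x b S)
    (hn : 0 < n) {W : ℝ × ℝ → ℝ} {C c η r ρ κ M : ℝ} (hC : 1 ≤ C) (hr : 0 < r) (hρ : 0 < ρ)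
    (hρ1 : ρ ≤ 1) (hW : ContinuousOn W (Ici 0 ×ˢ univ)) (hWC : ∀ t ≥ 0, ∀ x, |W (t, x)| ≤ C)
    (hcr : 2 * C ≤ c * (r / 2) ^ 2) (hc1 : 2 * C ≤ c)
    (hκ : 4 * c / (n * ρ) + 1276 * c ^ 2 * ρ + 22 * c / n ≤ κ) (hκη : 2 * κ < η)
    (hWs : QuarticSub c κ ρ (Ioi 0) (fun p => -W p)) (hM : 0 < M)
    (hinf : ∃ R, ∀ t ∈ Icc 0 T, ∀ y s y', 0 ≤ s → R ≤ |y| → |y - y'| ≤ 1 → |t + r - s| ≤ r / 2 →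
      (cntTop (x t) (b t) y : ℝ) / n - W (s, y') ≤ M)
    (hinit : ∀ y s y', 0 ≤ s → |y - y'| ≤ 1 → |r - s| ≤ r / 2 →
      (cntTop x₀ b₀ y : ℝ) / n - W (s, y') - c * (y - y') ^ 4 - c * (r - s) ^ 2 ≤ M) :
    ∀ t ∈ Icc 0 T, ∀ y s y', 0 ≤ s → |y - y'| ≤ 1 → |t + r - s| ≤ r / 2 →
      (cntTop (x t) (b t) y : ℝ) / n - W (s, y') - c * (y - y') ^ 4 - c * (t + r - s) ^ 2 - η * t
        ≤ M := by
  have hn' : (0 : ℝ) < n := by exact_mod_cast hn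
  have hc : 0 < c := by linarith
  have hκ0 : 0 ≤ κ := le_trans (by positivity) hκ
  have hη : 0 < η := by linarith
  refine slab_induction S (fun s hs => (h.exceptional s hs).1) ?_ ?_
  · intro y s y' hs h1 h2
    rw [h.initial_pos, h.initial_charge]
    simpa using hinit y s y' hs h1 (by simpa using h2)
  intro σ τ hσ hστ hτ hS ih y s y' hs h1 h2
  have hslab := h.isSlab hσ hστ hτ hS
  have hins : insert σ (Ioo σ τ) = Ico σ τ := Ioo_insert_left hστ
  set U : ℝ × ℝ → ℝ := fun p => (cntTop (x p.1) (b σ) p.2 : ℝ) / n with hU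
  -- The term γ / (τ - t) keeps the maximum away from the end of the slab, where the charges may
  -- collide. It is increasing in t, so the lower bound η for the derivative is kept.
  have hmid : ∀ γ > 0, ∀ t ∈ Ico σ τ, ∀ y s y', 0 ≤ s →
      U (t, y) - W (s, y') - c * (y - y') ^ 4 - c * (t + r - s) ^ 2
        - (η * t + γ * (τ - t)⁻¹) ≤ M := by
    intro γ hγ
    have hpos : ∀ t ∈ Ico σ τ, 0 < γ * (τ - t)⁻¹ := fun t ht => by
      have : 0 < τ - t := sub_pos.2 ht.2
      positivity
    have key := doubling (U := U) (W := W) (C := C) (c := c) (η := η) (r := r) (ρ := ρ)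
      (κ := κ) (M := M) (σ := σ) (I := Ioo σ τ) (K := Icc σ (τ - γ / (2 * C)))
      (P := fun t => η * t + γ * (τ - t)⁻¹)
      hr hρ hσ Ioo_subset_Ioi_self isOpen_Ioo (by rw [hins]; exact hslab.upperSemicontinuousOn)
      (by
        rw [hins]
        intro t ht y
        simp only [hU]
        rw [abs_div, abs_of_pos hn']
        refine le_trans ?_ hC
        rw [div_le_one hn']
        exact_mod_cast abs_cntTop_le (hslab.state t ht).abs_le y)
      hW hWC
      (by
        rw [hins]
        intro t ht
        have := hpos t ht
        have := hσ.trans ht.1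
        positivity)
      (by
        rw [hins]
        have : ∀ t ∈ Ico σ τ, τ - t ≠ 0 := fun t ht => (sub_pos.2 ht.2).ne'
        fun_prop (disch := assumption))
      (by
        have : ∀ t ∈ Ioo σ τ, τ - t ≠ 0 := fun t ht => (sub_pos.2 ht.2).ne'
        exact ContDiffOn.add (by fun_prop)
          (contDiffOn_const.mul (ContDiffOn.inv (by fun_prop) this)))
      (by
        intro t ht
        have h0 : 0 < τ - t := sub_pos.2 ht.2
        have d1 : HasDerivAt (fun t => η * t + γ * (τ - t)⁻¹)
            (η * 1 + γ * (-(-1) / (τ - t) ^ 2)) t :=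
          ((hasDerivAt_id t).const_mul η).add
            ((((hasDerivAt_id t).const_sub τ).inv h0.ne').const_mul γ)
        rw [d1.deriv]
        have : 0 ≤ γ * (-(-1) / (τ - t) ^ 2) := by
          rw [neg_neg]
          positivity
        linarith)
      isCompact_Icc
      (by
        rw [hins]
        refine fun t ht => ⟨ht.1, ht.2.trans_lt ?_⟩
        have : 0 < γ / (2 * C) := by positivity
        linarith)
      (by
        rw [hins]
        intro t ht htK
        have h0 : 0 < τ - t := sub_pos.2 ht.2
        have h1 : τ - γ / (2 * C) < t := by
          by_contra h
          exact htK ⟨ht.1, not_lt.1 h⟩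
        have h2 : τ - t < γ / (2 * C) := by linarith
        rw [lt_div_iff₀ (by positivity)] at h2
        have h3 : 2 * C ≤ γ * (τ - t)⁻¹ := by
          rw [← div_eq_mul_inv, le_div_iff₀ h0]
          linarith
        have : 0 ≤ η * t := mul_nonneg hη.le (hσ.trans ht.1)
        linarith)
      hc hcr hc1
      (by
        obtain ⟨R, hR⟩ := hinf
        refine ⟨R, fun t ht y s y' hs h1 h2 h3 => ?_⟩
        have htτ : t < τ := ht.2.trans_lt (by
          have : 0 < γ / (2 * C) := by positivity
          linarith)
        have := hR t ⟨hσ.trans ht.1, htτ.le.trans hτ⟩ y s y' hs h1 h2 h3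
        rwa [h.charge_eq hσ hτ hS ⟨ht.1, htτ⟩] at this)
      (by
        intro y s y' hs h1 h2
        have := ih y s y' hs h1 h2
        have := hpos σ ⟨le_rfl, hστ⟩
        simp only [hU]
        linarith)
      hM (hslab.quarticSub hn hc hρ hρ1 hκ) hWs hκη
    rwa [hins] at key
  have hmid2 : ∀ t ∈ Ico σ τ, ∀ y, (cntTop (x t) (b σ) y : ℝ) ≤
      n * (W (s, y') + c * (y - y') ^ 4 + c * (t + r - s) ^ 2 + η * t + M) := by
    intro t ht y
    have h0 : 0 < τ - t := sub_pos.2 ht.2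
    rw [← div_le_iff₀' hn']
    refine le_of_forall_pos_le_add fun ε hε => ?_
    -- For a fixed t this choice of γ turns the singular term into ε.
    have := hmid (ε * (τ - t)) (by positivity) t ht y s y' hs
    rw [mul_assoc, mul_inv_cancel₀ h0.ne', mul_one] at this
    simp only [hU] at this
    linarith
  have hend := hslab.le_at_end (F := fun t y => n * (W (s, y') + c * (y - y') ^ 4 +
    c * (t + r - s) ^ 2 + η * t + M)) (by fun_prop) hmid2 y
  -- Only charges at a common point are annihilated, with total charge zero, so the counts do not
  -- notice the jump.
  have heq : cntTop (x τ) (b τ) y = cntTop (x τ) (b σ) y := by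
    unfold cntTop
    rw [h.cnt_eq hσ hστ hτ hS, h.cntLeft_eq hσ hστ hτ hS]
  rw [heq]
  rw [← div_le_iff₀' hn'] at hend
  linarith

/-! ### Conservation of charge, bounded positions and charge reversal. -/

section Bounds
variable {n : ℕ} {T : ℝ} {x₀ : Fin n → ℝ} {b₀ : Fin n → ℤ} {x : ℝ → Fin n → ℝ}
  {b : ℝ → Fin n → ℤ} {S : Finset ℝ} (h : IsSolutionWith T x₀ b₀ x b S)
include h

lemma IsSolutionWith.sum_charge_initial : ∀ t ∈ Icc 0 T, ∑ i, b t i = ∑ i, b₀ i := by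
  refine slab_induction S (fun s hs => (h.exceptional s hs).1) (by rw [h.initial_charge]) ?_
  intro σ τ hσ hστ hτ hS ih
  rw [h.sum_charge_eq hσ hστ hτ hS, ih]

lemma IsSolutionWith.exists_pos_bound : ∃ R, ∀ t ∈ Icc 0 T, ∀ i, |x t i| ≤ R := by
  choose R hR using fun i => isCompact_Icc.exists_bound_of_continuousOn (h.continuousOn i)
  refine ⟨∑ i, |R i|, fun t ht i => ((hR i t ht).trans (le_abs_self _)).trans ?_⟩
  exact Finset.single_le_sum (f := fun i => |R i|) (fun _ _ => abs_nonneg _) (Finset.mem_univ i)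

/-- The forces depend on products of charges only. Charge reversal turns upper bounds for the
cumulative functions into lower bounds. -/
lemma IsSolutionWith.neg :
    IsSolutionWith T x₀ (fun i => -b₀ i) x (fun t i => -b t i) S := by
  have hl : ∀ i, ∀ t ∈ Ioc 0 T, leftCharge (fun t i => -b t i) t i = -leftCharge b t i :=
    fun i t ht => leftLim_eq_of_tendsto (h.tendsto_left ht i).neg
  refine ⟨h.exceptional, fun t ht => ⟨fun i => ?_, fun i j hij hb => ?_⟩, h.continuousOn,
    h.contDiffOn, fun i t ht => (h.rightContinuous i t ht).neg, fun i t ht => ?_, h.initial_pos,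
    by rw [h.initial_charge], fun i => ?_, fun i t ht hne => ?_, fun τ hτ y => ?_,
    fun t ht i => ?_⟩
  · rcases (h.state t ht).1 i with h | h | h <;> simp [h]
  · exact (h.state t ht).2 i j hij (by simpa using hb)
  · obtain ⟨l, hl⟩ := h.hasLeftLimits i t ht
    exact ⟨-l, hl.neg⟩
  · refine (h.jump_once i).anti fun t ht => ⟨ht.1, fun heq => ht.2 ?_⟩
    rw [hl i t ht.1, heq]
  · rw [hl i t ht] at hne ⊢
    obtain ⟨h1, h2, h3⟩ := h.jump i t ht (fun heq => hne (by rw [heq]))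
    exact ⟨h1, by rwa [abs_neg], by rw [h3, neg_zero]⟩
  · rw [← neg_eq_zero, ← Finset.sum_neg_distrib, ← h.annihilation τ hτ y]
    refine Finset.sum_congr rfl fun i _ => ?_
    rw [hl i τ (h.exceptional τ hτ)]
    ring
  · refine (h.ode t ht i).congr_deriv ?_
    simp

end Bounds

lemma QuarticSub.mono {c κ κ' ρ : ℝ} {I : Set ℝ} {U : ℝ × ℝ → ℝ} (h : QuarticSub c κ ρ I U)
    (hκ : κ ≤ κ') : QuarticSub c κ' ρ I U := fun t ht x y₀ g h1 h2 h3 => by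
  linarith [h t ht x y₀ g h1 h2 h3]

/-- The counting functions of the particle systems stay below a supersolution of the limiting
equation, up to a small error if there are many particles. -/
theorem exists_particle_le {T B β e : ℝ} (hT : 0 < T) (hB : 0 < B) {f : ℝ → ℝ} {W : ℝ × ℝ → ℝ}
    (hf0 : Tendsto f atBot (𝓝 0)) (hfβ : Tendsto f atTop (𝓝 β)) (hfB : ∀ x, |f x| ≤ B)
    (hW : HasModulus W) (hWB : ∀ p, |W p| ≤ B) (hWf : ∀ x, W (0, x) = f x)
    (hWs : ∀ ρ > 0, IsSubsolution ρ (fun p => -W p)) (he : 0 < e) :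
    ∃ N : ℕ, ∃ d > 0, ∀ n ≥ N, 0 < n → ∀ (x₀ : Fin n → ℝ) (b₀ : Fin n → ℤ)
      (x : ℝ → Fin n → ℝ) (b : ℝ → Fin n → ℤ) (S : Finset ℝ), IsSolutionWith T x₀ b₀ x b S →
      (∀ y, (cntTop x₀ b₀ y : ℝ) / n ≤ f y + d) → ((∑ i, b₀ i : ℤ) : ℝ) / n ≤ β + d →
      ∀ t ∈ Icc 0 T, ∀ y, (cntTop (x t) (b t) y : ℝ) / n ≤ W (t, y) + e := by
  -- Error budget: 3θ from the doubling, θ from the modulus of W and ηT ≤ e / 2.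
  set θ := e / 8 with hθ
  have hθ0 : 0 < θ := by positivity
  obtain ⟨δ, hδ, hmod⟩ := hW θ hθ0
  set η := e / (2 * (T + 1)) with hη
  have hη0 : 0 < η := by positivity
  have hηT : η * T ≤ e / 2 := by
    rw [hη, div_mul_eq_mul_div, div_le_iff₀ (by positivity)]
    nlinarith
  set r := δ / 2 with hr
  have hr0 : 0 < r := by positivity
  set C := max 1 B with hC
  have hC1 : 1 ≤ C := le_max_left _ _
  have hBC : B ≤ C := le_max_right _ _
  have hC0 : 0 < C := by linarith
  set c := max (2 * C) (max (2 * C / (r / 2) ^ 2) (2 * C / δ ^ 4)) with hc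
  have hc1 : 2 * C ≤ c := le_max_left _ _
  have hc2 : 2 * C / (r / 2) ^ 2 ≤ c := (le_max_left _ _).trans (le_max_right _ _)
  have hc3 : 2 * C / δ ^ 4 ≤ c := (le_max_right _ _).trans (le_max_right _ _)
  rw [div_le_iff₀ (by positivity)] at hc2 hc3
  have hc0 : 0 < c := by linarith
  set κ := η / 4 with hκ
  have hκ0 : 0 < κ := by positivity
  -- The radius is fixed before n, using half of κ; the errors of order 1 / n, which contain 1 / ρ,
  -- are absorbed afterwards by the choice of N.
  set ρ := min 1 (κ / (2 * (1276 * c ^ 2))) with hρ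
  have hρ0 : 0 < ρ := by positivity
  have hρ1 : ρ ≤ 1 := min_le_left _ _
  have hρκ : 1276 * c ^ 2 * ρ ≤ κ / 2 := by
    have : ρ ≤ κ / (2 * (1276 * c ^ 2)) := min_le_right _ _
    rw [le_div_iff₀ (by positivity)] at this
    linarith
  have hWs' : QuarticSub c κ ρ (Ioi 0) (fun p => -W p) := by
    refine ((hWs (ρ + 1) (by linarith)).quarticSub hρ0 (by linarith) hρ1 hc0).mono ?_
    have : 0 ≤ c ^ 2 * ρ := by positivity
    linarith
  obtain ⟨R₂, hR₂⟩ := (hWs 1 one_pos).le_at_infinity (f := fun x => -f x) one_pos hB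
    hW.neg.continuousOn.upperSemicontinuousOn (fun t _ x => by simpa using hWB (t, x))
    (fun x => by simp [hWf]) (fun x => by simpa using hfB x) hf0.neg hfβ.neg (T + 2 * r) hθ0
  obtain ⟨N, hN⟩ := exists_nat_ge ((4 * c / ρ + 22 * c) * 2 / κ)
  refine ⟨N, θ, hθ0, fun n hnN hn x₀ b₀ x b S h hinit htot t ht y => ?_⟩
  have hn' : (0 : ℝ) < n := by exact_mod_cast hn
  obtain ⟨R₁, hR₁⟩ := h.exists_pos_bound
  have hstate0 : ∀ i, |b₀ i| ≤ 1 := by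
    have := (h.state 0 ⟨le_rfl, hT.le⟩).abs_le
    rwa [h.initial_charge] at this
  have key := h.doubled_le hn (W := W) (C := C) (c := c) (η := η) (r := r) (ρ := ρ) (κ := κ)
    (M := 3 * θ) hC1 hr0 hρ0 hρ1 hW.continuousOn (fun t _ x => (hWB _).trans hBC) hc2 hc1
    (by
      have h1 : (4 * c / ρ + 22 * c) * 2 / κ ≤ n := hN.trans (by exact_mod_cast hnN)
      rw [div_le_iff₀ hκ0] at h1
      have h2 : 4 * c / (n * ρ) + 22 * c / n ≤ κ / 2 := by
        have : 4 * c / (n * ρ) + 22 * c / n = (4 * c / ρ + 22 * c) / n := by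
          field_simp
        rw [this, div_le_iff₀ hn']
        linarith
      linarith)
    (by linarith) hWs' (by positivity)
    (by
      -- Beyond all particles the count is 0 on the left and the conserved total charge on the
      -- right. The radius R₁ depends on n and on the solution, but no estimate depends on it.
      refine ⟨max (R₁ + 1) (R₂ + 1), fun t ht y s y' hs hy hyy hts => ?_⟩
      have hy1 : R₁ + 1 ≤ |y| := (le_max_left _ _).trans hy
      have hy2 : R₂ + 1 ≤ |y| := (le_max_right _ _).trans hy
      rw [abs_le] at hyy hts
      have hs' : s ∈ Icc 0 (T + 2 * r) := ⟨hs, by linarith [ht.2]⟩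
      rcases le_total 0 y with h0 | h0
      · rw [abs_of_nonneg h0] at hy1 hy2
        have h1 : cntTop (x t) (b t) y = ∑ i, b₀ i := by
          rw [← h.sum_charge_initial t ht]
          have hlt : ∀ i, x t i < y := fun i => by linarith [(abs_le.1 (hR₁ t ht i)).2]
          simp [cntTop, cnt, cntLeft, hlt, (hlt _).le]
        have h2 := (hR₂ s hs' y').1 (by linarith)
        rw [h1]
        linarith
      · rw [abs_of_nonpos h0] at hy1 hy2
        have h1 : cntTop (x t) (b t) y = 0 := by
          have hlt : ∀ i, y < x t i := fun i => by linarith [(abs_le.1 (hR₁ t ht i)).1]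
          simp [cntTop, cnt, cntLeft, not_lt.2 (hlt _).le, not_le.2 (hlt _)]
        have h2 := (hR₂ s hs' y').2 (by linarith)
        rw [h1]
        simp only [Int.cast_zero, zero_div]
        linarith)
    (by
      intro y s y' hs hyy hts
      have hq2 : 0 ≤ c * (r - s) ^ 2 := by positivity
      have hq4 : 0 ≤ c * (y - y') ^ 4 := by positivity
      have h0 := hinit y
      by_cases hd : |y - y'| ≤ δ
      · have h1 := (abs_le.1 (hmod (0, y) (s, y') le_rfl hs (by
          rw [abs_le] at hts ⊢
          constructor <;> simp only <;> linarith) hd)).2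
        rw [hWf] at h1
        linarith
      · have h4 : δ ^ 4 ≤ (y - y') ^ 4 := by
          have := (not_le.1 hd).le
          rw [← (show Even 4 by decide).pow_abs (y - y')]
          gcongr
        have h5 : 2 * C ≤ c * (y - y') ^ 4 := hc3.trans (by gcongr)
        have h6 : (cntTop x₀ b₀ y : ℝ) / n ≤ 1 := by
          rw [div_le_one hn']
          exact_mod_cast (le_abs_self _).trans (abs_cntTop_le hstate0 y)
        have h7 := (abs_le.1 (hWB (s, y'))).1
        linarith)
  have ht0 : 0 ≤ t := ht.1
  have h1 := key t ht y (t + r) y (by linarith) (by simp) (by simp; linarith)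
  simp only [sub_self] at h1
  norm_num at h1
  have h2 := (abs_le.1 (hmod (t + r, y) (t, y) (by simp only; linarith) ht0
    (by simp only; rw [abs_le]; constructor <;> linarith) (by simp [hδ.le]))).2
  have h3 : η * t ≤ η * T := by
    have := ht.2
    gcongr
  linarith

lemma cntTop_neg {n : ℕ} (x : Fin n → ℝ) (b : Fin n → ℤ) (y : ℝ) :
    cntTop x (fun i => -b i) y = -min (cnt x b y) (cntLeft x b y) := by
  have h1 : cnt x (fun i => -b i) y = -cnt x b y := by
    unfold cnt
    rw [← Finset.sum_neg_distrib]
    refine Finset.sum_congr rfl fun i _ => ?_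
    split_ifs <;> simp
  have h2 : cntLeft x (fun i => -b i) y = -cntLeft x b y := by
    unfold cntLeft
    rw [← Finset.sum_neg_distrib]
    refine Finset.sum_congr rfl fun i _ => ?_
    split_ifs <;> simp
  rw [cntTop, h1, h2, max_neg_neg]

/-- Uniform convergence of the cumulative functions of the particle systems. -/
theorem exists_particle_abs_le {T B β e : ℝ} (hT : 0 < T) (hB : 0 < B) {f : ℝ → ℝ}
    {W : ℝ × ℝ → ℝ} (hf : Continuous f)
    (hf0 : Tendsto f atBot (𝓝 0)) (hfβ : Tendsto f atTop (𝓝 β)) (hfB : ∀ x, |f x| ≤ B)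
    (hW : HasModulus W) (hWB : ∀ p, |W p| ≤ B) (hWf : ∀ x, W (0, x) = f x)
    (hWs : ∀ ρ > 0, IsSubsolution ρ W) (hWs' : ∀ ρ > 0, IsSubsolution ρ (fun p => -W p))
    (he : 0 < e) :
    ∃ N : ℕ, ∃ d > 0, ∀ n ≥ N, 0 < n → ∀ (x₀ : Fin n → ℝ) (b₀ : Fin n → ℤ)
      (x : ℝ → Fin n → ℝ) (b : ℝ → Fin n → ℤ) (S : Finset ℝ), IsSolutionWith T x₀ b₀ x b S →
      (∀ y, |(cnt x₀ b₀ y : ℝ) / n - f y| ≤ d) →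
      ∀ t ∈ Icc 0 T, ∀ y, |(cnt (x t) (b t) y : ℝ) / n - W (t, y)| ≤ e := by
  obtain ⟨N₁, d₁, hd₁, h₁⟩ := exists_particle_le hT hB hf0 hfβ hfB hW hWB hWf hWs' he
  obtain ⟨N₂, d₂, hd₂, h₂⟩ := exists_particle_le (f := fun x => -f x) (W := fun p => -W p) hT hB
    (by simpa using hf0.neg) hfβ.neg (fun x => by simpa using hfB x) hW.neg
    (fun p => by simpa using hWB p) (fun x => by simp [hWf]) (by simpa using hWs) he
  refine ⟨max N₁ N₂, min d₁ d₂, lt_min hd₁ hd₂, fun n hn hn0 x₀ b₀ x b S h hinit t ht y => ?_⟩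
  have hn' : (0 : ℝ) < n := by exact_mod_cast hn0
  set d := min d₁ d₂ with hd
  -- Left limits through unoccupied points, where the two counts agree; f is continuous, so the
  -- bound d is kept.
  have hleft : ∀ y, |(cntLeft x₀ b₀ y : ℝ) / n - f y| ≤ d := by
    intro y
    have h1 : Tendsto (fun z => |(cntLeft x₀ b₀ y : ℝ) / n - f z|) (𝓝[<] y)
        (𝓝 |(cntLeft x₀ b₀ y : ℝ) / n - f y|) :=
      (Continuous.tendsto (by fun_prop) y).mono_left nhdsWithin_le_nhds
    refine le_of_tendsto h1 ?_
    filter_upwards [eventually_cntLeft_left x₀ b₀ y] with z hz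
    have h2 := (eventually_cnt_eq (x := x₀) (b := b₀) (y := z) fun j _ => hz.2 j).self_of_nhds.1
    simp only at h2
    rw [← hz.1, ← h2]
    exact hinit z
  have htot : |((∑ i, b₀ i : ℤ) : ℝ) / n - β| ≤ d := by
    have h1 : Tendsto (fun z => |((∑ i, b₀ i : ℤ) : ℝ) / n - f z|) atTop
        (𝓝 |((∑ i, b₀ i : ℤ) : ℝ) / n - β|) := (tendsto_const_nhds.sub hfβ).abs
    refine le_of_tendsto h1 ?_
    have h2 : ∀ᶠ z in atTop, ∀ i, x₀ i ≤ z := eventually_all.2 fun i => eventually_ge_atTop _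
    filter_upwards [h2] with z hz
    have : cnt x₀ b₀ z = ∑ i, b₀ i := by simp [cnt, hz]
    rw [← this]
    exact hinit z
  have hdd₁ : d ≤ d₁ := min_le_left _ _
  have hdd₂ : d ≤ d₂ := min_le_right _ _
  have a₁ := h₁ n ((le_max_left _ _).trans hn) hn0 x₀ b₀ x b S h (fun y => by
    have e1 := (abs_le.1 (hinit y)).2
    have e2 := (abs_le.1 (hleft y)).2
    unfold cntTop
    rw [div_le_iff₀ hn']
    push_cast
    exact max_le ((div_le_iff₀ hn').1 (by linarith)) ((div_le_iff₀ hn').1 (by linarith))) (by linarith [(abs_le.1 htot).2]) t ht y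
  have a₂ := h₂ n ((le_max_right _ _).trans hn) hn0 x₀ (fun i => -b₀ i) x (fun t i => -b t i) S
    h.neg (fun y => by
    have e1 := (abs_le.1 (hinit y)).1
    have e2 := (abs_le.1 (hleft y)).1
    rw [cntTop_neg]
    push_cast
    rw [neg_div, neg_le, ← min_div_div_right hn'.le]
    exact le_min (by linarith) (by linarith)) (by
      rw [Finset.sum_neg_distrib]
      push_cast [neg_div] at htot ⊢
      linarith [(abs_le.1 htot).1]) t ht y
  rw [cntTop_neg] at a₂
  push_cast at a₂
  rw [neg_div] at a₂
  have e1 : (cnt (x t) (b t) y : ℝ) / n ≤ (cntTop (x t) (b t) y : ℝ) / n := by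
    have : (cnt (x t) (b t) y : ℝ) ≤ cntTop (x t) (b t) y := by
      exact_mod_cast cnt_le_cntTop y
    gcongr
  have e2 : min (cnt (x t) (b t) y : ℝ) (cntLeft (x t) (b t) y) / n
      ≤ (cnt (x t) (b t) y : ℝ) / n := by
    gcongr
    exact min_le_left _ _
  rw [abs_le]
  constructor <;> linarith

/-! ### Signed measures on the line -/

instance isFiniteMeasure_variation (ν : SignedMeasure ℝ) : IsFiniteMeasure ν.variation := by
  rw [← SignedMeasure.totalVariation_eq_variation]
  infer_instance

/-- The integral of a function against a signed measure. -/
abbrev lint (ν : SignedMeasure ℝ) (φ : ℝ → ℝ) : ℝ := ν.integral φ (ContinuousLinearMap.lsmul ℝ ℝ)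

lemma signedMeasure_Ioc (ν : SignedMeasure ℝ) {a c : ℝ} (h : a ≤ c) :
    ν (Ioc a c) = ν (Iic c) - ν (Iic a) := by
  rw [← Iic_union_Ioc_eq_Iic h, VectorMeasure.of_union (Iic_disjoint_Ioc le_rfl) measurableSet_Iic
    measurableSet_Ioc]
  ring

lemma abs_signedMeasure_le (ν : SignedMeasure ℝ) {s t : Set ℝ} {e : ℝ} (he : 0 ≤ e) (hst : s ⊆ t)
    (h : ν.variation t ≤ ENNReal.ofReal e) : |ν s| ≤ e := by
  have h1 := (VectorMeasure.enorm_measure_le_variation ν s).trans ((measure_mono hst).trans h)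
  rw [← Real.norm_eq_abs, ← toReal_enorm]
  exact ENNReal.toReal_le_of_le_ofReal he h1

/-- A finite signed measure is small outside of large intervals. -/
lemma exists_variation_compl_le (ν : SignedMeasure ℝ) {e : ℝ} (he : 0 < e) :
    ∃ R₀ : ℝ, ∀ R ≥ R₀, ν.variation (Ioc (-R) R)ᶜ ≤ ENNReal.ofReal e := by
  have h1 : Tendsto (fun N : ℕ => ν.variation (Ioc (-(N : ℝ)) N)ᶜ) atTop (𝓝 0) := by
    have h2 : ⋂ N : ℕ, (Ioc (-(N : ℝ)) N)ᶜ = ∅ := by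
      refine eq_empty_of_forall_notMem fun x hx => ?_
      obtain ⟨N, hN⟩ := exists_nat_gt |x|
      have h3 := mem_iInter.1 hx N
      exact h3 ⟨by linarith [neg_abs_le x], by linarith [le_abs_self x]⟩
    have h3 := tendsto_measure_iInter_atTop (μ := ν.variation)
      (s := fun N : ℕ => (Ioc (-(N : ℝ)) N)ᶜ)
      (fun N => measurableSet_Ioc.compl.nullMeasurableSet)
      (fun a c hac => compl_subset_compl.2
        (Ioc_subset_Ioc (by simpa using hac) (by exact_mod_cast hac)))
      ⟨0, measure_ne_top _ _⟩
    rwa [h2, measure_empty] at h3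
  have h4 := (tendsto_order.1 h1).2 (ENNReal.ofReal e) (by simpa using he)
  obtain ⟨N, hN⟩ := h4.exists
  refine ⟨N, fun R hR => (measure_mono (compl_subset_compl.2
    (Ioc_subset_Ioc (by linarith) hR))).trans hN.le⟩

lemma tendsto_signedMeasure_Iic_atBot (ν : SignedMeasure ℝ) :
    Tendsto (fun y => ν (Iic y)) atBot (𝓝 0) := by
  refine Metric.tendsto_nhds.2 fun e he => ?_
  obtain ⟨R, hR⟩ := exists_variation_compl_le ν (half_pos he)
  filter_upwards [eventually_le_atBot (-R)] with y hy
  rw [Real.dist_eq, sub_zero]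
  refine (abs_signedMeasure_le ν (half_pos he).le ?_ (hR R le_rfl)).trans_lt (half_lt_self he)
  exact fun z hz h => absurd h.1 (by have := mem_Iic.1 hz; linarith)

lemma tendsto_signedMeasure_Iic_atTop (ν : SignedMeasure ℝ) :
    Tendsto (fun y => ν (Iic y)) atTop (𝓝 (ν univ)) := by
  refine Metric.tendsto_nhds.2 fun e he => ?_
  obtain ⟨R, hR⟩ := exists_variation_compl_le ν (half_pos he)
  filter_upwards [eventually_ge_atTop R] with y hy
  have h1 : ν univ = ν (Iic y) + ν (Ioi y) := by
    rw [← Iic_union_Ioi, VectorMeasure.of_union (Iic_disjoint_Ioi le_rfl) measurableSet_Iic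
      measurableSet_Ioi]
  rw [Real.dist_eq, h1, abs_sub_comm, add_sub_cancel_left]
  refine (abs_signedMeasure_le ν (half_pos he).le ?_ (hR R le_rfl)).trans_lt (half_lt_self he)
  exact fun z hz h => absurd h.2 (by have := mem_Ioi.1 hz; linarith)

/-- A finite signed measure is determined by its cumulative function. -/
lemma signedMeasure_ext_of_Iic {μ ν : SignedMeasure ℝ} (h : ∀ y, μ (Iic y) = ν (Iic y)) :
    μ = ν := by
  refine VectorMeasure.ext_of_generateFrom (range Iic) ?_
    ((BorelSpace.measurable_eq (α := ℝ)).trans (borel_eq_generateFrom_Iic ℝ)) isPiSystem_Iic ?_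
  · rintro _ ⟨y, rfl⟩
    exact h y
  · refine tendsto_nhds_unique (tendsto_signedMeasure_Iic_atTop μ) ?_
    simp_rw [h]
    exact tendsto_signedMeasure_Iic_atTop ν

/-- A continuous function of bounded variation that vanishes at `-∞` is the cumulative function of
a signed measure without atoms. -/
lemma exists_signedMeasure_Iic {f : ℝ → ℝ} (hf : Continuous f) (hf0 : Tendsto f atBot (𝓝 0))
    (hv : BoundedVariationOn f univ) :
    ∃ κ : SignedMeasure ℝ, (∀ y, κ (Iic y) = f y) ∧ ∀ y, κ {y} = 0 := by
  have h1 : ∀ a, f.rightLim a = f a := fun a => hf.continuousAt.continuousWithinAt.rightLim_eq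
  have h2 : ∀ a, f.leftLim a = f a := fun a => hf.continuousAt.continuousWithinAt.leftLim_eq
  refine ⟨hv.vectorMeasure, fun y => ?_, fun y => ?_⟩
  · rw [hv.vectorMeasure_Iic, h1, hf0.limUnder_eq, sub_zero]
  · rw [hv.vectorMeasure_singleton, h1, h2, sub_self]

lemma integrable_variation (ν : SignedMeasure ℝ) {φ : ℝ → ℝ} (hφ : Measurable φ) {M : ℝ}
    (hM : ∀ x, |φ x| ≤ M) : Integrable φ ν.variation :=
  Integrable.of_bound hφ.aestronglyMeasurable M (ae_of_all _ hM)

/-- Approximation of the integral of a function by the integral of a step function. -/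
lemma abs_lint_sub_sum_le (ν : SignedMeasure ℝ) {φ : ℝ → ℝ} (hφ : Measurable φ) {M C e η : ℝ}
    (hM : ∀ x, |φ x| ≤ M) (hη0 : 0 ≤ η) (hC0 : 0 ≤ C) (he : 0 ≤ e) {y : ℕ → ℝ} (hy : Monotone y)
    {K : ℕ} (hη : ∀ k < K, ∀ x ∈ Ioc (y k) (y (k + 1)), |φ x - φ (y (k + 1))| ≤ η)
    (hC : ν.variation univ ≤ ENNReal.ofReal C)
    (ht : ν.variation (Ioc (y 0) (y K))ᶜ ≤ ENNReal.ofReal e) :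
    |lint ν φ - ∑ k ∈ Finset.range K, φ (y (k + 1)) * ν (Ioc (y k) (y (k + 1)))|
      ≤ η * C + M * e := by
  have hM0 : 0 ≤ M := (abs_nonneg _).trans (hM 0)
  set ψ : ℝ → ℝ := fun x => ∑ k ∈ Finset.range K,
    (Ioc (y k) (y (k + 1))).indicator (fun _ => φ (y (k + 1))) x with hψ
  have hint : ∀ k, Integrable ((Ioc (y k) (y (k + 1))).indicator (fun _ => φ (y (k + 1))))
      ν.variation := fun k => (integrable_const _).indicator measurableSet_Ioc
  have h1 : lint ν ψ = ∑ k ∈ Finset.range K, φ (y (k + 1)) * ν (Ioc (y k) (y (k + 1))) := by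
    rw [lint, VectorMeasure.integral_finsetSum _ fun k _ => hint k]
    refine Finset.sum_congr rfl fun k _ => ?_
    rw [VectorMeasure.integral_indicator_const _ measurableSet_Ioc]
    simp
  have hφi := integrable_variation ν hφ hM
  have hψi : Integrable ψ ν.variation := integrable_finsetSum _ fun k _ => hint k
  rw [← h1, lint, lint, ← VectorMeasure.integral_fun_sub hφi hψi, ← Real.norm_eq_abs]
  refine (VectorMeasure.norm_integral_le_integral_norm).trans ?_
  have h2 : ∀ x, ‖φ x - ψ x‖ ≤ η + (Ioc (y 0) (y K))ᶜ.indicator (fun _ => M) x := by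
    intro x
    by_cases hx : x ∈ Ioc (y 0) (y K)
    · rw [indicator_of_notMem (by simpa using hx), add_zero]
      have h3 : ∃ k < K, x ∈ Ioc (y k) (y (k + 1)) := by
        by_contra! hcon
        have h4 : ∀ k ≤ K, y k < x := by
          intro k
          induction k with
          | zero => exact fun _ => hx.1
          | succ k ih =>
            intro hk
            by_contra! h5
            exact hcon k hk ⟨ih (by omega), h5⟩
        exact absurd hx.2 (not_le.2 (h4 K le_rfl))
      obtain ⟨k, hk, hxk⟩ := h3
      have h5 : ψ x = φ (y (k + 1)) := by
        simp only [hψ]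
        rw [Finset.sum_eq_single k, indicator_of_mem hxk]
        · intro j _ hj
          refine indicator_of_notMem (fun hxj => ?_) _
          exact disjoint_left.1 (hy.pairwise_disjoint_on_Ioc_succ hj) hxj hxk
        · intro h
          exact absurd (Finset.mem_range.2 hk) h
      rw [h5]
      exact hη k hk x hxk
    · rw [indicator_of_mem (by simpa using hx)]
      have h5 : ψ x = 0 := by
        refine Finset.sum_eq_zero fun k hk => indicator_of_notMem (fun hxk => hx ?_) _
        have := Finset.mem_range.1 hk
        exact ⟨(hy (Nat.zero_le k)).trans_lt hxk.1, hxk.2.trans (hy (by omega))⟩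
      rw [h5, sub_zero]
      exact (hM x).trans (by linarith)
  have h6 : Integrable (fun x => η + (Ioc (y 0) (y K))ᶜ.indicator (fun _ => M) x) ν.variation :=
    (integrable_const _).add ((integrable_const _).indicator measurableSet_Ioc.compl)
  have h7 : ∫ x, ‖φ x - ψ x‖ ∂ν.variation ≤ η * C + M * e := by
    refine (integral_mono (hφi.sub hψi).norm h6 h2).trans ?_
    rw [integral_add (integrable_const _) ((integrable_const _).indicator measurableSet_Ioc.compl),
      integral_const, integral_indicator_const _ measurableSet_Ioc.compl, smul_eq_mul, smul_eq_mul,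
      mul_comm η C, mul_comm M e]
    gcongr
    · exact ENNReal.toReal_le_of_le_ofReal hC0 hC
    · exact ENNReal.toReal_le_of_le_ofReal he ht
  have h8 : ‖ContinuousLinearMap.lsmul ℝ ℝ (E := ℝ)‖ ≤ 1 := ContinuousLinearMap.opNorm_lsmul_le
  calc _ ≤ 1 * ∫ x, ‖φ x - ψ x‖ ∂ν.variation := by
        gcongr
    _ ≤ _ := by rw [one_mul]; exact h7

/-- For tight families of bounded total variation, convergence of the cumulative functions implies
narrow convergence. -/
lemma tendsto_lint {μ : ℕ → SignedMeasure ℝ} {ν : SignedMeasure ℝ} {C : ℝ} (hC0 : 0 ≤ C)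
    (hC : ∀ᶠ n in atTop, (μ n).variation univ ≤ ENNReal.ofReal C)
    (ht : ∀ e > 0, ∃ R₀, ∀ R ≥ R₀, ∀ᶠ n in atTop,
      (μ n).variation (Ioc (-R) R)ᶜ ≤ ENNReal.ofReal e)
    (hlim : ∀ y, Tendsto (fun n => μ n (Iic y)) atTop (𝓝 (ν (Iic y)))) {φ : ℝ → ℝ}
    (hφ : Continuous φ) {M : ℝ} (hM : ∀ x, |φ x| ≤ M) :
    Tendsto (fun n => lint (μ n) φ) atTop (𝓝 (lint ν φ)) := by
  have hM0 : 0 ≤ M := (abs_nonneg _).trans (hM 0)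
  set C' := max C (ν.variation univ).toReal with hC'
  have hC'0 : 0 ≤ C' := hC0.trans (le_max_left _ _)
  have hνC : ν.variation univ ≤ ENNReal.ofReal C' :=
    ENNReal.le_ofReal_iff_toReal_le (measure_ne_top _ _) hC'0 |>.2 (le_max_right _ _)
  refine Metric.tendsto_nhds.2 fun e he => ?_
  obtain ⟨η, hη, hη1⟩ : ∃ η > 0, η * C' ≤ e / 10 :=
    ⟨e / (10 * (C' + 1)), by positivity, by
      rw [div_mul_eq_mul_div, div_le_div_iff₀ (by positivity) (by norm_num)]
      nlinarith⟩
  obtain ⟨e', he', he1⟩ : ∃ e' > 0, M * e' ≤ e / 10 :=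
    ⟨e / (10 * (M + 1)), by positivity, by
      rw [mul_div_assoc', div_le_div_iff₀ (by positivity) (by norm_num)]
      nlinarith⟩
  obtain ⟨R₁, hR₁⟩ := ht e' he'
  obtain ⟨R₂, hR₂⟩ := exists_variation_compl_le ν he'
  set R := max 1 (max R₁ R₂) with hR
  have hR0 : 0 < R := lt_of_lt_of_le one_pos (le_max_left _ _)
  obtain ⟨δ, hδ, hδ1⟩ := Metric.uniformContinuousOn_iff.1
    ((isCompact_Icc (a := -R) (b := R)).uniformContinuousOn_of_continuous hφ.continuousOn) η hη
  obtain ⟨K, hK⟩ := exists_nat_gt (2 * R / δ)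
  have hK0 : (0 : ℝ) < K := lt_trans (by positivity) hK
  have hKδ : 2 * R / K < δ := by
    rw [div_lt_iff₀ hδ] at hK
    rw [div_lt_iff₀ hK0]
    linarith
  set y : ℕ → ℝ := fun k => -R + k * (2 * R / K) with hy
  have hym : Monotone y := fun a c hac => by
    have : (a : ℝ) ≤ c := by exact_mod_cast hac
    simp only [hy]
    gcongr
  have hy0 : y 0 = -R := by simp [hy]
  have hyK : y K = R := by
    simp only [hy]
    field_simp
    ring
  have hstep : ∀ k, y (k + 1) = y k + 2 * R / K := fun k => by
    simp only [hy]
    push_cast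
    ring
  have hmod : ∀ k < K, ∀ x ∈ Ioc (y k) (y (k + 1)), |φ x - φ (y (k + 1))| ≤ η := by
    intro k hk x hx
    have h1 : y 0 ≤ y k := hym (Nat.zero_le k)
    have h2 : y (k + 1) ≤ y K := hym hk
    rw [hy0] at h1
    rw [hyK] at h2
    have h3 := hδ1 x ⟨h1.trans hx.1.le, hx.2.trans h2⟩ (y (k + 1))
      ⟨h1.trans (hym k.le_succ), h2⟩ (by
        rw [Real.dist_eq, abs_sub_comm, abs_of_nonneg (by linarith [hx.2])]
        linarith [hx.1, hstep k])
    exact h3.le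
  have hν := abs_lint_sub_sum_le ν hφ.measurable hM hη.le hC'0 he'.le hym hmod hνC
    (by rw [hy0, hyK]; exact hR₂ R ((le_max_right _ _).trans (le_max_right _ _)))
  -- The step functions involve only finitely many points, so pointwise convergence of the
  -- cumulative functions is enough.
  have hsum : Tendsto (fun n => ∑ k ∈ Finset.range K, φ (y (k + 1)) * μ n (Ioc (y k) (y (k + 1))))
      atTop (𝓝 (∑ k ∈ Finset.range K, φ (y (k + 1)) * ν (Ioc (y k) (y (k + 1))))) := by
    refine tendsto_finsetSum _ fun k _ => Tendsto.const_mul _ ?_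
    simp_rw [fun κ : SignedMeasure ℝ => signedMeasure_Ioc κ (hym k.le_succ)]
    exact (hlim _).sub (hlim _)
  filter_upwards [hC, hR₁ R ((le_max_left _ _).trans (le_max_right _ _)),
    Metric.tendsto_nhds.1 hsum (e / 10) (by positivity)] with n hn1 hn2 hn3
  have hμ := abs_lint_sub_sum_le (μ n) hφ.measurable hM hη.le hC'0 he'.le hym hmod
    (hn1.trans (ENNReal.ofReal_le_ofReal (le_max_left _ _))) (by rw [hy0, hyK]; exact hn2)
  rw [Real.dist_eq] at hn3 ⊢
  rw [abs_le] at hν hμ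
  rw [abs_lt] at hn3 ⊢
  constructor <;> linarith [hν.1, hν.2, hμ.1, hμ.2, hn3.1, hn3.2]

/-! ### Empirical measures -/

section Empirical
variable {n : ℕ} {x : Fin n → ℝ} {b : Fin n → ℤ}

lemma empirical_Iic (y : ℝ) : empirical x b (Iic y) = (cnt x b y : ℝ) / n := by
  have h1 : empirical x b (Iic y) = ∑ i, VectorMeasure.dirac (x i) ((b i : ℝ) / n) (Iic y) := by
    simp [empirical]
  rw [h1, cnt, Int.cast_sum, Finset.sum_div]
  refine Finset.sum_congr rfl fun i _ => ?_
  by_cases h : x i ≤ y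
  · rw [VectorMeasure.dirac_apply_of_mem measurableSet_Iic (mem_Iic.2 h), if_pos h]
  · rw [VectorMeasure.dirac_apply_of_notMem (notMem_Iic.2 (not_le.1 h)), if_neg h]
    simp

lemma lint_empirical (φ : ℝ → ℝ) : lint (empirical x b) φ = (∑ i, φ (x i) * b i) / n := by
  rw [lint, empirical, VectorMeasure.integral_finsetSum_vectorMeasure, Finset.sum_div]
  · refine Finset.sum_congr rfl fun i _ => ?_
    rw [VectorMeasure.integral_dirac]
    simp [mul_div_assoc]
  · intro i _
    rw [VectorMeasure.Integrable, VectorMeasure.variation_dirac]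
    exact (integrable_dirac (by simp)).smul_measure (by simp)

/-- Markov's inequality together with subadditivity of the variation. It is used with g = 1 for the
total mass and with g twice a rescaled `bump` for the tails. -/
lemma variation_empirical_le {A : Set ℝ} (hA : MeasurableSet A) {g : ℝ → ℝ} (hg : ∀ y, 0 ≤ g y)
    (hgA : ∀ y ∈ A, 1 ≤ g y) :
    (empirical x b).variation A ≤ ENNReal.ofReal ((∑ i, |(b i : ℝ)| * g (x i)) / n) := by
  refine (VectorMeasure.variation_finsetSum_le Finset.univ
    (fun i => VectorMeasure.dirac (x i) ((b i : ℝ) / n)) A).trans ?_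
  rw [Finset.sum_div, ENNReal.ofReal_sum_of_nonneg fun i _ =>
    div_nonneg (mul_nonneg (abs_nonneg _) (hg _)) (Nat.cast_nonneg n), Measure.finsetSum_apply]
  refine Finset.sum_le_sum fun i _ => ?_
  rw [VectorMeasure.variation_dirac, Measure.smul_apply, Measure.dirac_apply' _ hA, smul_eq_mul]
  by_cases h : x i ∈ A
  · rw [indicator_of_mem h, Pi.one_apply, mul_one, ← ofReal_norm, norm_div, Real.norm_eq_abs,
      Real.norm_natCast]
    refine ENNReal.ofReal_le_ofReal ?_
    gcongr
    exact le_mul_of_one_le_right (abs_nonneg _) (hgA _ h)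
  · rw [indicator_of_notMem h, mul_zero]
    exact zero_le

lemma variation_empirical_univ_le (hb : ∀ i, |b i| ≤ 1) :
    (empirical x b).variation univ ≤ ENNReal.ofReal 1 := by
  refine (variation_empirical_le MeasurableSet.univ (g := fun _ => 1) (fun _ => zero_le_one)
    fun _ _ => le_rfl).trans (ENNReal.ofReal_le_ofReal ?_)
  refine div_le_one_of_le₀ ?_ (Nat.cast_nonneg n)
  refine (Finset.sum_le_card_nsmul _ _ 1 fun i _ => ?_).trans (by simp)
  rw [mul_one]
  exact_mod_cast hb i

/-- The cumulative function of an empirical measure has variation at most one. -/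
lemma eVariationOn_cnt_le (hb : ∀ i, |b i| ≤ 1) :
    eVariationOn (fun y => (cnt x b y : ℝ) / n) univ ≤ ENNReal.ofReal 1 := by
  -- The cumulative function of the absolute charges is nondecreasing and dominates all increments,
  -- so the sums of increments telescope.
  set G : ℝ → ℝ := fun y => (∑ i, if x i ≤ y then |(b i : ℝ)| else 0) / n with hG
  have hstep : ∀ y z, y ≤ z →
      |(cnt x b z : ℝ) / n - (cnt x b y : ℝ) / n| ≤ G z - G y := by
    intro y z hyz
    simp only [hG, cnt]
    rw [← sub_div, ← sub_div, abs_div, Nat.abs_cast]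
    gcongr
    push_cast
    rw [← Finset.sum_sub_distrib, ← Finset.sum_sub_distrib]
    refine (Finset.abs_sum_le_sum_abs _ _).trans (Finset.sum_le_sum fun i _ => ?_)
    by_cases h1 : x i ≤ y
    · simp [h1, h1.trans hyz]
    · by_cases h2 : x i ≤ z <;> simp [h1, h2]
  have hG0 : ∀ y, 0 ≤ G y := fun y => div_nonneg
    (Finset.sum_nonneg fun i _ => by split_ifs <;> positivity) (Nat.cast_nonneg n)
  have hG1 : ∀ y, G y ≤ 1 := fun y => by
    refine div_le_one_of_le₀ ?_ (Nat.cast_nonneg n)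
    refine (Finset.sum_le_card_nsmul _ _ 1 fun i _ => ?_).trans (by simp)
    split_ifs
    · exact_mod_cast hb i
    · exact zero_le_one
  refine iSup_le fun p => ?_
  obtain ⟨N, u, hu, -⟩ := p
  simp only
  calc ∑ k ∈ Finset.range N, edist ((cnt x b (u (k + 1)) : ℝ) / n) ((cnt x b (u k) : ℝ) / n)
      ≤ ∑ k ∈ Finset.range N, ENNReal.ofReal (G (u (k + 1)) - G (u k)) :=
        Finset.sum_le_sum fun k _ => by
          rw [edist_dist, Real.dist_eq]
          exact ENNReal.ofReal_le_ofReal (hstep _ _ (hu k.le_succ))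
    _ = ENNReal.ofReal (G (u N) - G (u 0)) := by
        rw [← ENNReal.ofReal_sum_of_nonneg fun k _ =>
          (abs_nonneg _).trans (hstep _ _ (hu k.le_succ)), Finset.sum_range_sub (fun k => G (u k))]
    _ ≤ _ := ENNReal.ofReal_le_ofReal (by linarith [hG0 (u 0), hG1 (u N)])

end Empirical

/-! ### Convergence of the initial data -/

lemma variation_empirical_compl_le {n : ℕ} {x : Fin n → ℝ} {b : Fin n → ℤ} {R : ℝ} (hR : 0 < R) :
    (empirical x b).variation (Ioc (-R) R)ᶜ
      ≤ ENNReal.ofReal (2 * ((∑ i, |(b i : ℝ)| * bump (x i / R)) / n)) := by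
  refine (variation_empirical_le measurableSet_Ioc.compl (g := fun y => 2 * bump (y / R))
    (fun y => mul_nonneg zero_le_two (bump_nonneg _)) fun y hy => ?_).trans
    (ENNReal.ofReal_le_ofReal (le_of_eq ?_))
  · have h1 : R ≤ |y| := by
      by_contra! h
      exact hy ⟨by linarith [neg_abs_le y], by linarith [le_abs_self y]⟩
    have h2 := half_le_bump (x := y / R) (by rwa [abs_div, abs_of_pos hR, one_le_div hR])
    linarith
  · rw [← mul_div_assoc, Finset.mul_sum Finset.univ]
    congr 1
    exact Finset.sum_congr rfl fun i _ => by ring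

lemma tendsto_lint_of_convergesWith {s : ℕ → ℝ} {ω : ℝ → ℝ} {μ : ℕ → SignedMeasure ℝ}
    {ν : SignedMeasure ℝ} (h : ConvergesWith s ω μ ν) {φ : ℝ → ℝ} (hφ : Continuous φ) {M : ℝ}
    (hM : ∀ x, |φ x| ≤ M) : Tendsto (fun n => lint (μ n) φ) atTop (𝓝 (lint ν φ)) :=
  h.1 (BoundedContinuousFunction.ofNormedAddCommGroup φ hφ M hM)

lemma tendsto_lint_of_tendsto (ν : SignedMeasure ℝ) {φ : ℕ → ℝ → ℝ} {ψ : ℝ → ℝ} {M : ℝ}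
    (hφ : ∀ k, Measurable (φ k)) (hM : ∀ k x, |φ k x| ≤ M)
    (h : ∀ x, Tendsto (fun k => φ k x) atTop (𝓝 (ψ x))) :
    Tendsto (fun k => lint ν (φ k)) atTop (𝓝 (lint ν ψ)) :=
  VectorMeasure.tendsto_integral_of_dominated_convergence (fun _ => M)
    (fun k => (hφ k).aestronglyMeasurable) (integrable_const _) (fun k => ae_of_all _ (hM k))
    (ae_of_all _ h)

/-- A compactly supported test function can be modified far out so that it sees all the charge of
a given configuration there. -/
lemma exists_test_function {n : ℕ} {x : Fin n → ℝ} {b : Fin n → ℤ} (hst : IsState x b) {R : ℝ}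
    {Ψ : ℝ → ℝ} (hΨ : Continuous Ψ) (hΨ1 : ∀ y, |Ψ y| ≤ 1) (hΨ0 : ∀ y, R ≤ |y| → Ψ y = 0) :
    ∃ (Ψ' : ℝ → ℝ) (R' : ℝ), R + 1 ≤ R' ∧ Continuous Ψ' ∧ (∀ y, |Ψ' y| ≤ 1) ∧
      (∀ y, R' ≤ |y| → Ψ' y = 0) ∧ (∀ y, |y| ≤ R → Ψ' y = Ψ y) ∧ (∀ i, |x i| ≤ R') ∧
      lint (empirical x b) Ψ' = lint (empirical x b) Ψ +
        (∑ i, if R < |x i| then |(b i : ℝ)| else 0) / n := by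
  obtain ⟨R', hR', hx'⟩ : ∃ R', R + 1 ≤ R' ∧ ∀ i, |x i| < R' := by
    refine ⟨max (R + 1) (1 + ∑ i, |x i|), le_max_left _ _, fun i => ?_⟩
    have := Finset.single_le_sum (f := fun i => |x i|) (fun i _ => abs_nonneg _)
      (Finset.mem_univ i)
    exact lt_of_lt_of_le (by linarith) (le_max_right _ _)
  set A : ℤ → Set ℝ := fun c => x '' {i | b i = c ∧ R < |x i|} with hA
  have hAf : ∀ c, IsClosed (A c) := fun c => ((Set.toFinite _).image _).isClosed
  set Z : Set ℝ := {y | |y| ≤ R} ∪ {y | R' ≤ |y|} with hZ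
  have hZc : IsClosed Z := (isClosed_le continuous_abs continuous_const).union
    (isClosed_le continuous_const continuous_abs)
  have hdisj : ∀ c d : ℤ, c ≠ 0 → d ≠ 0 → c ≠ d → Disjoint (Z ∪ A d) (A c) := by
    intro c d hc hd hcd
    refine disjoint_left.2 ?_
    rintro _ h1 ⟨i, ⟨hi1, hi2⟩, rfl⟩
    rcases h1 with (h1 | h1) | ⟨j, ⟨hj1, hj2⟩, hj⟩
    · exact absurd hi2 (not_lt.2 h1)
    · exact absurd (hx' i) (not_lt.2 h1)
    · have hij : j ≠ i := by
        rintro rfl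
        exact hcd (hi1.symm.trans hj1)
      exact hst.ne hij (by rwa [hj1]) (by rwa [hi1]) hj
  -- Charged particles occupy distinct points, so the finite sets of far positive and far negative
  -- ones can be separated. The difference p - q equals the charge at each far charged particle and
  -- vanishes for |y| ≤ R and |y| ≥ R'.
  obtain ⟨p, hp0, hp1, hp⟩ := exists_continuous_zero_one_of_isClosed (hZc.union (hAf (-1))) (hAf 1)
    (hdisj 1 (-1) (by norm_num) (by norm_num) (by norm_num))
  obtain ⟨q, hq0, hq1, hq⟩ := exists_continuous_zero_one_of_isClosed (hZc.union (hAf 1)) (hAf (-1))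
    (hdisj (-1) 1 (by norm_num) (by norm_num) (by norm_num))
  have hpZ : ∀ y ∈ Z, p y = 0 := fun y hy => hp0 (Or.inl hy)
  have hqZ : ∀ y ∈ Z, q y = 0 := fun y hy => hq0 (Or.inl hy)
  refine ⟨fun y => Ψ y + (p y - q y), R', hR', by fun_prop, fun y => ?_, fun y hy => ?_,
    fun y hy => ?_, fun i => (hx' i).le, ?_⟩
  · beta_reduce
    rcases le_total |y| R with hy | hy
    · rw [hpZ y (Or.inl hy), hqZ y (Or.inl hy)]
      simpa using hΨ1 y
    · rw [hΨ0 y hy, zero_add, abs_le]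
      constructor <;> linarith [(hp y).1, (hp y).2, (hq y).1, (hq y).2]
  · beta_reduce
    rw [hΨ0 y (by linarith), hpZ y (Or.inr hy), hqZ y (Or.inr hy)]
    simp
  · beta_reduce
    rw [hpZ y (Or.inl hy), hqZ y (Or.inl hy)]
    simp
  · rw [lint_empirical, lint_empirical, ← add_div, ← Finset.sum_add_distrib]
    congr 1
    refine Finset.sum_congr rfl fun i _ => ?_
    rw [add_mul]
    congr 1
    split_ifs with h
    · rcases hst.1 i with hi | hi | hi
      · have hm : x i ∈ A (-1) := ⟨i, ⟨hi, h⟩, rfl⟩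
        rw [hp0 (Or.inr hm), hq1 hm, hi]
        simp
      · simp [hi]
      · have hm : x i ∈ A 1 := ⟨i, ⟨hi, h⟩, rfl⟩
        rw [hq0 (Or.inr hm), hp1 hm, hi]
        simp
    · rw [hpZ _ (Or.inl (not_lt.1 h)), hqZ _ (Or.inl (not_lt.1 h))]
      simp

section Tightness

variable {x : (n : ℕ) → Fin n → ℝ} {b : (n : ℕ) → Fin n → ℤ}

/-- A narrowly convergent sequence of empirical measures of charged configurations does not lose
mass at infinity (gliding hump). -/
theorem exists_charge_tail_le (hst : ∀ n ≥ 2, IsState (x n) (b n)) {κ : SignedMeasure ℝ}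
    (hlim : ∀ φ : ℝ → ℝ, Continuous φ → (∀ y, |φ y| ≤ 1) →
      Tendsto (fun n => lint (empirical (x n) (b n)) φ) atTop (𝓝 (lint κ φ))) {e : ℝ} (he : 0 < e) :
    ∃ R, ∀ n ≥ 2, (∑ i, if R < |x n i| then |(b n i : ℝ)| else 0) / n ≤ e := by
  by_contra! hcon
  -- The particles of finitely many configurations lie in a bounded set, so failure for all R
  -- produces bad indices n beyond any N.
  have htail : ∀ (R : ℝ) (N : ℕ), ∃ n ≥ N, 2 ≤ n ∧
      e < (∑ i, if R < |x n i| then |(b n i : ℝ)| else 0) / n := by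
    intro R N
    set r : ℕ → ℝ := fun m => ∑ i, |x m i| with hr
    have hr0 : ∀ m, 0 ≤ r m := fun m => Finset.sum_nonneg fun i _ => abs_nonneg _
    obtain ⟨n, hn, hne⟩ := hcon (max R (∑ m ∈ Finset.range N, r m))
    have hnN : N ≤ n := by
      by_contra! hlt
      have h1 : r n ≤ ∑ m ∈ Finset.range N, r m :=
        Finset.single_le_sum (fun m _ => hr0 m) (Finset.mem_range.2 hlt)
      rw [Finset.sum_eq_zero fun i _ => if_neg (not_lt.2 ?_), zero_div] at hne
      · linarith
      · exact (Finset.single_le_sum (f := fun i => |x n i|) (fun i _ => abs_nonneg _)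
          (Finset.mem_univ i)).trans (h1.trans (le_max_right _ _))
    refine ⟨n, hnN, hn, hne.trans_le ?_⟩
    gcongr with i
    split_ifs with h1 h2 h2
    · exact le_rfl
    · exact absurd ((le_max_left _ _).trans_lt h1) h2
    · exact abs_nonneg _
    · exact le_rfl
  let P : (ℝ → ℝ) × ℝ × ℕ → Prop := fun p =>
    Continuous p.1 ∧ (∀ y, |p.1 y| ≤ 1) ∧ ∀ y, p.2.1 ≤ |y| → p.1 y = 0
  -- One step of the hump: for large n the old function already integrates to at least its limit
  -- minus e / 2, and the modification far out adds more than e.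
  have hstep : ∀ p : {p // P p}, ∃ p' : {p // P p}, p.1.2.1 + 1 ≤ p'.1.2.1 ∧
      p.1.2.2 < p'.1.2.2 ∧ (∀ y, |y| ≤ p.1.2.1 → p'.1.1 y = p.1.1 y) ∧
      (∀ i, |x p'.1.2.2 i| ≤ p'.1.2.1) ∧
      lint κ p.1.1 + e / 2 ≤ lint (empirical (x p'.1.2.2) (b p'.1.2.2)) p'.1.1 := by
    rintro ⟨⟨Ψ, R, N⟩, h1, h2, h3⟩
    obtain ⟨N', hN'⟩ := eventually_atTop.1
      ((tendsto_order.1 (hlim Ψ h1 h2)).1 (lint κ Ψ - e / 2) (by linarith))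
    obtain ⟨n, hn1, hn2, hne⟩ := htail R (max N' (N + 1))
    obtain ⟨Ψ', R', h4, h5, h6, h7, h8, h9, h10⟩ := exists_test_function (hst n hn2) h1 h2 h3
    refine ⟨⟨⟨Ψ', R', n⟩, h5, h6, h7⟩, h4, ?_, h8, h9, ?_⟩
    · exact (le_max_right N' (N + 1)).trans hn1
    · have := hN' n ((le_max_left _ _).trans hn1)
      simp only
      linarith
  choose nx hnx1 hnx2 hnx3 hnx4 hnx5 using hstep
  let p : ℕ → {p // P p} := fun k => nx^[k] ⟨⟨0, 0, 0⟩, continuous_const, by simp, by simp⟩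
  have hp : ∀ k, p (k + 1) = nx (p k) := fun k => Function.iterate_succ_apply' _ _ _
  set Ψ : ℕ → ℝ → ℝ := fun k => (p k).1.1 with hΨ
  set R : ℕ → ℝ := fun k => (p k).1.2.1 with hR
  set N : ℕ → ℕ := fun k => (p k).1.2.2 with hN
  have hR1 : ∀ k, R k + 1 ≤ R (k + 1) := fun k => by
    have := hnx1 (p k)
    rwa [← hp] at this
  have hN1 : StrictMono N := strictMono_nat_of_lt_succ fun k => by
    have := hnx2 (p k)
    rwa [← hp] at this
  have hΨ3 : ∀ k y, |y| ≤ R k → Ψ (k + 1) y = Ψ k y := fun k => by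
    have := hnx3 (p k)
    rwa [← hp] at this
  have hx4 : ∀ k i, |x (N (k + 1)) i| ≤ R (k + 1) := fun k => by
    have := hnx4 (p k)
    rwa [← hp] at this
  have hl5 : ∀ k, lint κ (Ψ k) + e / 2 ≤
      lint (empirical (x (N (k + 1))) (b (N (k + 1)))) (Ψ (k + 1)) := fun k => by
    have := hnx5 (p k)
    rwa [← hp] at this
  have hRm : Monotone R := monotone_nat_of_le_succ fun k => by linarith [hR1 k]
  have hRk : ∀ k : ℕ, (k : ℝ) ≤ R k := by
    intro k
    induction k with
    | zero => exact_mod_cast le_rfl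
    | succ k ih =>
      push_cast
      linarith [hR1 k]
  have hstab : ∀ k m, k ≤ m → ∀ y, |y| ≤ R k → Ψ m y = Ψ k y := by
    intro k m hkm y hy
    induction m, hkm using Nat.le_induction with
    | base => rfl
    | succ m hkm ih => rw [hΨ3 m y (hy.trans (hRm hkm)), ih]
  -- The functions stabilize on each bounded interval because R k ≥ k, so φ is their locally
  -- eventually constant limit.
  set φ : ℝ → ℝ := fun y => Ψ ⌈|y|⌉₊ y with hφ
  have hφk : ∀ k y, |y| ≤ R k → φ y = Ψ k y := by
    intro k y hy
    have h1 : |y| ≤ R ⌈|y|⌉₊ := (Nat.le_ceil _).trans (hRk _)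
    rw [hφ]
    simp only
    rw [← hstab _ (max k ⌈|y|⌉₊) (le_max_right _ _) y h1, hstab k _ (le_max_left _ _) y hy]
  have hφc : Continuous φ := by
    refine continuous_iff_continuousAt.2 fun y => ?_
    obtain ⟨k, hk⟩ := exists_nat_gt |y|
    refine ((p k).2.1.continuousAt (x := y)).congr ?_
    filter_upwards [(continuous_abs.tendsto y).eventually_lt_const hk] with z hz
    exact (hφk k z (hz.le.trans (hRk k))).symm
  have hφ1 : ∀ y, |φ y| ≤ 1 := fun y => (p ⌈|y|⌉₊).2.2.1 y
  have hlimΨ : Tendsto (fun k => lint κ (Ψ k)) atTop (𝓝 (lint κ φ)) := by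
    refine tendsto_lint_of_tendsto κ (M := 1) (fun k => (p k).2.1.measurable)
      (fun k => (p k).2.2.1) fun y => ?_
    refine tendsto_const_nhds.congr' ?_
    filter_upwards [eventually_ge_atTop ⌈|y|⌉₊] with k hk
    exact hφk k y ((Nat.le_ceil _).trans ((Nat.cast_le.2 hk).trans (hRk k)))
  have hlimφ := (hlim φ hφc hφ1).comp (hN1.tendsto_atTop.comp (tendsto_add_atTop_nat 1))
  -- The configuration N (k + 1) lies where φ and Ψ (k + 1) coincide, so the gain of e / 2 persists
  -- in the limit, whereas Ψ k converges to φ boundedly under κ.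
  have hle : lint κ φ + e / 2 ≤ lint κ φ := by
    refine le_of_tendsto_of_tendsto' (hlimΨ.add_const _) hlimφ fun k => (hl5 k).trans (le_of_eq ?_)
    simp only [Function.comp_apply]
    rw [lint_empirical, lint_empirical]
    congr 1
    exact Finset.sum_congr rfl fun i _ => by rw [hφk (k + 1) _ (hx4 k i)]
  linarith

/-- Uniform smallness of the moments of a narrowly convergent sequence of empirical measures. -/
theorem exists_moment_le (hst : ∀ n ≥ 2, IsState (x n) (b n)) {κ : SignedMeasure ℝ}
    (hlim : ∀ φ : ℝ → ℝ, Continuous φ → (∀ y, |φ y| ≤ 1) →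
      Tendsto (fun n => lint (empirical (x n) (b n)) φ) atTop (𝓝 (lint κ φ))) {e : ℝ} (he : 0 < e) :
    ∃ R₀ > 0, ∀ R ≥ R₀, ∀ n ≥ 2, (∑ i, |(b n i : ℝ)| * bump (x n i / R)) / n ≤ e := by
  obtain ⟨M₀, hM₀⟩ := exists_charge_tail_le hst hlim (half_pos he)
  set M := max M₀ 1 with hM
  have hM1 : 0 < M := one_pos.trans_le (le_max_right _ _)
  -- This makes (M / R)² at most e / 2, which bounds the rescaled bump on [-M, M]; the charge
  -- outside is at most e / 2 by the tail estimate.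
  refine ⟨M * (1 + 2 / e), by positivity, fun R hR n hn => ?_⟩
  have hn0 : (0 : ℝ) < n := by exact_mod_cast (by omega : 0 < n)
  have hR0 : 0 < R := lt_of_lt_of_le (by positivity) hR
  have hMR : (M / R) ^ 2 ≤ e / 2 := by
    have h1 : M / R ≤ 1 / (1 + 2 / e) := by
      rw [div_le_div_iff₀ hR0 (by positivity)]
      linarith
    have h2 : 1 / (1 + 2 / e) ≤ e / 2 := by
      rw [div_le_iff₀ (by positivity)]
      field_simp
      linarith
    have h3 : 1 / (1 + 2 / e) ≤ 1 := by
      rw [div_le_one (by positivity)]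
      linarith [show (0 : ℝ) < 2 / e by positivity]
    have h4 : 0 ≤ M / R := by positivity
    nlinarith
  have hterm : ∀ i, |(b n i : ℝ)| * bump (x n i / R) ≤
      e / 2 + if M₀ < |x n i| then |(b n i : ℝ)| else 0 := by
    intro i
    have hb1 : |(b n i : ℝ)| ≤ 1 := by exact_mod_cast (hst n hn).abs_le i
    have hbu := bump_nonneg (x n i / R)
    split_ifs with h
    · have := mul_le_of_le_one_right (abs_nonneg (b n i : ℝ)) (bump_le_one (x n i / R))
      linarith
    · rw [add_zero]
      refine (mul_le_of_le_one_left hbu hb1).trans ((bump_le_sq _).trans (le_trans ?_ hMR))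
      rw [← sq_abs, abs_div, abs_of_pos hR0]
      gcongr
      exact (not_lt.1 h).trans (le_max_left _ _)
  calc (∑ i, |(b n i : ℝ)| * bump (x n i / R)) / n
      ≤ (∑ i : Fin n, (e / 2 + if M₀ < |x n i| then |(b n i : ℝ)| else 0)) / n := by
        gcongr with i
        exact hterm i
    _ = e / 2 + (∑ i, if M₀ < |x n i| then |(b n i : ℝ)| else 0) / n := by
        rw [Finset.sum_add_distrib, add_div]
        congr 1
        simp
        field_simp
    _ ≤ e := by linarith [hM₀ n hn]

end Tightness

/-! ### Convergence of the cumulative functions -/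

/-- Averaging the step functions over (y, y + δ] produces a continuous bounded test function, to
which narrow convergence applies. -/
lemma integral_cnt_shift {n : ℕ} {x : Fin n → ℝ} {b : Fin n → ℤ} {y δ : ℝ} :
    ∫ s in Ioc 0 δ, (cnt x b (y + s) : ℝ) / n =
      lint (empirical x b) fun z => max 0 (δ - max 0 (z - y)) := by
  have h1 : ∀ s, (cnt x b (y + s) : ℝ) / n =
      ∑ i, (Ici (x i - y)).indicator (fun _ => (b i : ℝ) / n) s := by
    intro s
    rw [cnt, Int.cast_sum, Finset.sum_div]
    refine Finset.sum_congr rfl fun i _ => ?_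
    by_cases h : x i ≤ y + s
    · rw [if_pos h, indicator_of_mem (mem_Ici.2 (by linarith))]
    · rw [if_neg h, indicator_of_notMem (notMem_Ici.2 (by linarith [not_le.1 h]))]
      simp
  simp_rw [h1]
  rw [integral_finsetSum _ fun i _ => (integrable_const _).indicator measurableSet_Ici,
    lint_empirical, Finset.sum_div]
  refine Finset.sum_congr rfl fun i _ => ?_
  rw [integral_indicator_const _ measurableSet_Ici, smul_eq_mul, mul_div_assoc]
  congr 1
  rw [measureReal_restrict_apply measurableSet_Ici, max_comm, ← Real.volume_real_Ioc]
  refine measureReal_congr ?_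
  have h2 : Ici (x i - y) ∩ Ioc 0 δ ⊆ Icc (max 0 (x i - y)) δ := fun s hs =>
    ⟨max_le hs.2.1.le hs.1, hs.2.2⟩
  have h3 : Ioc (max 0 (x i - y)) δ ⊆ Ici (x i - y) ∩ Ioc 0 δ := fun s hs =>
    ⟨(le_max_right _ _).trans hs.1.le, (le_max_left _ _).trans_lt hs.1, hs.2⟩
  exact ((LE.le.eventuallyLE h2).trans Ioc_ae_eq_Icc.symm.le).antisymm
    (LE.le.eventuallyLE h3)

lemma lint_indicator_Iic (κ : SignedMeasure ℝ) (y : ℝ) :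
    lint κ ((Iic y).indicator fun _ => 1) = κ (Iic y) := by
  rw [lint, VectorMeasure.integral_indicator_const _ measurableSet_Iic]
  simp

section Cumulative

variable {x : (n : ℕ) → Fin n → ℝ} {b : (n : ℕ) → Fin n → ℤ} {κ : SignedMeasure ℝ} {s : ℕ → ℝ}
  {ω : ℝ → ℝ}

lemma ConvergesWith.abs_cnt_sub_le
    (h : ConvergesWith s ω (fun n => empirical (x n) (b n)) κ) {n : ℕ} (hn : 2 ≤ n) (y z : ℝ) :
    |(cnt (x n) (b n) z : ℝ) / n - (cnt (x n) (b n) y : ℝ) / n| ≤ s n + ω |y - z| := by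
  rcases le_total y z with hyz | hyz
  · have := h.2.2 n hn y z hyz
    rwa [signedMeasure_Ioc _ hyz, empirical_Iic, empirical_Iic] at this
  · have := h.2.2 n hn z y hyz
    rwa [signedMeasure_Ioc _ hyz, empirical_Iic, empirical_Iic, abs_sub_comm, abs_sub_comm z]
      at this

lemma IsModulus.exists_le (hω : IsModulus ω) {e : ℝ} (he : 0 < e) :
    ∃ δ > 0, ∀ r, 0 ≤ r → r ≤ δ → ω r ≤ e := by
  obtain ⟨δ, hδ, h⟩ := Metric.continuousWithinAt_iff.1 hω.2.2 e he
  refine ⟨δ / 2, half_pos hδ, fun r hr hrδ => ?_⟩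
  have := h (mem_Ici.2 hr) (by rw [Real.dist_eq, sub_zero, abs_of_nonneg hr]; linarith)
  rw [hω.2.1, Real.dist_eq, sub_zero] at this
  exact (le_abs_self _).trans this.le

/-- The cumulative functions of a convergent sequence converge pointwise. -/
lemma ConvergesWith.tendsto_cnt (h : ConvergesWith s ω (fun n => empirical (x n) (b n)) κ)
    (hs : Tendsto s atTop (𝓝 0)) (hω : IsModulus ω) (y : ℝ) :
    Tendsto (fun n => (cnt (x n) (b n) y : ℝ) / n) atTop (𝓝 (κ (Iic y))) := by
  set φ : ℝ → ℝ → ℝ := fun δ z => max 0 (δ - max 0 (z - y)) with hφ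
  have hφc : ∀ δ, Continuous (φ δ) := fun δ => by fun_prop
  have hφ1 : ∀ δ ≥ 0, ∀ z, |φ δ z| ≤ δ := fun δ hδ z => by
    simp only [hφ]
    rw [abs_of_nonneg (le_max_left _ _)]
    exact max_le hδ (by linarith [le_max_left 0 (z - y)])
  -- By equicontinuity the average over (y, y + δ] differs from the value at y by at most s n + ω δ.
  have hcmp : ∀ δ > 0, ∀ n ≥ 2, |lint (empirical (x n) (b n)) (φ δ) -
      δ * ((cnt (x n) (b n) y : ℝ) / n)| ≤ (s n + ω δ) * δ := by
    intro δ hδ n hn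
    have hmeas : Measurable fun r => (cnt (x n) (b n) (y + r) : ℝ) / n :=
      (measurable_from_top.comp (measurable_cnt.comp (measurable_const_add y))).div_const _
    have hint : IntegrableOn (fun r => (cnt (x n) (b n) (y + r) : ℝ) / n) (Ioc 0 δ) := by
      refine Integrable.of_bound hmeas.aestronglyMeasurable ((∑ i, |(b n i : ℝ)|) / n)
        (ae_of_all _ fun r => ?_)
      rw [norm_div, Real.norm_eq_abs, Real.norm_natCast, cnt, Int.cast_sum]
      gcongr
      refine (Finset.abs_sum_le_sum_abs _ _).trans (Finset.sum_le_sum fun i _ => ?_)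
      split_ifs <;> simp
    have h1 : lint (empirical (x n) (b n)) (φ δ) - δ * ((cnt (x n) (b n) y : ℝ) / n) =
        ∫ r in Ioc 0 δ, ((cnt (x n) (b n) (y + r) : ℝ) / n - (cnt (x n) (b n) y : ℝ) / n) := by
      rw [integral_sub hint (integrable_const _), integral_cnt_shift, setIntegral_const,
        Real.volume_real_Ioc, sub_zero, max_eq_left hδ.le, smul_eq_mul]
    rw [h1, ← Real.norm_eq_abs]
    refine (norm_setIntegral_le_of_norm_le_const (C := s n + ω δ) (by simp) fun r hr => ?_).trans
      (by simp [hδ.le])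
    refine (h.abs_cnt_sub_le hn y (y + r)).trans ?_
    have h2 : |y - (y + r)| = r := by rw [sub_add_cancel_left, abs_neg, abs_of_pos hr.1]
    rw [h2]
    linarith [hω.1 hr.1.le hδ.le hr.2]
  have hκ : Tendsto (fun k : ℕ => lint κ (fun z => (1 / ((k : ℝ) + 1))⁻¹ * φ (1 / ((k : ℝ) + 1)) z))
      atTop (𝓝 (κ (Iic y))) := by
    rw [← lint_indicator_Iic]
    refine tendsto_lint_of_tendsto κ (M := 1) (fun k => by fun_prop) (fun k z => ?_) fun z => ?_
    · have hk : (0 : ℝ) < 1 / (k + 1) := by positivity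
      rw [abs_mul, abs_of_pos (inv_pos.2 hk), inv_mul_le_one₀ hk]
      exact hφ1 _ hk.le z
    · rcases le_or_gt z y with hz | hz
      · rw [indicator_of_mem (mem_Iic.2 hz)]
        refine tendsto_const_nhds.congr fun k => ?_
        have hk : (0 : ℝ) < 1 / (k + 1) := by positivity
        simp only [hφ]
        rw [max_eq_left (by linarith : z - y ≤ 0), sub_zero, max_eq_right hk.le,
          inv_mul_cancel₀ hk.ne']
      · rw [indicator_of_notMem (notMem_Iic.2 hz)]
        refine tendsto_const_nhds.congr' ?_
        filter_upwards [(tendsto_one_div_add_atTop_nhds_zero_nat (𝕜 := ℝ)).eventually_lt_const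
          (sub_pos.2 hz)] with k hk
        simp only [hφ]
        rw [max_eq_right (sub_pos.2 hz).le, max_eq_left (by linarith), mul_zero]
  refine Metric.tendsto_nhds.2 fun e he => ?_
  obtain ⟨d, hd, hωd⟩ := hω.exists_le (e := e / 4) (by positivity)
  obtain ⟨k, hk1, hk2⟩ := ((Metric.tendsto_nhds.1 hκ (e / 4) (by positivity)).and
    ((tendsto_one_div_add_atTop_nhds_zero_nat (𝕜 := ℝ)).eventually_lt_const hd)).exists
  set δ : ℝ := 1 / ((k : ℝ) + 1) with hδ
  have hδ0 : 0 < δ := by positivity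
  have hlin : ∀ ν : SignedMeasure ℝ, lint ν (fun z => δ⁻¹ * φ δ z) = δ⁻¹ * lint ν (φ δ) :=
    fun ν => VectorMeasure.integral_fun_smul _ _ _ _
  have hlim := (tendsto_lint_of_convergesWith h (hφc δ) (hφ1 δ hδ0.le)).const_mul δ⁻¹
  rw [hlin] at hk1
  filter_upwards [Metric.tendsto_nhds.1 hlim (e / 4) (by positivity),
    hs.eventually_lt_const (show (0 : ℝ) < e / 4 by positivity), eventually_ge_atTop 2]
    with n hn1 hn2 hn3
  have h3 := hcmp δ hδ0 n hn3
  have h4 : |δ⁻¹ * lint (empirical (x n) (b n)) (φ δ) - (cnt (x n) (b n) y : ℝ) / n|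
      ≤ s n + ω δ := by
    have h5 : δ⁻¹ * lint (empirical (x n) (b n)) (φ δ) - (cnt (x n) (b n) y : ℝ) / n =
        δ⁻¹ * (lint (empirical (x n) (b n)) (φ δ) - δ * ((cnt (x n) (b n) y : ℝ) / n)) := by
      rw [mul_sub, ← mul_assoc δ⁻¹ δ, inv_mul_cancel₀ hδ0.ne', one_mul]
    rw [h5, abs_mul, abs_of_pos (inv_pos.2 hδ0), inv_mul_le_iff₀ hδ0]
    linarith
  have h6 := hωd δ hδ0.le hk2.le
  rw [Real.dist_eq] at hn1 hk1 ⊢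
  rw [abs_lt] at hn1 hk1 ⊢
  rw [abs_le] at h4
  constructor <;> linarith [hn1.1, hn1.2, hk1.1, hk1.2, h4.1, h4.2]

lemma ConvergesWith.abs_sub_le (h : ConvergesWith s ω (fun n => empirical (x n) (b n)) κ)
    (hs : Tendsto s atTop (𝓝 0)) (hω : IsModulus ω) (y z : ℝ) :
    |κ (Iic z) - κ (Iic y)| ≤ ω |y - z| := by
  have h1 := ((h.tendsto_cnt hs hω z).sub (h.tendsto_cnt hs hω y)).abs
  have h2 : Tendsto (fun n => s n + ω |y - z|) atTop (𝓝 (0 + ω |y - z|)) := hs.add_const _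
  rw [zero_add] at h2
  refine le_of_tendsto_of_tendsto h1 h2 ?_
  filter_upwards [eventually_ge_atTop 2] with n hn
  exact h.abs_cnt_sub_le hn y z

/-- The cumulative function of the limit is bounded and uniformly continuous. -/
lemma ConvergesWith.isBUC (h : ConvergesWith s ω (fun n => empirical (x n) (b n)) κ)
    (hs : Tendsto s atTop (𝓝 0)) (hω : IsModulus ω) :
    ∃ B > 0, IsBUC B (fun y => κ (Iic y)) := by
  refine ⟨κ.variation.real univ + 1, by positivity, ⟨fun y => ?_, fun e he => ?_⟩⟩
  · have h1 : κ.variation univ ≤ ENNReal.ofReal (κ.variation.real univ) := by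
      rw [Measure.real, ENNReal.ofReal_toReal (measure_ne_top _ _)]
    have := abs_signedMeasure_le κ measureReal_nonneg (subset_univ (Iic y)) h1
    linarith
  · obtain ⟨δ, hδ, h1⟩ := hω.exists_le he
    refine ⟨δ, hδ, fun a ha y => (h.abs_sub_le hs hω y (y + a)).trans ?_⟩
    rw [sub_add_cancel_left, abs_neg]
    exact h1 _ (abs_nonneg _) ha

/-- The cumulative functions of a convergent sequence converge uniformly. -/
theorem ConvergesWith.eventually_abs_cnt_sub_le
    (h : ConvergesWith s ω (fun n => empirical (x n) (b n)) κ)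
    (hst : ∀ n ≥ 2, IsState (x n) (b n))
    (hs : Tendsto s atTop (𝓝 0)) (hω : IsModulus ω) {d : ℝ} (hd : 0 < d) :
    ∀ᶠ n in atTop, ∀ y, |(cnt (x n) (b n) y : ℝ) / n - κ (Iic y)| ≤ d := by
  have hd4 : 0 < d / 4 := by positivity
  obtain ⟨R₁, hR₁⟩ := exists_variation_compl_le κ hd4
  obtain ⟨R₂, hR₂, htail⟩ := exists_moment_le hst
    (fun φ hφ hφ1 => tendsto_lint_of_convergesWith h hφ hφ1) (show 0 < d / 8 by positivity)
  set R := max R₁ R₂ with hR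
  have hR0 : 0 < R := hR₂.trans_le (le_max_right _ _)
  have hκ := hR₁ R (le_max_left _ _)
  have hμ : ∀ n ≥ 2, (empirical (x n) (b n)).variation (Ioc (-R) R)ᶜ ≤ ENNReal.ofReal (d / 4) :=
    fun n hn => (variation_empirical_compl_le hR0).trans
      (ENNReal.ofReal_le_ofReal (by linarith [htail R (le_max_right _ _) n hn]))
  have hcomp : ∀ᶠ n in atTop, ∀ y ∈ Icc (-R) R,
      |(cnt (x n) (b n) y : ℝ) / n - κ (Iic y)| ≤ d / 2 := by
    obtain ⟨δ, hδ, hωδ⟩ := hω.exists_le (show 0 < d / 8 by positivity)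
    -- Convergence at one centre spreads to a δ-ball through the common modulus of the sequence and
    -- the limit; finitely many balls suffice.
    refine isCompact_Icc.induction_on (p := fun A => ∀ᶠ n in atTop, ∀ y ∈ A,
      |(cnt (x n) (b n) y : ℝ) / n - κ (Iic y)| ≤ d / 2) (by simp)
      (fun A A' hAA' hA' => hA'.mono fun n hn y hy => hn y (hAA' hy))
      (fun A A' hA hA' => by
        filter_upwards [hA, hA'] with n hn hn' y hy
        exact hy.elim (hn y) (hn' y)) fun y₀ _ => ?_
    refine ⟨Metric.closedBall y₀ δ, mem_nhdsWithin_of_mem_nhds (Metric.closedBall_mem_nhds _ hδ),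
      ?_⟩
    filter_upwards [eventually_ge_atTop 2,
      hs.eventually_lt_const (show (0 : ℝ) < d / 8 by positivity),
      Metric.tendsto_nhds.1 (h.tendsto_cnt hs hω y₀) (d / 8) (by positivity)]
      with n hn hsn hn0 y hy
    have h1 : ω |y₀ - y| ≤ d / 8 := hωδ _ (abs_nonneg _) (by
      rw [abs_sub_comm]
      exact hy)
    have h2 := h.abs_cnt_sub_le hn y₀ y
    have h3 := h.abs_sub_le hs hω y₀ y
    rw [Real.dist_eq] at hn0
    rw [abs_lt] at hn0
    rw [abs_le] at h2 h3 ⊢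
    constructor <;> linarith [hn0.1, hn0.2, h2.1, h2.2, h3.1, h3.2]
  filter_upwards [hcomp, eventually_ge_atTop 2] with n hn hn2 y
  rcases le_total y (-R) with hy | hy
  · have hsub : Iic y ⊆ (Ioc (-R) R)ᶜ := fun z hz hz' =>
      absurd hz'.1 (not_lt.2 ((mem_Iic.1 hz).trans hy))
    have h1 := abs_signedMeasure_le _ hd4.le hsub hκ
    have h2 := abs_signedMeasure_le _ hd4.le hsub (hμ n hn2)
    rw [empirical_Iic] at h2
    exact (abs_sub _ _).trans (by linarith)
  rcases le_total y R with hyR | hyR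
  · exact (hn y ⟨hy, hyR⟩).trans (by linarith)
  · have hsub : Ioc R y ⊆ (Ioc (-R) R)ᶜ := fun z hz hz' => absurd hz'.2 (not_le.2 hz.1)
    have h1 := abs_signedMeasure_le _ hd4.le hsub hκ
    have h2 := abs_signedMeasure_le _ hd4.le hsub (hμ n hn2)
    have h3 := hn R ⟨by linarith, le_rfl⟩
    rw [signedMeasure_Ioc _ hyR] at h1 h2
    rw [empirical_Iic, empirical_Iic] at h2
    rw [abs_le] at h1 h2 h3 ⊢
    constructor <;> linarith [h1.1, h1.2, h2.1, h2.2, h3.1, h3.2]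

end Cumulative

/-! ### Uniform data for the limit -/

/-- Eventual uniform smallness is witnessed by a null sequence. -/
lemma exists_null_sequence {ι : Type*} (g : ℕ → ι → ℝ) (hbd : ∀ n ≥ 2, ∃ C, ∀ i, |g n i| ≤ C)
    (h : ∀ e > 0, ∀ᶠ n in atTop, ∀ i, |g n i| ≤ e) :
    ∃ s : ℕ → ℝ, Tendsto s atTop (𝓝 0) ∧ ∀ n ≥ 2, ∀ i, |g n i| ≤ s n := by
  -- The assumption `hbd` matters: the real supremum of an unbounded family is 0 by default and
  -- would dominate nothing.
  refine ⟨fun n => ⨆ i, |g n i|, ?_, fun n hn i => ?_⟩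
  · refine Metric.tendsto_nhds.2 fun e he => ?_
    filter_upwards [h (e / 2) (half_pos he)] with n hn
    rw [Real.dist_eq, sub_zero, abs_of_nonneg (Real.iSup_nonneg fun i => abs_nonneg _)]
    exact (Real.iSup_le hn (half_pos he).le).trans_lt (half_lt_self he)
  · obtain ⟨C, hC⟩ := hbd n hn
    exact le_ciSup (f := fun i => |g n i|) ⟨C, by rintro _ ⟨j, rfl⟩; exact hC j⟩ i

lemma HasModulus.exists_isModulus {W : ℝ × ℝ → ℝ} (hW : HasModulus W) {B : ℝ}
    (hB : ∀ p, |W p| ≤ B) :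
    ∃ ω, IsModulus ω ∧ ∀ t ≥ 0, ∀ y z, |W (t, z) - W (t, y)| ≤ ω |y - z| := by
  set A : ℝ → Set ℝ := fun δ =>
    {r | ∃ t y z, 0 ≤ t ∧ |y - z| ≤ δ ∧ r = |W (t, z) - W (t, y)|} with hA
  have hbd : ∀ δ, BddAbove (A δ) := fun δ => ⟨B + B, by
    rintro _ ⟨t, y, z, -, -, rfl⟩
    exact (abs_sub _ _).trans (add_le_add (hB _) (hB _))⟩
  have hle : ∀ t ≥ 0, ∀ y z, |W (t, z) - W (t, y)| ≤ sSup (A |y - z|) :=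
    fun t ht y z => le_csSup (hbd _) ⟨t, y, z, ht, le_rfl, rfl⟩
  have hmem : ∀ δ ≥ 0, (0 : ℝ) ∈ A δ := fun δ hδ => ⟨0, 0, 0, le_rfl, by simpa using hδ, by simp⟩
  have hzero : sSup (A 0) = 0 := by
    refine le_antisymm (csSup_le ⟨0, hmem 0 le_rfl⟩ ?_) (le_csSup (hbd 0) (hmem 0 le_rfl))
    rintro _ ⟨t, y, z, -, hyz, rfl⟩
    have : y = z := sub_eq_zero.1 (abs_nonpos_iff.1 hyz)
    simp [this]
  refine ⟨fun δ => sSup (A δ), ⟨fun δ hδ δ' hδ' h => ?_, hzero, ?_⟩, hle⟩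
  · refine csSup_le_csSup (hbd _) ⟨0, hmem δ hδ⟩ ?_
    rintro _ ⟨t, y, z, ht, hyz, rfl⟩
    exact ⟨t, y, z, ht, hyz.trans h, rfl⟩
  · refine Metric.continuousWithinAt_iff.2 fun e he => ?_
    obtain ⟨δ, hδ, hWδ⟩ := hW (e / 2) (half_pos he)
    refine ⟨δ, hδ, fun r hr hrδ => ?_⟩
    rw [Real.dist_eq, sub_zero, abs_of_nonneg hr] at hrδ
    rw [Real.dist_eq, hzero, sub_zero, abs_of_nonneg (le_csSup (hbd r) (hmem r hr))]
    refine (csSup_le ⟨0, hmem r hr⟩ ?_).trans_lt (half_lt_self he)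
    rintro _ ⟨t, y, z, ht, hyz, rfl⟩
    refine hWδ _ _ ht ht (by simpa using hδ.le) ?_
    rw [abs_sub_comm]
    exact hyz.trans hrδ.le

section Limit

variable {T : ℝ} {x₀ : (n : ℕ) → Fin n → ℝ} {b₀ : (n : ℕ) → Fin n → ℤ}
  {x : (n : ℕ) → ℝ → Fin n → ℝ} {b : (n : ℕ) → ℝ → Fin n → ℤ}

lemma IsSolution.abs_charge_le {n : ℕ} (h : IsSolution T (x₀ n) (b₀ n) (x n) (b n)) {t : ℝ}
    (ht : t ∈ Icc 0 T) (i : Fin n) : |b n t i| ≤ 1 := by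
  obtain ⟨S, hS⟩ := h
  exact (hS.state t ht).abs_le i

/-- The empirical measures of the particle systems are tight, uniformly in time. -/
lemma exists_variation_compl_le_of_isSolution
    (hsol : ∀ n ≥ 2, IsSolution T (x₀ n) (b₀ n) (x n) (b n))
    (hmom : ∀ e > 0, ∃ R₀ > 0, ∀ R ≥ R₀, ∀ n ≥ 2,
      (∑ i, |(b₀ n i : ℝ)| * bump (x₀ n i / R)) / n ≤ e) {e : ℝ} (he : 0 < e) :
    ∃ R₀, ∀ R ≥ R₀, ∀ n ≥ 2, ∀ t ∈ Icc 0 T,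
      (empirical (x n t) (b n t)).variation (Ioc (-R) R)ᶜ ≤ ENNReal.ofReal e := by
  obtain ⟨R₁, hR₁, h1⟩ := hmom (e / 4) (by positivity)
  -- The drift 3t / R² is then at most e / 4, using R ≤ R². With e / 4 from the initial moment and
  -- the factor 2 of the tail bound this adds up to e.
  refine ⟨max R₁ (max 1 (12 * T / e)), fun R hR n hn t ht => ?_⟩
  have hR0 : 0 < R := hR₁.trans_le ((le_max_left _ _).trans hR)
  have hR1 : 1 ≤ R := (le_max_left _ _).trans ((le_max_right _ _).trans hR)
  have hRT : 12 * T / e ≤ R := (le_max_right _ _).trans ((le_max_right _ _).trans hR)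
  have hn0 : (0 : ℝ) < n := by exact_mod_cast (by omega : 0 < n)
  obtain ⟨S, hS⟩ := hsol n hn
  have h2 := hS.moment_le (by omega) hR0 t ht
  have h3 := h1 R ((le_max_left _ _).trans hR) n hn
  refine (variation_empirical_compl_le hR0).trans (ENNReal.ofReal_le_ofReal ?_)
  have h4 : (∑ i, |(b n t i : ℝ)| * bump (x n t i / R)) / n ≤ e / 4 + 3 * t / R ^ 2 := by
    rw [div_le_iff₀ hn0] at h3 ⊢
    refine h2.trans ((add_le_add_left h3 _).trans (le_of_eq ?_))
    ring
  have h5 : 3 * t / R ^ 2 ≤ e / 4 := by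
    rw [div_le_iff₀ (by positivity)]
    rw [div_le_iff₀ he] at hRT
    have : R ≤ R ^ 2 := by nlinarith
    nlinarith [ht.2]
  linarith

/-- The uniform limit of the cumulative functions is the cumulative function of a signed measure
without atoms. -/
lemma exists_signedMeasure_of_tendsto {y : (n : ℕ) → Fin n → ℝ} {c : (n : ℕ) → Fin n → ℤ}
    (hc : ∀ n ≥ 2, ∀ i, |c n i| ≤ 1) {f : ℝ → ℝ} (hf : Continuous f)
    (h : ∀ e > 0, ∀ᶠ n in atTop, ∀ z, |(cnt (y n) (c n) z : ℝ) / n - f z| ≤ e) :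
    ∃ κ : SignedMeasure ℝ, (∀ z, κ (Iic z) = f z) ∧ ∀ z, κ {z} = 0 := by
  refine exists_signedMeasure_Iic hf ?_ ?_
  · refine Metric.tendsto_nhds.2 fun e he => ?_
    obtain ⟨n, hn⟩ := (h (e / 2) (half_pos he)).exists
    have h1 := tendsto_signedMeasure_Iic_atBot (empirical (y n) (c n))
    filter_upwards [Metric.tendsto_nhds.1 h1 (e / 2) (half_pos he)] with z hz
    rw [empirical_Iic] at hz
    rw [Real.dist_eq, sub_zero] at hz ⊢
    have h2 := hn z
    rw [abs_lt] at hz ⊢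
    rw [abs_le] at h2
    constructor <;> linarith [hz.1, hz.2, h2.1, h2.2]
  -- Variation is lower semicontinuous under pointwise convergence, and the approximating cumulative
  -- functions have variation at most 1.
  · refine ne_top_of_le_ne_top (ENNReal.ofReal_ne_top (r := 1)) (not_lt.1 fun hlt => ?_)
    have h1 := eVariationOn.lowerSemicontinuous_aux
      (F := fun (n : ℕ) z => (cnt (y n) (c n) z : ℝ) / n) (p := atTop) (s := univ) (f := f)
      (fun z _ => Metric.tendsto_nhds.2 fun e he => (h (e / 2) (half_pos he)).mono fun n hn =>
        (hn z).trans_lt (half_lt_self he)) hlt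
    obtain ⟨n, hn1, hn2⟩ := (h1.and (eventually_ge_atTop 2)).exists
    exact absurd hn1 (not_lt.2 (eVariationOn_cnt_le (hc n hn2)))

end Limit

end ChargedParticles

end

/-! ### Assembly of the main theorem. -/

open ChargedParticles in
theorem corollary5p6 (T : ℝ) (hT : 0 < T)
    (x₀ : (n : ℕ) → Fin n → ℝ) (b₀ : (n : ℕ) → Fin n → ℤ)
    (hstate : ∀ n ≥ 2, IsState (x₀ n) (b₀ n))
    (κ₀ : SignedMeasure ℝ)
    (hconv : ∃ (s : ℕ → ℝ) (ω : ℝ → ℝ), Tendsto s atTop (𝓝 0) ∧ IsModulus ω ∧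
      ConvergesWith s ω (fun n => empirical (x₀ n) (b₀ n)) κ₀)
    (x : (n : ℕ) → ℝ → Fin n → ℝ) (b : (n : ℕ) → ℝ → Fin n → ℤ)
    (hsol : ∀ n ≥ 2, IsSolution T (x₀ n) (b₀ n) (x n) (b n)) :
    ∃ (κ : ℝ → SignedMeasure ℝ) (u : ℝ × ℝ → ℝ),
      -- the measures of the particle systems converge to `κ`, uniformly in the times `tₙ → t`
      (∃ (s : ℕ → ℝ) (ω : ℝ → ℝ), Tendsto s atTop (𝓝 0) ∧ IsModulus ω ∧
        ∀ t ∈ Icc 0 T, ∀ τ : ℕ → ℝ, (∀ n, τ n ∈ Icc 0 T) → Tendsto τ atTop (𝓝 t) →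
          ConvergesWith s ω (fun n => empirical (x n (τ n)) (b n (τ n))) (κ t)) ∧
      -- these measures are bounded in total variation and tight, uniformly in time
      (∃ C : ENNReal, C ≠ ⊤ ∧ ∀ n ≥ 2, ∀ t ∈ Icc 0 T,
        (empirical (x n t) (b n t)).totalVariation univ ≤ C) ∧
      IsTightMeasureSet
        {m : Measure ℝ | ∃ n ≥ 2, ∃ t ∈ Icc 0 T, m = (empirical (x n t) (b n t)).totalVariation} ∧
      -- `u` is the cumulative function of `κ`, and `κ` is determined by `u`
      (∀ t ∈ Icc 0 T, ∀ y, u (t, y) = κ t (Iic y)) ∧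
      (∀ κ' : ℝ → SignedMeasure ℝ, (∀ t ∈ Icc 0 T, ∀ y, u (t, y) = κ' t (Iic y)) →
        ∀ t ∈ Icc 0 T, κ' t = κ t) ∧
      -- `u` is the unique viscosity solution on `Q` with initial datum `κ₀ (-∞, y]`
      (∀ y, u (0, y) = κ₀ (Iic y)) ∧
      (∀ ρ > 0, IsViscositySolution ρ u) ∧
      HasInitialDatum u (fun y => κ₀ (Iic y)) ∧
      ∀ ρ > 0, ∀ v : ℝ × ℝ → ℝ, IsViscositySolution ρ v →
        HasInitialDatum v (fun y => κ₀ (Iic y)) → EqOn v u Q := by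
  obtain ⟨s, ω, hs, hω, hc⟩ := hconv
  have hlim₀ : ∀ φ : ℝ → ℝ, Continuous φ → (∀ y, |φ y| ≤ 1) →
      Tendsto (fun n => lint (empirical (x₀ n) (b₀ n)) φ) atTop (𝓝 (lint κ₀ φ)) :=
    fun φ hφ hφ1 => tendsto_lint_of_convergesWith hc hφ hφ1
  obtain ⟨B, hB, hf⟩ := hc.isBUC hs hω
  obtain ⟨W, hWB, hWmod, hWcont, hW0, hWs, hWs', hWv, hWi, hWu⟩ := exists_unique_solution hB hf
    (tendsto_signedMeasure_Iic_atBot κ₀) (tendsto_signedMeasure_Iic_atTop κ₀)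
  have hb : ∀ n ≥ 2, ∀ t ∈ Icc 0 T, ∀ i, |b n t i| ≤ 1 :=
    fun n hn t ht i => (hsol n hn).abs_charge_le ht i
  have hunif : ∀ e > 0, ∀ᶠ n in atTop, ∀ t ∈ Icc 0 T, ∀ y,
      |(cnt (x n t) (b n t) y : ℝ) / n - W (t, y)| ≤ e := by
    intro e he
    obtain ⟨N, d, hd, hN⟩ := exists_particle_abs_le hT hB hf.continuous
      (tendsto_signedMeasure_Iic_atBot κ₀) (tendsto_signedMeasure_Iic_atTop κ₀) hf.bound hWmod hWB
      hW0 hWs hWs' he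
    filter_upwards [eventually_ge_atTop N, eventually_ge_atTop 2,
      hc.eventually_abs_cnt_sub_le hstate hs hω hd] with n hn hn2 hnd
    obtain ⟨S, hS⟩ := hsol n hn2
    exact hN n hn (by omega) _ _ _ _ S hS hnd
  -- Indexing by pairs (t, y) gives one null sequence for all times, so arbitrary sequences of times
  -- are covered without further work.
  obtain ⟨s', hs', hcnt⟩ := exists_null_sequence (ι := Icc 0 T × ℝ)
    (fun n p => (cnt (x n p.1) (b n p.1) p.2 : ℝ) / n - W (p.1, p.2))
    (fun n hn => ⟨1 + B, fun p => (abs_sub _ _).trans (add_le_add (by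
      rw [abs_div, Nat.abs_cast]
      exact div_le_one_of_le₀ (by exact_mod_cast abs_cnt_le (hb n hn _ p.1.2) p.2)
        (Nat.cast_nonneg n)) (hWB _))⟩)
    (fun e he => (hunif e he).mono fun n hn p => hn _ p.1.2 _)
  obtain ⟨ω', hω', hWω⟩ := hWmod.exists_isModulus hWB
  -- Outside [0, T] the value is irrelevant and set to 0, although W solves the equation for all
  -- positive times.
  have hκ : ∀ t, ∃ κ : SignedMeasure ℝ, t ∈ Icc 0 T →
      (∀ y, κ (Iic y) = W (t, y)) ∧ ∀ y, κ {y} = 0 := by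
    intro t
    by_cases ht : t ∈ Icc 0 T
    · obtain ⟨κ, h1, h2⟩ := exists_signedMeasure_of_tendsto (fun n hn => hb n hn t ht)
        (f := fun y => W (t, y)) (by fun_prop) fun e he => (hunif e he).mono fun n hn => hn t ht
      exact ⟨κ, fun _ => ⟨h1, h2⟩⟩
    · exact ⟨0, fun h => absurd h ht⟩
  choose κ hκ using hκ
  have htight : ∀ e > 0, ∃ R₀, ∀ R ≥ R₀, ∀ n ≥ 2, ∀ t ∈ Icc 0 T,
      (empirical (x n t) (b n t)).variation (Ioc (-R) R)ᶜ ≤ ENNReal.ofReal e :=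
    fun e he => exists_variation_compl_le_of_isSolution hsol
      (fun e he => exists_moment_le hstate hlim₀ he) he
  -- The factor 2 accounts for the two end points of (x, y]; between them the spatial modulus of W
  -- applies.
  refine ⟨κ, W, ⟨fun n => 2 * s' n, ω', by simpa using hs'.const_mul 2, hω',
    fun t ht τ hτ hτt => ⟨fun φ => ?_, (hκ t ht).2, fun n hn y z hyz => ?_⟩⟩,
    ⟨ENNReal.ofReal 1, ENNReal.ofReal_ne_top, fun n hn t ht => ?_⟩, ?_,
    fun t ht y => ((hκ t ht).1 y).symm, fun κ' hκ' t ht => ?_, hW0, hWv, hWi, hWu⟩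
  · refine tendsto_lint (C := 1) zero_le_one ?_ (fun e he => ?_) (fun y => ?_) φ.continuous
      φ.norm_coe_le_norm
    · filter_upwards [eventually_ge_atTop 2] with n hn
      exact variation_empirical_univ_le (hb n hn _ (hτ n))
    · obtain ⟨R₀, hR₀⟩ := htight e he
      exact ⟨R₀, fun R hR => (eventually_ge_atTop 2).mono fun n hn => hR₀ R hR n hn _ (hτ n)⟩
    · simp_rw [empirical_Iic]
      rw [(hκ t ht).1]
      have h1 : Tendsto (fun n => (cnt (x n (τ n)) (b n (τ n)) y : ℝ) / n - W (τ n, y)) atTop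
          (𝓝 0) := by
        refine squeeze_zero_norm' ?_ hs'
        filter_upwards [eventually_ge_atTop 2] with n hn
        exact hcnt n hn ⟨⟨τ n, hτ n⟩, y⟩
      have h2 : Tendsto (fun n => W (τ n, y)) atTop (𝓝 (W (t, y))) :=
        (hWcont.tendsto (t, y)).comp (hτt.prodMk_nhds tendsto_const_nhds)
      simpa using h1.add h2
  · rw [signedMeasure_Ioc _ hyz, empirical_Iic, empirical_Iic]
    have h1 := hcnt n hn ⟨⟨τ n, hτ n⟩, y⟩
    have h2 := hcnt n hn ⟨⟨τ n, hτ n⟩, z⟩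
    have h3 := hWω (τ n) (hτ n).1 y z
    simp only at h1 h2
    rw [abs_sub_comm y z] at h3 ⊢
    rw [abs_le] at h1 h2 h3 ⊢
    constructor <;> linarith [h1.1, h1.2, h2.1, h2.2, h3.1, h3.2]
  · rw [SignedMeasure.totalVariation_eq_variation]
    exact variation_empirical_univ_le (hb n hn t ht)
  · refine isTightMeasureSet_iff_exists_isCompact_measure_compl_le.2 fun ε hε => ?_
    obtain ⟨e, he, heε⟩ : ∃ e : ℝ, 0 < e ∧ ENNReal.ofReal e ≤ ε := by
      obtain ⟨r, hr0, hr⟩ := ENNReal.lt_iff_exists_real_btwn.1 hε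
      exact ⟨r, ENNReal.ofReal_pos.1 hr.1, hr.2.le⟩
    obtain ⟨R, hR⟩ := htight e he
    refine ⟨Icc (-R) R, isCompact_Icc, ?_⟩
    rintro _ ⟨n, hn, t, ht, rfl⟩
    rw [SignedMeasure.totalVariation_eq_variation]
    exact (measure_mono (compl_subset_compl.2 Ioc_subset_Icc_self)).trans
      ((hR R le_rfl n hn t ht).trans heε)
  · refine signedMeasure_ext_of_Iic fun y => ?_
    rw [← hκ' t ht y, (hκ t ht).1 y]
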